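/- Theorem 2.5. Let $p$ be a prime and let $\mathcal A_p$ be the mod $p$ Steenrod algebra. An unstable $\mathcal A_p$-algebra is a graded commutative algebra $B=\bigoplus_{n\ge 0}B^n$ over $\mathbb F_p$ with a graded $\mathcal A_p$-module structure satisfying the Cartan formula, the instability condition ($Sq^i x=0$ for $i>|x|$ if $p=2$; $\beta^{e}P^i x=0$ for $e+2i>|x|$, $e\in\{0,1\}$, if $p$ is odd), and $Sq^{|x|}x=x^2$ if $p=2$, respectively $P^{|x|/2}x=x^p$ for $|x|$ even if $p$ is odd. It is finitely generated if there is a finite subset $S\subseteq B$ such that $B$ is the only $\mathcal A_p$-stable $\mathbb F_p$-subalgebra of $B$ containing $S$. Let $B$ be a finitely generated unstable $\mathcal A_p$-algebra which is connected ($B^0=\mathbb F_p\cdot 1$) and is a graded Hopf algebra, i.e. it is equipped with an augmentation $\varepsilon\colon B\to\mathbb F_p$ and a degree-preserving algebra morphism $\Delta\colon B\to B\otimes B$ (where $(a\otimes b)(c\otimes d)=(-1)^{|b||c|}ac\otimes bd$) having $\varepsilon$ as two-sided counit. (Neither coassociativity of $\Delta$ nor its compatibility with the Steenrod operations is required.)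 Let $A\subseteq B$ be an unstable Hopf subalgebra, i.e. a graded $\mathbb F_p$-subalgebra, stable under $\mathcal A_p$, with $\Delta(A)\subseteq A\otimes A$. Then $A$, with the induced grading and $\mathcal A_p$-action, is also a finitely generated unstable $\mathcal A_p$-algebra. -/

import Mathlib

open scoped TensorProduct DirectSum

noncomputable section

/-! ## The mod `p` Steenrod algebra -/

/-- Generators of the mod `p` Steenrod algebra: the Bockstein `β` and the operations `P^i`, `i ≥ 0`.
For `p = 2` the symbol `P i` stands for the Steenrod square `Sq^i`. -/
inductive SteenrodGen : Type
  | bockstein : SteenrodGen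
  | P (i : ℕ) : SteenrodGen

namespace SteenrodAlgebra

/-- The generator `P^i` (`Sq^i` if `p = 2`) in the free algebra. -/
def freeP (p i : ℕ) : FreeAlgebra (ZMod p) SteenrodGen :=
  FreeAlgebra.ι (ZMod p) (SteenrodGen.P i)

/-- The generator `β` in the free algebra. -/
def freeB (p : ℕ) : FreeAlgebra (ZMod p) SteenrodGen :=
  FreeAlgebra.ι (ZMod p) SteenrodGen.bockstein

/-- The defining relations of the mod `p` Steenrod algebra: `P^0 = 1` and the Adem relations, for
`p = 2` with `β = Sq^1`, and for odd `p` with `β² = 0`. All natural-number subtractions below are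
honest ones in the indicated ranges. -/
inductive Rel (p : ℕ) :
    FreeAlgebra (ZMod p) SteenrodGen → FreeAlgebra (ZMod p) SteenrodGen → Prop
  | P_zero : Rel p (freeP p 0) 1
  | bockstein_two (hp : p = 2) : Rel p (freeB p) (freeP p 1)
  | adem_two (hp : p = 2) (a b : ℕ) (ha : 0 < a) (hab : a < 2 * b) :
      Rel p (freeP p a * freeP p b)
        (∑ t ∈ Finset.range (a / 2 + 1),
          (((b - 1 - t).choose (a - 2 * t) : ℕ) : ZMod p) • (freeP p (a + b - t) * freeP p t))
  | bockstein_sq (hp : p ≠ 2) : Rel p (freeB p * freeB p) 0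
  | adem_odd (hp : p ≠ 2) (a b : ℕ) (ha : 0 < a) (hab : a < p * b) :
      Rel p (freeP p a * freeP p b)
        (∑ t ∈ Finset.range (a / p + 1),
          ((-1 : ZMod p) ^ (a + t) * (((p - 1) * (b - t) - 1).choose (a - p * t) : ℕ)) •
            (freeP p (a + b - t) * freeP p t))
  | adem_bockstein_odd (hp : p ≠ 2) (a b : ℕ) (ha : 0 < a) (hab : a ≤ p * b) :
      Rel p (freeP p a * freeB p * freeP p b)
        ((∑ t ∈ Finset.range (a / p + 1),
          ((-1 : ZMod p) ^ (a + t) * (((p - 1) * (b - t)).choose (a - p * t) : ℕ)) •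
            (freeB p * freeP p (a + b - t) * freeP p t)) +
        ∑ t ∈ Finset.range ((a - 1) / p + 1),
          ((-1 : ZMod p) ^ (a + t + 1) * (((p - 1) * (b - t) - 1).choose (a - p * t - 1) : ℕ)) •
            (freeP p (a + b - t) * freeB p * freeP p t))

end SteenrodAlgebra

/-- The mod `p` Steenrod algebra `𝒜_p`, by generators and relations. -/
def SteenrodAlgebra (p : ℕ) : Type := RingQuot (SteenrodAlgebra.Rel p)

namespace SteenrodAlgebra

instance instRing (p : ℕ) : Ring (SteenrodAlgebra p) :=
  inferInstanceAs (Ring (RingQuot (SteenrodAlgebra.Rel p)))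

instance instAlgebra (p : ℕ) : Algebra (ZMod p) (SteenrodAlgebra p) :=
  inferInstanceAs (Algebra (ZMod p) (RingQuot (SteenrodAlgebra.Rel p)))

/-- The projection from the free algebra. -/
def mk (p : ℕ) : FreeAlgebra (ZMod p) SteenrodGen →ₐ[ZMod p] SteenrodAlgebra p :=
  RingQuot.mkAlgHom (ZMod p) (SteenrodAlgebra.Rel p)

/-- The operation `P^i ∈ 𝒜_p`; for `p = 2` this is `Sq^i`. -/
def P (p i : ℕ) : SteenrodAlgebra p := mk p (freeP p i)

/-- The Bockstein `β ∈ 𝒜_p`; for `p = 2` this is `Sq^1`. -/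
def bockstein (p : ℕ) : SteenrodAlgebra p := mk p (freeB p)

/-- The degree of `P^i`: it is `2i(p-1)` for odd `p`, and `i` for `Sq^i` when `p = 2`. -/
def degP (p i : ℕ) : ℕ := if p = 2 then i else 2 * i * (p - 1)

end SteenrodAlgebra

open SteenrodAlgebra

/-! ## Unstable algebras over the Steenrod algebra -/

section Unstable

variable (p : ℕ) {B : Type*} [Ring B] [Algebra (ZMod p) B]
  (𝒜 : ℕ → Submodule (ZMod p) B) [GradedAlgebra 𝒜]
  [Module (SteenrodAlgebra p) B]

/-- A nonnegatively graded `𝔽_p`-algebra `B = ⨁ₙ 𝒜 n` with an action of the Steenrod algebra is an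
*unstable algebra* if it is graded commutative, a graded `𝒜_p`-module, unstable as such, satisfies
the Cartan formula, and `P^{|x|/2} x = x^p` for `|x|` even (`Sq^{|x|} x = x²` if `p = 2`). -/
structure IsUnstableAlgebra : Prop where
  /-- graded commutativity -/
  mul_comm : ∀ (m n : ℕ), ∀ x ∈ 𝒜 m, ∀ y ∈ 𝒜 n, x * y = (-1) ^ (m * n) * (y * x)
  P_mem : ∀ (i n : ℕ), ∀ x ∈ 𝒜 n, P p i • x ∈ 𝒜 (n + degP p i)
  bockstein_mem : ∀ (n : ℕ), ∀ x ∈ 𝒜 n, bockstein p • x ∈ 𝒜 (n + 1)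
  /-- Cartan formula for `P^i` -/
  cartan_P : ∀ (i : ℕ) (x y : B),
    P p i • (x * y) = ∑ jk ∈ Finset.HasAntidiagonal.antidiagonal i, (P p jk.1 • x) * (P p jk.2 • y)
  /-- Cartan formula for `β` -/
  cartan_bockstein : ∀ (n : ℕ), ∀ x ∈ 𝒜 n, ∀ y : B,
    bockstein p • (x * y) = (bockstein p • x) * y + (-1) ^ n * (x * (bockstein p • y))
  /-- instability for `p = 2`: `Sq^i x = 0` if `i > |x|` -/
  unstable_two : p = 2 → ∀ (n : ℕ), ∀ x ∈ 𝒜 n, ∀ i : ℕ, n < i → P p i • x = 0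
  /-- instability for odd `p`: `β^e P^i x = 0` if `e + 2i > |x|`, `e ∈ {0, 1}` -/
  unstable_odd : p ≠ 2 → ∀ (n : ℕ), ∀ x ∈ 𝒜 n, ∀ e i : ℕ, e ≤ 1 → n < e + 2 * i →
    (bockstein p ^ e * P p i) • x = 0
  top_two : p = 2 → ∀ (n : ℕ), ∀ x ∈ 𝒜 n, P p n • x = x ^ 2
  top_odd : p ≠ 2 → ∀ (k : ℕ), ∀ x ∈ 𝒜 (2 * k), P p k • x = x ^ p

/-- A *finitely generated unstable `𝒜_p`-algebra*: an unstable algebra that is generated, as an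
algebra over the Steenrod algebra, by a finite set `S`, i.e. the only subalgebra that contains `S`
and is stable under all Steenrod operations is the whole algebra. -/
structure IsFGUnstableAlgebra : Prop extends IsUnstableAlgebra p 𝒜 where
  fg : ∃ S : Finset B, ∀ C : Subalgebra (ZMod p) B,
    (∀ (θ : SteenrodAlgebra p), ∀ x ∈ C, θ • x ∈ C) → (S : Set B) ⊆ C → C = ⊤

/-- An *unstable subalgebra*: a graded subalgebra stable under all Steenrod operations. -/
structure UnstableSubalgebra extends Subalgebra (ZMod p) B where
  homogeneous' : ∀ (n : ℕ), ∀ x ∈ carrier, (DirectSum.decompose 𝒜 x n : B) ∈ carrier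
  steenrod_mem' : ∀ (θ : SteenrodAlgebra p), ∀ x ∈ carrier, θ • x ∈ carrier

namespace UnstableSubalgebra

variable {p 𝒜} (A : UnstableSubalgebra p 𝒜)

/-- The restricted action of the Steenrod algebra on an unstable subalgebra. -/
instance instSMul : SMul (SteenrodAlgebra p) A.toSubalgebra where
  smul θ x := ⟨θ • (x : B), A.steenrod_mem' θ x x.2⟩

@[simp] theorem coe_smul (θ : SteenrodAlgebra p) (x : A.toSubalgebra) :
    ((θ • x : A.toSubalgebra) : B) = θ • (x : B) := rfl

instance instModule : Module (SteenrodAlgebra p) A.toSubalgebra where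
  one_smul x := Subtype.ext (one_smul _ (x : B))
  mul_smul θ η x := Subtype.ext (mul_smul θ η (x : B))
  smul_zero θ := Subtype.ext (smul_zero θ)
  smul_add θ x y := Subtype.ext (smul_add θ (x : B) (y : B))
  add_smul θ η x := Subtype.ext (add_smul θ η (x : B))
  zero_smul x := Subtype.ext (zero_smul _ (x : B))

instance instIsScalarTower [IsScalarTower (ZMod p) (SteenrodAlgebra p) B] :
    IsScalarTower (ZMod p) (SteenrodAlgebra p) A.toSubalgebra where
  smul_assoc c θ x := Subtype.ext (smul_assoc c θ (x : B))

/-- The induced grading `A^n = A ∩ B^n` of an unstable subalgebra `A` of `B`. -/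
def grading (n : ℕ) : Submodule (ZMod p) A.toSubalgebra :=
  (𝒜 n).comap A.toSubalgebra.val.toLinearMap

theorem mem_grading {n : ℕ} {x : A.toSubalgebra} : x ∈ A.grading n ↔ (x : B) ∈ 𝒜 n := Iff.rfl

instance instGradedMonoid : SetLike.GradedMonoid A.grading where
  one_mem := SetLike.GradedOne.one_mem (A := 𝒜)
  mul_mem _ _ _ _ hx hy := SetLike.GradedMul.mul_mem (A := 𝒜) hx hy

theorem isInternal_grading : DirectSum.IsInternal A.grading := by
  constructor
  · intro f g hfg
    have hB := (DirectSum.Decomposition.isInternal 𝒜).1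
    let φ : ∀ i, A.grading i →+ 𝒜 i := fun i =>
      { toFun := fun x => ⟨((x : A.toSubalgebra) : B), x.2⟩
        map_zero' := rfl
        map_add' := fun _ _ => rfl }
    have key : ∀ h : ⨁ i, A.grading i,
        DirectSum.coeAddMonoidHom 𝒜 (DirectSum.map φ h) =
          ((DirectSum.coeAddMonoidHom A.grading h : A.toSubalgebra) : B) := by
      intro h
      induction h using DirectSum.induction_on with
      | zero => simp
      | of i x => simp [φ]
      | add x y hx hy => simp only [map_add, hx, hy]; rfl
    have h2 : DirectSum.map φ f = DirectSum.map φ g := hB (by rw [key, key, hfg])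
    refine DFinsupp.ext fun i => ?_
    have h3 := DFunLike.congr_fun h2 i
    exact Subtype.ext (Subtype.ext (congrArg (fun z : 𝒜 i => (z : B)) h3))
  · intro x
    classical
    refine ⟨∑ i ∈ (DirectSum.decompose 𝒜 (x : B)).support,
      DirectSum.of (fun i => A.grading i) i
        ⟨⟨DirectSum.decompose 𝒜 (x : B) i, A.homogeneous' i x x.2⟩,
          (DirectSum.decompose 𝒜 (x : B) i).2⟩, ?_⟩
    apply Subtype.ext
    rw [map_sum]
    simp only [DirectSum.coeAddMonoidHom_of, AddSubmonoidClass.coe_finsetSum]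
    exact DirectSum.sum_support_decompose 𝒜 (x : B)

instance instGradedAlgebra : GradedAlgebra A.grading where
  __ := A.instGradedMonoid
  __ := A.isInternal_grading.chooseDecomposition

end UnstableSubalgebra

end Unstable

/-! ## Hopf algebras -/

section Hopf

open GradedTensorProduct

variable (p : ℕ) {B : Type*} [Ring B] [Algebra (ZMod p) B]
  (𝒜 : ℕ → Submodule (ZMod p) B) [GradedAlgebra 𝒜]

/-- A *graded Hopf algebra* structure on a graded `𝔽_p`-algebra `B`: an augmentation `ε` and a
degree-preserving coproduct `Δ : B → B ⊗ B` that is a morphism of algebras for the graded (Koszul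
sign) multiplication `(a ⊗ b)(c ⊗ d) = (-1)^{|b||c|} ac ⊗ bd` on `B ⊗ B` and has `ε` as two-sided
counit. Coassociativity is not required (the cohomology of an `H`-space need not be coassociative),
so coassociative Hopf algebras are a special case. -/
structure GradedHopfAlgebra where
  comul : B →ₐ[ZMod p] 𝒜 ᵍ⊗[ZMod p] 𝒜
  counit : B →ₐ[ZMod p] ZMod p
  counit_of_pos : ∀ n : ℕ, 0 < n → ∀ x ∈ 𝒜 n, counit x = 0
  comul_mem : ∀ (n : ℕ), ∀ x ∈ 𝒜 n, (of (ZMod p) 𝒜 𝒜).symm (comul x) ∈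
    ⨆ (i : ℕ) (j : ℕ) (_ : i + j = n), LinearMap.range (TensorProduct.mapIncl (𝒜 i) (𝒜 j))
  counit_comul : ∀ x : B,
    counit.toLinearMap.rTensor B ((of (ZMod p) 𝒜 𝒜).symm (comul x)) = 1 ⊗ₜ[ZMod p] x
  comul_counit : ∀ x : B,
    counit.toLinearMap.lTensor B ((of (ZMod p) 𝒜 𝒜).symm (comul x)) = x ⊗ₜ[ZMod p] 1

variable {p 𝒜} in
/-- A subalgebra `A ⊆ B` is a *Hopf subalgebra* if `Δ(A) ⊆ A ⊗ A`. -/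
def GradedHopfAlgebra.IsHopfSubalgebra (H : GradedHopfAlgebra p 𝒜)
    (A : Subalgebra (ZMod p) B) : Prop :=
  ∀ x ∈ A, (of (ZMod p) 𝒜 𝒜).symm (H.comul x) ∈
    LinearMap.range (TensorProduct.mapIncl (Subalgebra.toSubmodule A) (Subalgebra.toSubmodule A))

end Hopf

end

/-!
# Hopf subalgebras of finitely generated unstable algebras

Let `I = ker ε` be the augmentation ideal of `B` and filter `B` by the powers `fil ε n` of `I`.
As `B` is connected, `fil ε n` vanishes in degrees below `n`, so it is enough to describe `A` modulo
higher filtration. Only the following *symbols* turn out to matter: the classes in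
`fil q / fil (q + 1)` of `x ^ q`, where `q = p ^ j` and `x` is an even class, and the classes
modulo `fil 2` of odd classes.

**The Hopf structure** shows that symbols generate. A functional `ψ` on `B` that kills
`fil (q + 1)` gives the operator `∂ = (ψ ⊗ 1) ∘ Δ`, which lowers the filtration by at most `q`, and
which modulo higher filtration is a derivation with `∂ (x ^ q) = ψ (x ^ q)`, because
`Δ x - x ⊗ 1 - 1 ⊗ x` lies in `I ⊗ I` up to a constant, and `x ↦ x ^ q` is additive on even
classes. It maps `A` to itself, as `A` is a Hopf subalgebra, and annihilates `A` if `ψ` does. Hence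
if `w = x ^ q` is not congruent to an element of `A` modulo `fil (q + 1)`, then `w` can be
eliminated from the leading terms of elements of `A` (choose `ψ` with `ψ w = 1` and `ψ A = 0`);
otherwise the coefficients of the powers of `w` in an element of `A` can be recovered by applying
`∂` repeatedly, with `w` replaced by its representative
(`exists_sub_mem_of_mem_adjoinFam`). Applying this first to odd classes and then to `x`, `x ^ p`,
`x ^ p ^ 2`, … one finds that a homogeneous subalgebra `C ⊆ A` in which all symbols of `A` have
representatives is equal to `A` (`le_of_symbols`). Coassociativity is not used.

**The Steenrod operations** show that the symbols of `A` are finitely generated. By the Cartan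
formula the total operation is multiplicative, so `P^{iq} (x ^ q) = (P^i x) ^ q` for even `x`
(`power_pow`). Therefore the even classes `x` for which `x ^ p ^ j` has a representative in `A`
form a submodule `evenSymbols` of `B`, closed under the `P^i`, which contains the decomposables and
increases with `j`; likewise for the odd symbols. So everything follows from a Noetherian property
of the module of indecomposables of `B`: as an unstable module that is finitely generated over the
algebra of reduced powers, it satisfies the ascending chain condition
(`chainCondition_of_generated`). Its proof is an induction that measures how far the module is from
being an iterated suspension: the top operations `x ↦ P^{|x|} x` (suitably shifted) span a
submodule, they commute with the reduced powers up to a factor `p` in the index by the Adem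
relations, and so a submodule is controlled by the chain of its preimages under the top operation
together with its image in the quotient by the top classes, whose suspension degree is larger. For
odd `p` a similar induction (`exists_finset_reducedPower_generators`) shows that a module that is
finitely generated over the Steenrod algebra is already finitely generated over the reduced powers.

Quotients and associated graded objects never appear: submodules of quotients are submodules
containing a given family `L`, and all congruences are taken in `B`.
-/

open scoped TensorProduct DirectSum

namespace SteenrodFG

/-! ### The Noetherian property of unstable modules over the reduced powers -/

section Noetherian

variable {k M : Type*} [Field k] [AddCommGroup M] [Module k M]

/-- A family `Q d` of submodules, thought of as the degree-`d` parts of a graded submodule, is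
*closed* under operations `P i` of degree `i * s`. -/
def OpClosed (s : ℕ) (P : ℕ → M →ₗ[k] M) (Q : ℕ → Submodule k M) : Prop :=
  ∀ i d, ∀ x ∈ Q d, P i x ∈ Q (d + i * s)

/-- The part of the Adem relations (for `p = s + 1`) that the Noetherian property depends on: the
inadmissible product `P a ∘ P b` is a combination of products `P (a + b - t) ∘ P t` with
`t ≤ a / p`, in which the extreme term `t = a / p` has coefficient `1` if `p ∣ a`. -/
def AdemLike (s : ℕ) (P : ℕ → M →ₗ[k] M) : Prop :=
  ∀ a b, a < (s + 1) * b → ∃ c : ℕ → k,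
    (∀ x, P a (P b x) = ∑ t ∈ Finset.range (a / (s + 1) + 1), c t • P (a + b - t) (P t x)) ∧
      ((s + 1) ∣ a → c (a / (s + 1)) = 1)

/-- Instability relative to `L`, with the bound lowered by `e`: modulo `L`, the family `𝓜` behaves
like the `e`-fold suspension of an unstable module. -/
def UnstableMod (s : ℕ) (P : ℕ → M →ₗ[k] M) (L 𝓜 : ℕ → Submodule k M) (e : ℕ) : Prop :=
  ∀ d i, ∀ x ∈ 𝓜 d, d < i + e → P i x ∈ L (d + i * s)

/-- The ascending chain condition for closed families between `L` and `𝓜`. -/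
def ChainCondition (s : ℕ) (P : ℕ → M →ₗ[k] M) (L 𝓜 : ℕ → Submodule k M) : Prop :=
  ∀ Q : ℕ → ℕ → Submodule k M, (∀ j, OpClosed s P (Q j)) → (∀ j, L ≤ Q j) → (∀ j, Q j ≤ 𝓜) →
    Monotone Q → ∃ j₀, ∀ j ≥ j₀, Q j = Q j₀

variable {s : ℕ} {P : ℕ → M →ₗ[k] M} {L 𝓜 : ℕ → Submodule k M} {e : ℕ}

theorem OpClosed.sup {Q Q' : ℕ → Submodule k M} (hQ : OpClosed s P Q) (hQ' : OpClosed s P Q') :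
    OpClosed s P (Q ⊔ Q') := by
  intro i d x hx
  obtain ⟨y, hy, z, hz, rfl⟩ := Submodule.mem_sup.1 hx
  rw [map_add]
  exact Submodule.add_mem_sup (hQ i d y hy) (hQ' i d z hz)

theorem mem_of_deg_eq {Q : ℕ → Submodule k M} {d d' : ℕ} {x : M} (h : x ∈ Q d) (hd : d = d') :
    x ∈ Q d' := hd ▸ h

/-- On a class of degree `e + b` the operation `P b` is the top one; modulo `L` it commutes with
the operations up to the factor `p = s + 1` in the index. -/
theorem top_sub_mem (hA : AdemLike s P) (hL : OpClosed s P L)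
    (hM : OpClosed s P 𝓜) (hU : UnstableMod s P L 𝓜 e) {b t : ℕ} {x : M} (hx : x ∈ 𝓜 (e + b)) :
    P ((s + 1) * t) (P b x) - P (b + s * t) (P t x) ∈
      L (e + b + b * s + (s + 1) * t * s) := by
  rcases lt_trichotomy t b with h | rfl | h
  · obtain ⟨c, hc, hc1⟩ := hA ((s + 1) * t) b (by gcongr)
    have hdiv : (s + 1) * t / (s + 1) = t := Nat.mul_div_cancel_left _ (by omega)
    rw [hc x, hdiv, Finset.sum_range_succ, ← hdiv, hc1 (dvd_mul_right _ _), hdiv, one_smul]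
    have h1 : (s + 1) * t + b - t = b + s * t := by
      have : (s + 1) * t = s * t + t := by ring
      omega
    rw [h1, add_sub_cancel_right]
    refine Submodule.sum_mem _ fun u hu => Submodule.smul_mem _ _ ?_
    have hu' : u < t := Finset.mem_range.1 hu
    obtain ⟨v, rfl⟩ := Nat.exists_eq_add_of_lt hu'
    have h2 : (s + 1) * (u + v + 1) + b - u = s * u + (s + 1) * (v + 1) + b := by
      have : (s + 1) * (u + v + 1) = s * u + (s + 1) * (v + 1) + u := by ring
      omega
    rw [h2]
    refine mem_of_deg_eq (hU _ _ _ (hM u _ x hx) ?_) (by ring)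
    nlinarith
  · rw [show t + s * t = (s + 1) * t by ring, sub_self]; exact zero_mem _
  · refine sub_mem (hU _ _ _ (hM b _ x hx) ?_) ?_
    · nlinarith
    · exact mem_of_deg_eq (hL _ _ _ (hU _ _ _ hx (by omega))) (by ring)

theorem top_mem_of_not_dvd (hA : AdemLike s P)
    (hM : OpClosed s P 𝓜) (hU : UnstableMod s P L 𝓜 e) {a b : ℕ} {x : M} (hx : x ∈ 𝓜 (e + b))
    (ha : ¬ (s + 1) ∣ a) : P a (P b x) ∈ L (e + b + b * s + a * s) := by
  rcases lt_or_ge a ((s + 1) * b) with h | h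
  · obtain ⟨c, hc, -⟩ := hA a b h
    rw [hc x]
    refine Submodule.sum_mem _ fun u hu => Submodule.smul_mem _ _ ?_
    have hu1 : u ≤ a / (s + 1) := Nat.lt_succ_iff.1 (Finset.mem_range.1 hu)
    have hu2 : (s + 1) * u < a := by
      refine lt_of_le_of_ne ?_ fun h => ha ⟨u, h.symm⟩
      calc (s + 1) * u ≤ (s + 1) * (a / (s + 1)) := by gcongr
        _ ≤ a := Nat.mul_div_le _ _
    obtain ⟨v, hv⟩ := Nat.exists_eq_add_of_lt hu2
    have h2 : a + b - u = s * u + v + 1 + b := by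
      have : (s + 1) * u = s * u + u := by ring
      omega
    rw [h2]
    refine mem_of_deg_eq (hU _ _ _ (hM u _ x hx) ?_) ?_
    · nlinarith
    · rw [hv]; ring
  · refine hU _ _ _ (hM b _ x hx) ?_
    have : a ≠ (s + 1) * b := fun h => ha ⟨b, h⟩
    have : (s + 1) * b < a := by omega
    nlinarith

/-- The family `L` enlarged by the images of the top operations. Modulo it, `𝓜` is a suspension
once more. -/
def addTop (s : ℕ) (P : ℕ → M →ₗ[k] M) (L 𝓜 : ℕ → Submodule k M) (e d : ℕ) : Submodule k M :=
  L d ⊔ ⨆ (b : ℕ) (_ : e + (s + 1) * b = d), (𝓜 (e + b)).map (P b)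

theorem le_addTop : L ≤ addTop s P L 𝓜 e := fun _ => le_sup_left

theorem top_mem_addTop {b d : ℕ} {x : M} (hx : x ∈ 𝓜 (e + b)) (hd : e + (s + 1) * b = d) :
    P b x ∈ addTop s P L 𝓜 e d :=
  Submodule.mem_sup_right <| Submodule.mem_iSup_of_mem b <|
    Submodule.mem_iSup_of_mem hd (Submodule.mem_map_of_mem hx)

theorem mem_addTop {d : ℕ} {y : M} (hy : y ∈ addTop s P L 𝓜 e d) :
    y ∈ L d ∨ ∃ b, e + (s + 1) * b = d ∧ ∃ l ∈ L d, ∃ x ∈ 𝓜 (e + b), y = l + P b x := by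
  by_cases h : ∃ b, e + (s + 1) * b = d
  · obtain ⟨b, hb⟩ := h
    right
    refine ⟨b, hb, ?_⟩
    have h2 : ⨆ (b' : ℕ) (_ : e + (s + 1) * b' = d), (𝓜 (e + b')).map (P b') ≤
        (𝓜 (e + b)).map (P b) := by
      refine iSup₂_le fun b' hb' => ?_
      have : b' = b := Nat.eq_of_mul_eq_mul_left (Nat.succ_pos s)
        (by simp only [Nat.succ_eq_add_one]; omega)
      rw [this]
    obtain ⟨l, hl, z, hz, rfl⟩ := Submodule.mem_sup.1 hy
    obtain ⟨x, hx, rfl⟩ := h2 hz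
    exact ⟨l, hl, x, hx, rfl⟩
  · left
    have h2 : ⨆ (b' : ℕ) (_ : e + (s + 1) * b' = d), (𝓜 (e + b')).map (P b') = ⊥ := by
      simp only [iSup_eq_bot]
      exact fun b hb => absurd ⟨b, hb⟩ h
    rwa [addTop, h2, sup_bot_eq] at hy

theorem addTop_le (hM : OpClosed s P 𝓜) (hLM : L ≤ 𝓜) : addTop s P L 𝓜 e ≤ 𝓜 := by
  intro d y hy
  rcases mem_addTop hy with h | ⟨b, rfl, l, hl, x, hx, rfl⟩
  · exact hLM d h
  · exact add_mem (hLM _ hl) (mem_of_deg_eq (hM b _ x hx) (by ring))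

theorem addTop_closed (hA : AdemLike s P) (hL : OpClosed s P L)
    (hM : OpClosed s P 𝓜) (hU : UnstableMod s P L 𝓜 e) : OpClosed s P (addTop s P L 𝓜 e) := by
  intro a d y hy
  rcases mem_addTop hy with h | ⟨b, rfl, l, hl, x, hx, rfl⟩
  · exact le_addTop _ (hL a d y h)
  · rw [map_add]
    refine add_mem (le_addTop _ (hL a _ l hl)) ?_
    by_cases ha : (s + 1) ∣ a
    · obtain ⟨t, rfl⟩ := ha
      rw [← sub_add_cancel (P ((s + 1) * t) (P b x)) (P (b + s * t) (P t x))]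
      refine add_mem (le_addTop _ (mem_of_deg_eq (top_sub_mem hA hL hM hU hx) (by ring))) ?_
      refine top_mem_addTop (mem_of_deg_eq (hM t _ x hx) (by ring)) (by ring)
    · exact le_addTop _ (mem_of_deg_eq (top_mem_of_not_dvd hA hM hU hx ha) (by ring))

theorem addTop_unstable (hU : UnstableMod s P L 𝓜 e) :
    UnstableMod s P (addTop s P L 𝓜 e) 𝓜 (e + 1) := by
  intro d i x hx hd
  rcases Nat.lt_or_ge d (i + e) with h | h
  · exact le_addTop _ (hU d i x hx h)
  · obtain rfl : d = e + i := by omega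
    exact top_mem_addTop hx (by ring)

/-- The preimage of `Q` under the top operation. -/
def topComap (s : ℕ) (P : ℕ → M →ₗ[k] M) (𝓜 : ℕ → Submodule k M) (e : ℕ)
    (Q : ℕ → Submodule k M) (d : ℕ) : Submodule k M :=
  𝓜 d ⊓ (Q (d + (d - e) * s)).comap (P (d - e))

theorem mem_topComap {Q : ℕ → Submodule k M} {d : ℕ} {x : M} :
    x ∈ topComap s P 𝓜 e Q d ↔ x ∈ 𝓜 d ∧ P (d - e) x ∈ Q (d + (d - e) * s) := Iff.rfl

theorem mem_topComap_add {Q : ℕ → Submodule k M} {b : ℕ} {x : M} :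
    x ∈ topComap s P 𝓜 e Q (e + b) ↔ x ∈ 𝓜 (e + b) ∧ P b x ∈ Q (e + b + b * s) := by
  rw [mem_topComap, Nat.add_sub_cancel_left]

theorem topComap_closed (hP0 : ∀ x, P 0 x = x) (hA : AdemLike s P) (hL : OpClosed s P L)
    (hM : OpClosed s P 𝓜) (hU : UnstableMod s P L 𝓜 e) {Q : ℕ → Submodule k M}
    (hQ : OpClosed s P Q) (hLQ : L ≤ Q) : OpClosed s P (topComap s P 𝓜 e Q) := by
  rintro t d x ⟨hx, hx'⟩
  rw [mem_topComap]
  refine ⟨hM t d x hx, ?_⟩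
  replace hx' : P (d - e) x ∈ Q (d + (d - e) * s) := hx'
  rcases Nat.lt_or_ge d e with h | h
  · have hxL : x ∈ L d := by simpa [hP0] using hU d 0 x hx (by omega)
    exact hLQ _ (hL _ _ _ (hL t d x hxL))
  · obtain ⟨b, rfl⟩ := Nat.exists_eq_add_of_le h
    have h1 : e + b + t * s - e = b + s * t := by rw [mul_comm]; omega
    rw [h1]
    rw [Nat.add_sub_cancel_left] at hx'
    rw [← sub_sub_self (P ((s + 1) * t) (P b x)) (P (b + s * t) (P t x))]
    refine sub_mem (mem_of_deg_eq (hQ ((s + 1) * t) _ _ hx') (by ring)) ?_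
    exact hLQ _ (mem_of_deg_eq (top_sub_mem hA hL hM hU hx) (by ring))

theorem topComap_mono {Q Q' : ℕ → Submodule k M} (h : Q ≤ Q') :
    topComap s P 𝓜 e Q ≤ topComap s P 𝓜 e Q' :=
  fun _ _ hx => ⟨hx.1, h _ hx.2⟩

theorem le_topComap {Q : ℕ → Submodule k M} (hQ : OpClosed s P Q) (hQM : Q ≤ 𝓜) :
    Q ≤ topComap s P 𝓜 e Q := fun d x hx => ⟨hQM d hx, hQ _ d x hx⟩

/-- A monotone double sequence whose monotone subsequences all stabilise is eventually constant in
the first index, uniformly in the second. -/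
theorem exists_forall_stable {α : Type*} [PartialOrder α] {f : ℕ → ℕ → α}
    (h1 : ∀ j, Monotone (f j)) (h2 : ∀ i, Monotone fun j => f j i)
    (hdiag : ∃ n, ∀ m ≥ n, f m m = f n n) (hrow : ∀ i, ∃ n, ∀ m ≥ n, f m i = f n i) :
    ∃ n, ∀ m ≥ n, ∀ i, f m i = f n i := by
  obtain ⟨a, ha⟩ := hdiag
  choose g hg using hrow
  refine ⟨a + ∑ i ∈ Finset.range a, g i, fun m hm i => ?_⟩
  set n := a + ∑ i ∈ Finset.range a, g i with hn
  rcases Nat.lt_or_ge i a with h | h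
  · have : g i ≤ n := by
      have := Finset.single_le_sum (f := g) (fun _ _ => Nat.zero_le _) (Finset.mem_range.2 h)
      omega
    rw [hg i m (this.trans hm), hg i n this]
  · have key : ∀ m ≥ a, f m i = f a a := fun m hm => by
      refine le_antisymm ?_ ((h1 a h).trans (h2 i hm))
      rw [← ha (max m i) (by omega)]
      exact (h1 m (le_max_right m i)).trans (h2 _ (le_max_left m i))
    rw [key m (by omega), key n (by omega)]

/-- Submodules between `X` and a finite-dimensional extension of `X` satisfy the ascending chain
condition. -/
theorem exists_stable_of_fg {X F : Submodule k M} (hF : F.FG) {Q : ℕ → Submodule k M}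
    (hQ : Monotone Q) (hX : ∀ j, X ≤ Q j) (hQF : ∀ j, Q j ≤ X ⊔ F) :
    ∃ n, ∀ m ≥ n, Q m = Q n := by
  have : Module.Finite k F := Module.Finite.iff_fg.2 hF
  obtain ⟨n, hn⟩ := monotone_stabilizes_iff_noetherian.2 (inferInstance : IsNoetherian k F)
    ⟨fun j => (Q j).comap F.subtype, fun i j h => Submodule.comap_mono (hQ h)⟩
  refine ⟨n, fun m hm => le_antisymm (fun x hx => ?_) (hQ hm)⟩
  obtain ⟨y, hy, z, hz, rfl⟩ := Submodule.mem_sup.1 (hQF m hx)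
  refine add_mem (hX n hy) ?_
  have hz' : z ∈ Q m := by simpa using sub_mem hx (hX m hy)
  have : (⟨z, hz⟩ : F) ∈ (Q m).comap F.subtype := hz'
  have h3 : (Q n).comap F.subtype = (Q m).comap F.subtype := hn m hm
  rw [← h3] at this
  exact this

/-- The chain condition for the quotient by the top operations implies the chain condition. -/
theorem chainCondition_of_addTop (hs : 1 ≤ s) (hP0 : ∀ x, P 0 x = x) (hA : AdemLike s P)
    (hL : OpClosed s P L) (hM : OpClosed s P 𝓜) (hLM : L ≤ 𝓜) (hU : UnstableMod s P L 𝓜 e)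
    (hfin : ∃ F : Submodule k M, F.FG ∧ 𝓜 e ≤ L e ⊔ F)
    (h : ChainCondition s P (addTop s P L 𝓜 e) 𝓜) : ChainCondition s P L 𝓜 := by
  intro Q hQ hLQ hQM hQmono
  -- `R j i` consists of the classes that land in `Q j` after `i` top operations
  let R : ℕ → ℕ → ℕ → Submodule k M := fun j i => (topComap s P 𝓜 e)^[i] (Q j)
  have hRs : ∀ j i, R j (i + 1) = topComap s P 𝓜 e (R j i) :=
    fun j i => Function.iterate_succ_apply' _ _ _
  have hR : ∀ j i, OpClosed s P (R j i) ∧ L ≤ R j i ∧ R j i ≤ 𝓜 := by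
    intro j i
    induction i with
    | zero => exact ⟨hQ j, hLQ j, hQM j⟩
    | succ i ih =>
      rw [hRs]
      exact ⟨topComap_closed hP0 hA hL hM hU ih.1 ih.2.1,
        ih.2.1.trans (le_topComap ih.1 ih.2.2), fun d x hx => hx.1⟩
  have hR1 : ∀ j, Monotone (R j) := fun j => monotone_nat_of_le_succ fun i => by
    rw [hRs]; exact le_topComap (hR j i).1 (hR j i).2.2
  have hR2 : ∀ i, Monotone fun j => R j i := by
    intro i
    induction i with
    | zero => exact hQmono
    | succ i ih => intro j j' hj; simp only [hRs]; exact topComap_mono (ih hj)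
  have hL' := addTop_closed hA hL hM hU
  have hcl : ∀ j i, OpClosed s P (R j i ⊔ addTop s P L 𝓜 e) := fun j i => (hR j i).1.sup hL'
  have hle : ∀ j i, R j i ⊔ addTop s P L 𝓜 e ≤ 𝓜 :=
    fun j i => sup_le (hR j i).2.2 (addTop_le hM hLM)
  obtain ⟨n₁, hn₁⟩ := exists_forall_stable (f := fun j i => R j i ⊔ addTop s P L 𝓜 e)
    (fun j i i' hi => sup_le_sup_right (hR1 j hi) _)
    (fun i j j' hj => sup_le_sup_right (hR2 i hj) _)
    (h (fun j => R j j ⊔ addTop s P L 𝓜 e) (fun j => hcl j j) (fun j => le_sup_right)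
      (fun j => hle j j)
      fun j j' hj => sup_le_sup_right ((hR1 j hj).trans (hR2 j' hj)) _)
    (fun i => h (fun j => R j i ⊔ addTop s P L 𝓜 e) (fun j => hcl j i) (fun j => le_sup_right)
      (fun j => hle j i) fun j j' hj => sup_le_sup_right (hR2 i hj) _)
  obtain ⟨F, hF, hMF⟩ := hfin
  obtain ⟨n₂, hn₂⟩ := exists_stable_of_fg (X := L e) hF (Q := fun j => Q j e)
    (fun i j hij => hQmono hij e) (fun j => hLQ j e) (fun j => (hQM j e).trans hMF)
  have hRe : ∀ j i, R j i e = Q j e := by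
    intro j i
    induction i with
    | zero => rfl
    | succ i ih =>
      rw [hRs]
      ext x
      have h0 : e - e = 0 := Nat.sub_self e
      rw [mem_topComap, h0, hP0, zero_mul, add_zero, ih]
      exact ⟨fun h => h.2, fun h => ⟨hQM j e h, h⟩⟩
  set n := max n₁ n₂
  -- by induction on the degree: modulo the top classes `R j i` agrees with `R n i`, and the top
  -- classes in `R j i` come from smaller degree in `R j (i + 1)`
  have key : ∀ d i, ∀ j ≥ n, R j i d ≤ R n i d := by
    intro d
    induction d using Nat.strong_induction_on with
    | _ d ih =>
      intro i j hj x hx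
      have hxM := (hR j i).2.2 d hx
      rcases lt_trichotomy d e with hd | rfl | hd
      · have hxL : x ∈ L d := by simpa [hP0] using hU d 0 x hxM (by omega)
        exact (hR n i).2.1 d hxL
      · rw [hRe] at hx ⊢
        rw [hn₂ n (le_max_right _ _), ← hn₂ j ((le_max_right _ _).trans hj)]
        exact hx
      · have hx' : x ∈ (R n i ⊔ addTop s P L 𝓜 e) d := by
          have h1 := (hn₁ j ((le_max_left _ _).trans hj) i).trans
            (hn₁ n (le_max_left _ _) i).symm
          rw [← h1]
          exact Submodule.mem_sup_left hx
        obtain ⟨y, hy, l, hl, rfl⟩ := Submodule.mem_sup.1 hx'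
        refine add_mem hy ?_
        rcases mem_addTop hl with hl' | ⟨b, hb, l, hl', z, hz, rfl⟩
        · exact (hR n i).2.1 d hl'
        · refine add_mem ((hR n i).2.1 d hl') ?_
          have h1 : P b z ∈ R j i d := by
            have h2 := sub_mem hx (hR2 i hj d hy)
            rw [add_sub_cancel_left] at h2
            simpa using sub_mem h2 ((hR j i).2.1 d hl')
          have hbpos : 0 < b := by
            rcases Nat.eq_zero_or_pos b with h | h
            · subst h; omega
            · exact h
          have hdeg : e + b + b * s = d := by rw [← hb]; ring
          have h3 : z ∈ R j (i + 1) (e + b) := by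
            rw [hRs, mem_topComap_add, hdeg]
            exact ⟨hz, h1⟩
          have h4 := ih (e + b) (by nlinarith) (i + 1) j hj h3
          rw [hRs, mem_topComap_add, hdeg] at h4
          exact h4.2
  exact ⟨n, fun j hj => le_antisymm (fun d => key d 0 j hj) (hQmono hj)⟩

/-- **Finitely generated unstable modules are Noetherian.** The module is `𝓜` modulo `L`; it is
finite in each degree, generated in degrees at most `N`, and behaves like an `e`-fold suspension.
If `e` exceeds `N` there are no generators left; otherwise pass to `addTop`, which increases `e`. -/
theorem chainCondition_of_generated (hs : 1 ≤ s) (hP0 : ∀ x, P 0 x = x) (hA : AdemLike s P)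
    (hM : OpClosed s P 𝓜) {N : ℕ} :
    ∀ (n e : ℕ), e + n = N + 1 → ∀ L : ℕ → Submodule k M, OpClosed s P L → L ≤ 𝓜 →
      UnstableMod s P L 𝓜 e → (∀ d, ∃ F : Submodule k M, F.FG ∧ 𝓜 d ≤ L d ⊔ F) →
      (∀ Q, OpClosed s P Q → L ≤ Q → (∀ d ≤ N, 𝓜 d ≤ Q d) → 𝓜 ≤ Q) →
      ChainCondition s P L 𝓜 := by
  intro n
  induction n with
  | zero =>
    intro e he L hL hLM hU _ hgen
    have hML : 𝓜 ≤ L := hgen L hL le_rfl fun d hd x hx => by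
      simpa [hP0] using hU d 0 x hx (by omega)
    exact fun Q _ h1 h2 _ => ⟨0, fun j _ =>
      le_antisymm ((h2 j).trans (hML.trans (h1 0))) ((h2 0).trans (hML.trans (h1 j)))⟩
  | succ n ih =>
    intro e he L hL hLM hU hfin hgen
    refine chainCondition_of_addTop hs hP0 hA hL hM hLM hU (hfin e) ?_
    refine ih (e + 1) (by omega) _ (addTop_closed hA hL hM hU) (addTop_le hM hLM)
      (addTop_unstable hU) (fun d => ?_) fun Q hQ hLQ => hgen Q hQ (le_addTop.trans hLQ)
    obtain ⟨F, hF, h⟩ := hfin d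
    exact ⟨F, hF, h.trans (sup_le_sup_right (le_addTop d) F)⟩

/-- Under the chain condition, every closed family between `L` and `𝓜` is finitely generated
modulo `L`. -/
theorem ChainCondition.exists_finset (h : ChainCondition s P L 𝓜)
    {W : ℕ → Submodule k M} (hW : OpClosed s P W) (hLW : L ≤ W) (hWM : W ≤ 𝓜) :
    ∃ S : Finset (ℕ × M), (∀ x ∈ S, x.2 ∈ W x.1) ∧
      ∀ Q, OpClosed s P Q → L ≤ Q → (∀ x ∈ S, x.2 ∈ Q x.1) → W ≤ Q := by
  classical
  -- otherwise generators can be added one at a time to give a strictly increasing chain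
  by_contra! hcon
  -- the closed family generated by a finite set
  let gen : Finset (ℕ × M) → ℕ → Submodule k M := fun S d =>
    ⨅ (Q : ℕ → Submodule k M) (_ : OpClosed s P Q ∧ L ≤ Q ∧ ∀ x ∈ S, x.2 ∈ Q x.1), Q d
  have gen_mem : ∀ S d x, x ∈ gen S d ↔
      ∀ Q, OpClosed s P Q → L ≤ Q → (∀ y ∈ S, y.2 ∈ Q y.1) → x ∈ Q d := by
    intro S d x
    simp only [gen, Submodule.mem_iInf]
    exact ⟨fun h Q h1 h2 h3 => h Q ⟨h1, h2, h3⟩, fun h Q ⟨h1, h2, h3⟩ => h Q h1 h2 h3⟩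
  have step : ∀ S : {S : Finset (ℕ × M) // ∀ x ∈ S, x.2 ∈ W x.1},
      ∃ S' : {S : Finset (ℕ × M) // ∀ x ∈ S, x.2 ∈ W x.1}, S.1 ⊆ S'.1 ∧ ¬ gen S'.1 ≤ gen S.1 := by
    rintro ⟨S, hS⟩
    obtain ⟨Q, hQ, hLQ, hSQ, hne⟩ := hcon S hS
    simp only [Pi.le_def, SetLike.le_def, not_forall] at hne
    obtain ⟨d, x, hx, hxQ⟩ := hne
    refine ⟨⟨insert (d, x) S, ?_⟩, Finset.subset_insert _ _, fun hle => hxQ ?_⟩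
    · intro y hy
      rcases Finset.mem_insert.1 hy with rfl | hy
      exacts [hx, hS y hy]
    · have h1 : x ∈ gen (insert (d, x) S) d :=
        (gen_mem _ _ _).2 fun Q' _ _ h3 => h3 (d, x) (Finset.mem_insert_self _ _)
      exact (gen_mem _ _ _).1 (hle d h1) Q hQ hLQ hSQ
  choose f hf1 hf2 using step
  let T : ℕ → {S : Finset (ℕ × M) // ∀ x ∈ S, x.2 ∈ W x.1} := fun n => f^[n] ⟨∅, by simp⟩
  have hT : ∀ n, T (n + 1) = f (T n) := fun n => Function.iterate_succ_apply' _ _ _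
  obtain ⟨n, hn⟩ := h (fun n => gen (T n).1)
    (fun n i d x hx => (gen_mem _ _ _).2 fun Q h1 h2 h3 =>
      h1 i d x ((gen_mem _ _ _).1 hx Q h1 h2 h3))
    (fun n d x hx => (gen_mem _ _ _).2 fun Q h1 h2 h3 => h2 d hx)
    (fun n d x hx => hWM d ((gen_mem _ _ _).1 hx W hW hLW (T n).2))
    (monotone_nat_of_le_succ fun n d x hx => (gen_mem _ _ _).2 fun Q h1 h2 h3 =>
      (gen_mem _ _ _).1 hx Q h1 h2 fun y hy => h3 y (by rw [hT]; exact hf1 _ hy))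
  have h5 := hn (n + 1) (by omega)
  simp only [hT] at h5
  exact hf2 (T n) h5.le

end Noetherian

/-! ### Modules with a Bockstein are finitely generated over the reduced powers -/

section Bockstein

variable {k M : Type*} [Field k] [AddCommGroup M] [Module k M]

/-- The part of the Adem relations for `P a ∘ β ∘ P b` (`p = s + 1` odd) that the argument
depends on. -/
def BocksteinAdemLike (s : ℕ) (P : ℕ → M →ₗ[k] M) (β : M →ₗ[k] M) : Prop :=
  ∀ a b, 0 < a → a ≤ (s + 1) * b → ∃ c c' : ℕ → k,
    (∀ x, P a (β (P b x)) =
      ∑ t ∈ Finset.range (a / (s + 1) + 1), c t • β (P (a + b - t) (P t x)) +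
        ∑ t ∈ Finset.range ((a - 1) / (s + 1) + 1), c' t • P (a + b - t) (β (P t x))) ∧
      ((s + 1) ∣ a → c (a / (s + 1)) = 1)

/-- Instability for odd primes relative to `L`, with the bound lowered by `e`. Degrees are actual
degrees, so that `P i` has degree `i * (2 * s)`. -/
def BocksteinUnstableMod (s : ℕ) (P : ℕ → M →ₗ[k] M) (β : M →ₗ[k] M)
    (L 𝓜 : ℕ → Submodule k M) (e : ℕ) : Prop :=
  ∀ d i, ∀ x ∈ 𝓜 d, (d < 2 * i + e → P i x ∈ L (d + i * (2 * s))) ∧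
    (d < 1 + 2 * i + e → β (P i x) ∈ L (d + i * (2 * s) + 1))

variable {s : ℕ} {P : ℕ → M →ₗ[k] M} {β : M →ₗ[k] M} {L 𝓜 : ℕ → Submodule k M} {e : ℕ}

/-- In the degrees congruent to `e` modulo `2`, the operations `P i` form a family of the kind
considered without Bocksteins. -/
theorem BocksteinUnstableMod.shift (hU : BocksteinUnstableMod s P β L 𝓜 e) :
    UnstableMod s P (fun d => L (e + 2 * d)) (fun d => 𝓜 (e + 2 * d)) 0 := fun d i x hx hd =>
  mem_of_deg_eq ((hU _ i x hx).1 (by omega)) (by ring)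

theorem OpClosed.shift {Q : ℕ → Submodule k M} (hQ : OpClosed (2 * s) P Q) (e : ℕ) :
    OpClosed s P fun d => Q (e + 2 * d) := fun i d x hx =>
  mem_of_deg_eq (hQ i _ x hx) (by ring)

theorem BocksteinUnstableMod.mem_of_lt (hP0 : ∀ x, P 0 x = x)
    (hU : BocksteinUnstableMod s P β L 𝓜 e) {d : ℕ} {x : M} (hx : x ∈ 𝓜 d) (hd : d < e) :
    x ∈ L d := by
  simpa [hP0] using (hU d 0 x hx).1 (by omega)

/-- Modulo `L`, the operation `x ↦ β (P b x)` on classes of degree `e + 2 * b + 1` commutes with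
the reduced powers, up to the factor `p = s + 1` in the index. -/
theorem bockstein_top_sub_mem (hP0 : ∀ x, P 0 x = x)
    (hA : BocksteinAdemLike s P β) (hL : OpClosed (2 * s) P L)
    (hLβ : ∀ d, ∀ x ∈ L d, β x ∈ L (d + 1))
    (hM : OpClosed (2 * s) P 𝓜) (hMβ : ∀ d, ∀ x ∈ 𝓜 d, β x ∈ 𝓜 (d + 1)) (hs : 1 ≤ s)
    (hU : BocksteinUnstableMod s P β L 𝓜 e) {b t : ℕ} {x : M} (hx : x ∈ 𝓜 (e + 2 * b + 1)) :
    P ((s + 1) * t) (β (P b x)) - β (P (b + s * t) (P t x)) ∈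
      L (e + 2 * (s + 1) * b + 2 + (s + 1) * t * (2 * s)) := by
  rcases Nat.eq_zero_or_pos t with rfl | htpos
  · simp [hP0]
  rcases le_or_gt t b with h | h
  · obtain ⟨c, c', hc, hc1⟩ := hA ((s + 1) * t) b (by positivity) (by gcongr)
    have hdiv : (s + 1) * t / (s + 1) = t := Nat.mul_div_cancel_left _ (by omega)
    rw [hc x, hdiv, Finset.sum_range_succ, ← hdiv, hc1 (dvd_mul_right _ _), hdiv, one_smul]
    have h1 : (s + 1) * t + b - t = b + s * t := by
      have : (s + 1) * t = s * t + t := by ring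
      omega
    rw [h1, add_sub_right_comm, add_sub_cancel_right]
    refine add_mem (Submodule.sum_mem _ fun u hu => Submodule.smul_mem _ _ ?_)
      (Submodule.sum_mem _ fun u hu => Submodule.smul_mem _ _ ?_)
    · have hu' : u < t := Finset.mem_range.1 hu
      obtain ⟨v, rfl⟩ := Nat.exists_eq_add_of_lt hu'
      have h2 : (s + 1) * (u + v + 1) + b - u = s * u + (s + 1) * (v + 1) + b := by
        have : (s + 1) * (u + v + 1) = s * u + (s + 1) * (v + 1) + u := by ring
        omega
      rw [h2]
      refine mem_of_deg_eq ((hU _ _ _ (hM u _ x hx)).2 ?_) (by ring)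
      nlinarith
    · have hu' : u ≤ ((s + 1) * t - 1) / (s + 1) := Nat.lt_succ_iff.1 (Finset.mem_range.1 hu)
      have hu'' : u < t := by
        have h3 : (s + 1) * u ≤ (s + 1) * t - 1 :=
          (Nat.mul_le_mul_left _ hu').trans (Nat.mul_div_le _ _)
        have h4 : 0 < (s + 1) * t := by positivity
        have h5 : (s + 1) * u < (s + 1) * t := by omega
        exact lt_of_mul_lt_mul_left h5 (by omega)
      obtain ⟨v, rfl⟩ := Nat.exists_eq_add_of_lt hu''
      have h2 : (s + 1) * (u + v + 1) + b - u = s * u + (s + 1) * (v + 1) + b := by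
        have : (s + 1) * (u + v + 1) = s * u + (s + 1) * (v + 1) + u := by ring
        omega
      rw [h2]
      refine mem_of_deg_eq ((hU _ _ _ (hMβ _ _ (hM u _ x hx))).1 ?_) (by ring)
      nlinarith
  · refine sub_mem (mem_of_deg_eq ((hU _ _ _ (hMβ _ _ (hM b _ x hx))).1 ?_) (by ring)) ?_
    · obtain ⟨v, rfl⟩ := Nat.exists_eq_add_of_lt h
      nlinarith
    · refine mem_of_deg_eq (hLβ _ _ (hL _ _ _ ((hU _ t _ hx).1 (by omega)))) (by ring)

/-- The family `L` enlarged by the classes `P b x` with `|x| = e + 2 * b` and `β (P b x)` with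
`|x| = e + 2 * b + 1`. -/
def addBocksteinTop (s : ℕ) (P : ℕ → M →ₗ[k] M) (β : M →ₗ[k] M) (L 𝓜 : ℕ → Submodule k M)
    (e d : ℕ) : Submodule k M :=
  Submodule.span k ((L d : Set M) ∪
    ({y | ∃ b, e + 2 * (s + 1) * b = d ∧ ∃ x ∈ 𝓜 (e + 2 * b), P b x = y} ∪
      {y | ∃ b, e + 2 * (s + 1) * b + 2 = d ∧ ∃ x ∈ 𝓜 (e + 2 * b + 1), β (P b x) = y}))

theorem addBocksteinTop_le_iff {d : ℕ} {X : Submodule k M} :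
    addBocksteinTop s P β L 𝓜 e d ≤ X ↔ L d ≤ X ∧
      (∀ b, e + 2 * (s + 1) * b = d → ∀ x ∈ 𝓜 (e + 2 * b), P b x ∈ X) ∧
      (∀ b, e + 2 * (s + 1) * b + 2 = d → ∀ x ∈ 𝓜 (e + 2 * b + 1), β (P b x) ∈ X) := by
  rw [addBocksteinTop, Submodule.span_le, Set.union_subset_iff, Set.union_subset_iff]
  refine and_congr Iff.rfl (and_congr ?_ ?_)
  · exact ⟨fun h b hb x hx => h ⟨b, hb, x, hx, rfl⟩, fun h _ ⟨b, hb, x, hx, hy⟩ =>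
      hy ▸ h b hb x hx⟩
  · exact ⟨fun h b hb x hx => h ⟨b, hb, x, hx, rfl⟩, fun h _ ⟨b, hb, x, hx, hy⟩ =>
      hy ▸ h b hb x hx⟩

theorem le_addBocksteinTop : L ≤ addBocksteinTop s P β L 𝓜 e :=
  fun _ => (addBocksteinTop_le_iff.1 le_rfl).1

theorem top_mem_addBocksteinTop {b d : ℕ} {x : M} (hx : x ∈ 𝓜 (e + 2 * b))
    (hd : e + 2 * (s + 1) * b = d) : P b x ∈ addBocksteinTop s P β L 𝓜 e d :=
  (addBocksteinTop_le_iff.1 le_rfl).2.1 b hd x hx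

theorem bockstein_top_mem_addBocksteinTop {b d : ℕ} {x : M} (hx : x ∈ 𝓜 (e + 2 * b + 1))
    (hd : e + 2 * (s + 1) * b + 2 = d) : β (P b x) ∈ addBocksteinTop s P β L 𝓜 e d :=
  (addBocksteinTop_le_iff.1 le_rfl).2.2 b hd x hx

theorem addBocksteinTop_le (hM : OpClosed (2 * s) P 𝓜) (hMβ : ∀ d, ∀ x ∈ 𝓜 d, β x ∈ 𝓜 (d + 1))
    (hLM : L ≤ 𝓜) : addBocksteinTop s P β L 𝓜 e ≤ 𝓜 := fun d =>
  addBocksteinTop_le_iff.2 ⟨hLM d,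
    fun b hb x hx => mem_of_deg_eq (hM b _ x hx) (by rw [← hb]; ring),
    fun b hb x hx => mem_of_deg_eq (hMβ _ _ (hM b _ x hx)) (by rw [← hb]; ring)⟩

theorem addBocksteinTop_closed_bockstein (hββ : ∀ x, β (β x) = 0)
    (hLβ : ∀ d, ∀ x ∈ L d, β x ∈ L (d + 1)) (hU : BocksteinUnstableMod s P β L 𝓜 e) :
    ∀ d, ∀ x ∈ addBocksteinTop s P β L 𝓜 e d, β x ∈ addBocksteinTop s P β L 𝓜 e (d + 1) := by
  intro d
  suffices addBocksteinTop s P β L 𝓜 e d ≤ (addBocksteinTop s P β L 𝓜 e (d + 1)).comap β from this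
  refine addBocksteinTop_le_iff.2 ⟨fun x hx => le_addBocksteinTop _ (hLβ d x hx), ?_, ?_⟩
  · intro b hb x hx
    refine le_addBocksteinTop _ (mem_of_deg_eq ((hU _ b x hx).2 (by omega)) ?_)
    rw [← hb]; ring
  · intro b hb x hx
    rw [Submodule.mem_comap, hββ]
    exact zero_mem _

theorem addBocksteinTop_closed (hs : 1 ≤ s) (hP0 : ∀ x, P 0 x = x) (hA : AdemLike s P)
    (hAβ : BocksteinAdemLike s P β) (hL : OpClosed (2 * s) P L)
    (hLβ : ∀ d, ∀ x ∈ L d, β x ∈ L (d + 1)) (hM : OpClosed (2 * s) P 𝓜)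
    (hMβ : ∀ d, ∀ x ∈ 𝓜 d, β x ∈ 𝓜 (d + 1)) (hU : BocksteinUnstableMod s P β L 𝓜 e) :
    OpClosed (2 * s) P (addBocksteinTop s P β L 𝓜 e) := by
  intro a d
  suffices addBocksteinTop s P β L 𝓜 e d ≤
    (addBocksteinTop s P β L 𝓜 e (d + a * (2 * s))).comap (P a) from this
  refine addBocksteinTop_le_iff.2 ⟨fun x hx => le_addBocksteinTop _ (hL a d x hx), ?_, ?_⟩
  · intro b hb x hx
    have hx' : x ∈ (fun d => 𝓜 (e + 2 * d)) (0 + b) := by simpa using hx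
    rw [Submodule.mem_comap]
    by_cases ha : (s + 1) ∣ a
    · obtain ⟨t, rfl⟩ := ha
      rw [← sub_add_cancel (P ((s + 1) * t) (P b x)) (P (b + s * t) (P t x))]
      refine add_mem (le_addBocksteinTop _ (mem_of_deg_eq
        (top_sub_mem hA (hL.shift e) (hM.shift e) hU.shift hx') ?_)) ?_
      · rw [← hb]; ring
      · refine top_mem_addBocksteinTop (mem_of_deg_eq (hM t _ x hx) (by ring)) ?_
        rw [← hb]; ring
    · refine le_addBocksteinTop _ (mem_of_deg_eq
        (top_mem_of_not_dvd hA (hM.shift e) hU.shift hx' ha) ?_)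
      rw [← hb]; ring
  · intro b hb x hx
    rw [Submodule.mem_comap]
    by_cases ha : (s + 1) ∣ a
    · obtain ⟨t, rfl⟩ := ha
      rw [← sub_add_cancel (P ((s + 1) * t) (β (P b x))) (β (P (b + s * t) (P t x)))]
      refine add_mem (le_addBocksteinTop _ (mem_of_deg_eq
        (bockstein_top_sub_mem hP0 hAβ hL hLβ hM hMβ hs hU hx) ?_)) ?_
      · rw [← hb]
      · refine bockstein_top_mem_addBocksteinTop (mem_of_deg_eq (hM t _ x hx) (by ring)) ?_
        rw [← hb]; ring
    have hapos : 0 < a := Nat.pos_of_ne_zero fun h => ha (h ▸ dvd_zero _)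
    have hdeg : e + 2 * b + 1 + b * (2 * s) + 1 = d := by rw [← hb]; ring
    have hβ : β (P b x) ∈ 𝓜 d := hdeg ▸ hMβ _ _ (hM b _ x hx)
    rcases le_or_gt a ((s + 1) * b) with hab | hab
    · obtain ⟨c, c', hc, -⟩ := hAβ a b hapos hab
      rw [hc x]
      refine add_mem (Submodule.sum_mem _ fun u hu => Submodule.smul_mem _ _ ?_)
        (Submodule.sum_mem _ fun u hu => Submodule.smul_mem _ _ ?_)
      · have hu1 : u ≤ a / (s + 1) := Nat.lt_succ_iff.1 (Finset.mem_range.1 hu)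
        have hu2 : (s + 1) * u < a := by
          refine lt_of_le_of_ne ?_ fun h => ha ⟨u, h.symm⟩
          exact (Nat.mul_le_mul_left _ hu1).trans (Nat.mul_div_le _ _)
        obtain ⟨v, hv⟩ := Nat.exists_eq_add_of_lt hu2
        have h2 : a + b - u = s * u + v + 1 + b := by
          have : (s + 1) * u = s * u + u := by ring
          omega
        rw [h2]
        refine le_addBocksteinTop _ (mem_of_deg_eq ((hU _ _ _ (hM u _ x hx)).2 ?_) ?_)
        · nlinarith
        · rw [← hb, hv]; ring
      · have hu1 : u ≤ (a - 1) / (s + 1) := Nat.lt_succ_iff.1 (Finset.mem_range.1 hu)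
        have hu2 : (s + 1) * u ≤ a - 1 :=
          (Nat.mul_le_mul_left _ hu1).trans (Nat.mul_div_le _ _)
        obtain ⟨v, hv⟩ := Nat.exists_eq_add_of_lt (show (s + 1) * u < a by omega)
        have h2 : a + b - u = s * u + v + 1 + b := by
          have : (s + 1) * u = s * u + u := by ring
          omega
        rw [h2]
        rcases Nat.eq_zero_or_pos v with rfl | hvpos
        · refine top_mem_addBocksteinTop
            (mem_of_deg_eq (hMβ _ _ (hM u _ x hx)) (by ring)) ?_
          rw [← hb, hv]; ring
        · refine le_addBocksteinTop _
            (mem_of_deg_eq ((hU _ _ _ (hMβ _ _ (hM u _ x hx))).1 ?_) ?_)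
          · nlinarith
          · rw [← hb, hv]; ring
    · rcases Nat.eq_or_lt_of_le (Nat.succ_le_of_lt hab) with h | h
      · refine top_mem_addBocksteinTop (mem_of_deg_eq hβ ?_) ?_
        · rw [← hb, ← h, Nat.succ_eq_add_one]; ring
        · rw [← hb, ← h, Nat.succ_eq_add_one]; ring
      · refine le_addBocksteinTop _ ((hU _ a _ hβ).1 ?_)
        rw [← hb]; simp only [Nat.succ_eq_add_one] at h; nlinarith

theorem addBocksteinTop_unstable (hU : BocksteinUnstableMod s P β L 𝓜 e) :
    BocksteinUnstableMod s P β (addBocksteinTop s P β L 𝓜 e) 𝓜 (e + 1) := by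
  intro d i x hx
  constructor
  · intro hd
    rcases Nat.lt_or_ge d (2 * i + e) with h | h
    · exact le_addBocksteinTop _ ((hU d i x hx).1 h)
    · obtain rfl : d = e + 2 * i := by omega
      exact top_mem_addBocksteinTop hx (by ring)
  · intro hd
    rcases Nat.lt_or_ge d (1 + 2 * i + e) with h | h
    · exact le_addBocksteinTop _ ((hU d i x hx).2 h)
    · obtain rfl : d = e + 2 * i + 1 := by omega
      exact bockstein_top_mem_addBocksteinTop hx (by ring)

/-- The classes on which the composite `β ∘ P b` of top operations lands in `Q`. -/
def bocksteinTopComap (s : ℕ) (P : ℕ → M →ₗ[k] M) (β : M →ₗ[k] M) (𝓜 : ℕ → Submodule k M)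
    (e : ℕ) (Q : ℕ → Submodule k M) (d : ℕ) : Submodule k M :=
  𝓜 d ⊓ ⨅ (b : ℕ) (_ : e + 2 * b + 1 = d),
    (Q (e + 2 * (s + 1) * b + 2)).comap (β ∘ₗ P b)

theorem mem_bocksteinTopComap {Q : ℕ → Submodule k M} {d : ℕ} {x : M} :
    x ∈ bocksteinTopComap s P β 𝓜 e Q d ↔ x ∈ 𝓜 d ∧
      ∀ b, e + 2 * b + 1 = d → β (P b x) ∈ Q (e + 2 * (s + 1) * b + 2) := by
  simp [bocksteinTopComap]

/-- An unstable module over the Steenrod algebra at an odd prime that is finitely generated is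
already finitely generated over the subalgebra of reduced powers, without the Bockstein. The
induction is the same as in `chainCondition_of_generated`. -/
theorem exists_finset_reducedPower_generators (hs : 1 ≤ s) (hP0 : ∀ x, P 0 x = x)
    (hA : AdemLike s P) (hAβ : BocksteinAdemLike s P β) (hββ : ∀ x, β (β x) = 0)
    (hM : OpClosed (2 * s) P 𝓜) (hMβ : ∀ d, ∀ x ∈ 𝓜 d, β x ∈ 𝓜 (d + 1)) {N : ℕ} :
    ∀ (n e : ℕ), e + n = N + 1 → ∀ L : ℕ → Submodule k M, OpClosed (2 * s) P L →
      (∀ d, ∀ x ∈ L d, β x ∈ L (d + 1)) → L ≤ 𝓜 → BocksteinUnstableMod s P β L 𝓜 e →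
      (∀ d, ∃ F : Finset M, (∀ x ∈ F, x ∈ 𝓜 d) ∧ 𝓜 d ≤ L d ⊔ Submodule.span k F) →
      (∀ Q, OpClosed (2 * s) P Q → (∀ d, ∀ x ∈ Q d, β x ∈ Q (d + 1)) → L ≤ Q →
        (∀ d ≤ N, 𝓜 d ≤ Q d) → 𝓜 ≤ Q) →
      ∃ S : Finset (ℕ × M), (∀ x ∈ S, x.2 ∈ 𝓜 x.1) ∧
        ∀ Q, OpClosed (2 * s) P Q → L ≤ Q → (∀ x ∈ S, x.2 ∈ Q x.1) → 𝓜 ≤ Q := by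
  classical
  intro n
  induction n with
  | zero =>
    intro e he L hL hLβ hLM hU _ hgen
    have hML : 𝓜 ≤ L := hgen L hL hLβ le_rfl fun d hd x hx =>
      hU.mem_of_lt hP0 hx (by omega)
    exact ⟨∅, by simp, fun Q _ hLQ _ => hML.trans hLQ⟩
  | succ n ih =>
    intro e he L hL hLβ hLM hU hfin hgen
    have hL' := addBocksteinTop_closed hs hP0 hA hAβ hL hLβ hM hMβ hU
    obtain ⟨S, hSM, hS⟩ := ih (e + 1) (by omega) (addBocksteinTop s P β L 𝓜 e) hL'
      (addBocksteinTop_closed_bockstein hββ hLβ hU)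
      (addBocksteinTop_le hM hMβ hLM) (addBocksteinTop_unstable hU)
      (fun d => by
        obtain ⟨F, hF, h⟩ := hfin d
        exact ⟨F, hF, h.trans (sup_le_sup_right (le_addBocksteinTop d) _)⟩)
      (fun Q hQ hQβ hLQ => hgen Q hQ hQβ (le_addBocksteinTop.trans hLQ))
    obtain ⟨F, hFM, hF⟩ := hfin e
    -- the new generators: those of the quotient, their images under `β ∘ P b`, and the classes
    -- of degree `e`, on which the top operation `P 0` is the identity
    let g : ℕ × M → ℕ × M := fun x =>
      (x.1 + (x.1 - e - 1) / 2 * (2 * s) + 1, β (P ((x.1 - e - 1) / 2) x.2))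
    refine ⟨S ∪ S.image g ∪ F.image (fun x => (e, x)), ?_, ?_⟩
    · intro x hx
      simp only [Finset.mem_union, Finset.mem_image] at hx
      rcases hx with (hx | ⟨y, hy, rfl⟩) | ⟨y, hy, rfl⟩
      · exact hSM x hx
      · exact hMβ _ _ (hM _ _ _ (hSM y hy))
      · exact hFM y hy
    · intro Q hQ hLQ hSQ
      have hSQ1 : ∀ x ∈ S, x.2 ∈ Q x.1 := fun x hx => hSQ x (by simp [hx])
      have hSQ2 : ∀ x ∈ S, (g x).2 ∈ Q (g x).1 := fun x hx =>
        hSQ (g x) <| Finset.mem_union_left _ <| Finset.mem_union_right _ <|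
          Finset.mem_image_of_mem g hx
      have he : 𝓜 e ≤ Q e := hF.trans <| sup_le (hLQ e) <| Submodule.span_le.2 fun x hx =>
        hSQ (e, x) (Finset.mem_union_right _ (Finset.mem_image_of_mem _ hx))
      have hβ : 𝓜 ≤ bocksteinTopComap s P β 𝓜 e Q := by
        refine hS _ ?_ ?_ ?_
        · intro t d x hx
          rw [mem_bocksteinTopComap] at hx ⊢
          refine ⟨hM t d x hx.1, fun b hb => ?_⟩
          rcases Nat.lt_or_ge d (e + 1) with hd | hd
          · have hd' : d < e := by
              have : t * (2 * s) = 2 * (t * s) := by ring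
              omega
            refine hLQ _ (mem_of_deg_eq (hLβ _ _ (hL b _ _ (hL t _ _
              (hU.mem_of_lt hP0 hx.1 hd')))) ?_)
            rw [← hb]; ring
          · obtain ⟨c, rfl⟩ : ∃ c, d = e + 2 * c + 1 := by
              have : t * (2 * s) = 2 * (t * s) := by ring
              exact ⟨(d - e - 1) / 2, by omega⟩
            obtain rfl : b = c + s * t := by
              have : t * (2 * s) = 2 * (s * t) := by ring
              omega
            rw [← sub_sub_self (P ((s + 1) * t) (β (P c x))) (β (P (c + s * t) (P t x)))]
            refine sub_mem ?_ ?_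
            · exact mem_of_deg_eq (hQ _ _ _ (hx.2 c rfl)) (by ring)
            · exact hLQ _ (mem_of_deg_eq
                (bockstein_top_sub_mem hP0 hAβ hL hLβ hM hMβ hs hU hx.1) (by ring))
        · intro d
          refine addBocksteinTop_le_iff.2 ⟨fun x hx => ?_, fun b hb x hx => ?_, fun b hb x hx => ?_⟩
          · refine mem_bocksteinTopComap.2 ⟨hLM d hx, fun b hb => hLQ _ ?_⟩
            refine mem_of_deg_eq (hLβ _ _ (hL b _ _ hx)) ?_
            rw [← hb]; ring
          · refine mem_bocksteinTopComap.2
              ⟨mem_of_deg_eq (hM b _ x hx) (by rw [← hb]; ring), fun b' hb' => ?_⟩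
            have : 2 * (s + 1) * b = 2 * ((s + 1) * b) := by ring
            omega
          · refine mem_bocksteinTopComap.2
              ⟨mem_of_deg_eq (hMβ _ _ (hM b _ x hx)) (by rw [← hb]; ring), fun b' hb' => ?_⟩
            have : 2 * (s + 1) * b = 2 * ((s + 1) * b) := by ring
            omega
        · intro x hx
          refine mem_bocksteinTopComap.2 ⟨hSM x hx, fun b hb => ?_⟩
          have h1 : (x.1 - e - 1) / 2 = b := by omega
          have h2 := hSQ2 x hx
          simp only [g, h1] at h2
          refine mem_of_deg_eq h2 ?_
          rw [← hb]; ring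
      have hsup := hS (Q ⊔ addBocksteinTop s P β L 𝓜 e) (hQ.sup hL') le_sup_right
        fun x hx => Submodule.mem_sup_left (hSQ1 x hx)
      intro d
      induction d using Nat.strong_induction_on with
      | _ d ihd =>
        refine (hsup d).trans (sup_le le_rfl (addBocksteinTop_le_iff.2 ⟨hLQ d, ?_, ?_⟩))
        · intro b hb x hx
          rcases Nat.eq_zero_or_pos b with rfl | hbpos
          · rw [hP0]
            exact mem_of_deg_eq (he hx) (by omega)
          · refine mem_of_deg_eq (hQ b _ x (ihd _ ?_ hx)) (by rw [← hb]; ring)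
            nlinarith
        · intro b hb x hx
          exact mem_of_deg_eq ((mem_bocksteinTopComap.1 (hβ _ hx)).2 b rfl) hb

end Bockstein

/-! ### The filtration by powers of the augmentation ideal, and graded commutativity -/

section Filtration

variable {k B : Type*} [CommRing k] [Ring B] [Algebra k B]

/-- The filtration of an augmented algebra by the powers of the augmentation ideal `I = ker ε`,
starting with the whole algebra. -/
def fil (ε : B →ₐ[k] k) : ℕ → Submodule k B
  | 0 => ⊤
  | n + 1 => LinearMap.ker ε.toLinearMap * fil ε n

variable {ε : B →ₐ[k] k}

theorem mem_fil_zero (x : B) : x ∈ fil ε 0 := Submodule.mem_top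

theorem fil_one : fil ε 1 = LinearMap.ker ε.toLinearMap := by
  refine le_antisymm (Submodule.mul_le.2 fun x hx y _ => ?_) fun x hx => ?_
  · simp only [LinearMap.mem_ker, AlgHom.toLinearMap_apply] at hx ⊢
    rw [map_mul, hx, zero_mul]
  · rw [← mul_one x]
    exact Submodule.mul_mem_mul hx Submodule.mem_top

theorem mem_fil_one {x : B} : x ∈ fil ε 1 ↔ ε x = 0 := by
  rw [fil_one, LinearMap.mem_ker, AlgHom.toLinearMap_apply]

theorem fil_succ (n : ℕ) : fil ε (n + 1) = fil ε 1 * fil ε n := by rw [fil_one]; rfl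

theorem fil_mul_le (m n : ℕ) : fil ε m * fil ε n ≤ fil ε (m + n) := by
  induction m with
  | zero =>
    rw [Nat.zero_add]
    cases n with
    | zero => exact le_top
    | succ n =>
      rw [fil_succ, ← mul_assoc]
      refine mul_le_mul_left ?_ _
      refine Submodule.mul_le.2 fun x _ y hy => ?_
      rw [mem_fil_one] at hy ⊢
      rw [map_mul, hy, mul_zero]
  | succ m ih =>
    rw [fil_succ, mul_assoc, Nat.add_right_comm, fil_succ (m + n)]
    exact mul_le_mul_right ih _

theorem mul_mem_fil {m n : ℕ} {x y : B} (hx : x ∈ fil ε m) (hy : y ∈ fil ε n) :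
    x * y ∈ fil ε (m + n) := fil_mul_le m n (Submodule.mul_mem_mul hx hy)

theorem fil_antitone : Antitone (fil ε) := antitone_nat_of_succ_le fun n => by
  rw [fil_succ]
  refine (mul_le_mul_left (le_top : fil ε 1 ≤ fil ε 0) _).trans ((fil_mul_le 0 n).trans ?_)
  rw [Nat.zero_add]

theorem fil_le {m n : ℕ} (h : m ≤ n) {x : B} (hx : x ∈ fil ε n) : x ∈ fil ε m := fil_antitone h hx

theorem pow_mem_fil {q : ℕ} {x : B} (hx : x ∈ fil ε q) (e : ℕ) : x ^ e ∈ fil ε (e * q) := by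
  induction e with
  | zero => simp [mem_fil_zero]
  | succ e ih =>
    rw [pow_succ, Nat.succ_mul]
    exact mul_mem_fil ih hx

theorem mul_sub_mul_mem_fil {m n : ℕ} {x x' y y' : B} (hx : x ∈ fil ε m)
    (hy' : y' ∈ fil ε n) (hxx' : x - x' ∈ fil ε (m + 1)) (hyy' : y - y' ∈ fil ε (n + 1)) :
    x * y - x' * y' ∈ fil ε (m + n + 1) := by
  have : x * y - x' * y' = x * (y - y') + (x - x') * y' := by noncomm_ring
  rw [this]
  refine add_mem ?_ (fil_le (by omega) (mul_mem_fil hxx' hy'))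
  rw [add_assoc]
  exact mul_mem_fil hx hyy'

theorem pow_sub_pow_mem_fil {q : ℕ} {x y : B} (hx : x ∈ fil ε q) (hy : y ∈ fil ε q)
    (hxy : x - y ∈ fil ε (q + 1)) (e : ℕ) : x ^ e - y ^ e ∈ fil ε (e * q + 1) := by
  induction e with
  | zero => simp
  | succ e ih =>
    rw [pow_succ, pow_succ, Nat.succ_mul]
    exact mul_sub_mul_mem_fil (pow_mem_fil hx e) hy ih hxy

variable {𝒜 : ℕ → Submodule k B} [GradedAlgebra 𝒜]

open DirectSum

/-- The components of a product. -/
theorem decompose_mul_mem {W : Submodule k B} {x y : B} {n : ℕ}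
    (h : ∀ i j, i + j = n → (decompose 𝒜 x i : B) * (decompose 𝒜 y j : B) ∈ W) :
    (decompose 𝒜 (x * y) n : B) ∈ W := by
  classical
  have h1 : x * y = ∑ i ∈ (decompose 𝒜 x).support, ∑ j ∈ (decompose 𝒜 y).support,
      (decompose 𝒜 x i : B) * (decompose 𝒜 y j : B) := by
    rw [← Finset.sum_mul_sum, sum_support_decompose, sum_support_decompose]
  rw [← GradedAlgebra.proj_apply, h1, map_sum]
  refine sum_mem fun i _ => ?_
  rw [map_sum]
  refine sum_mem fun j _ => ?_
  rw [GradedAlgebra.proj_apply]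
  by_cases hn : i + j = n
  · rw [← hn, decompose_of_mem_same 𝒜 (SetLike.GradedMul.mul_mem (SetLike.coe_mem _)
      (SetLike.coe_mem _))]
    exact h i j hn
  · rw [decompose_of_mem_ne 𝒜 (SetLike.GradedMul.mul_mem (SetLike.coe_mem _)
      (SetLike.coe_mem _)) hn]
    exact zero_mem _

/-- An augmentation that vanishes in positive degrees sees only the component of degree `0`. -/
theorem counit_decompose (hε : ∀ n : ℕ, 0 < n → ∀ x ∈ 𝒜 n, ε x = 0) (x : B) :
    ε x = ε (decompose 𝒜 x 0 : B) := by
  classical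
  conv_lhs => rw [← sum_support_decompose 𝒜 x, map_sum]
  rw [Finset.sum_eq_single 0]
  · intro i _ hi
    exact hε i (Nat.pos_of_ne_zero hi) _ (SetLike.coe_mem _)
  · intro h
    rw [DFinsupp.notMem_support_iff.1 h]
    simp

theorem decompose_mem_fil (hε : ∀ n : ℕ, 0 < n → ∀ x ∈ 𝒜 n, ε x = 0) (n : ℕ) :
    ∀ x ∈ fil ε n, ∀ i, (decompose 𝒜 x i : B) ∈ fil ε n := by
  induction n with
  | zero => exact fun x _ i => mem_fil_zero _
  | succ n ih =>
    intro z hz m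
    rw [fil_succ] at hz ⊢
    induction hz using Submodule.mul_induction_on' with
    | mem_mul_mem x hx y hy =>
      refine decompose_mul_mem fun i j _ => Submodule.mul_mem_mul ?_ (ih y hy j)
      rcases Nat.eq_zero_or_pos i with rfl | hi
      · rw [mem_fil_one] at hx ⊢
        rw [← counit_decompose hε, hx]
      · exact mem_fil_one.2 (hε i hi _ (SetLike.coe_mem _))
    | add x _ y _ hx hy =>
      rw [decompose_add]
      exact add_mem hx hy

/-- In a connected graded algebra the `n`-th power of the augmentation ideal vanishes in degrees
below `n`. -/
theorem decompose_eq_zero_of_mem_fil (hε : ∀ n : ℕ, 0 < n → ∀ x ∈ 𝒜 n, ε x = 0)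
    (hconn : 𝒜 0 = 1) (n : ℕ) : ∀ x ∈ fil ε n, ∀ i < n, (decompose 𝒜 x i : B) = 0 := by
  have h1 : ∀ x ∈ fil ε 1, (decompose 𝒜 x 0 : B) = 0 := by
    intro x hx
    rw [mem_fil_one, counit_decompose hε] at hx
    have h0 : (decompose 𝒜 x 0 : B) ∈ (1 : Submodule k B) := hconn ▸ SetLike.coe_mem _
    obtain ⟨c, hc⟩ := Submodule.mem_one.1 h0
    rw [← hc, AlgHom.commutes, Algebra.algebraMap_self, RingHom.id_apply] at hx
    rw [← hc, hx, map_zero]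
  induction n with
  | zero => simp
  | succ n ih =>
    intro z hz m hm
    rw [fil_succ] at hz
    induction hz using Submodule.mul_induction_on' with
    | mem_mul_mem x hx y hy =>
      rw [← Submodule.mem_bot k]
      refine decompose_mul_mem fun i j hij => (Submodule.mem_bot k).2 ?_
      rcases Nat.eq_zero_or_pos i with rfl | hi
      · rw [h1 x hx, zero_mul]
      · rw [ih y hy j (by omega), mul_zero]
    | add x _ y _ hx hy =>
      rw [decompose_add, DirectSum.add_apply, Submodule.coe_add, hx, hy, add_zero]

end Filtration

section Parity

variable {p : ℕ} {B : Type*} [Ring B] [Algebra (ZMod p) B]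
  (𝒜 : ℕ → Submodule (ZMod p) B)

variable (p) in
/-- The degrees whose elements are central in a graded commutative algebra over `𝔽_p`: the even
ones, and all of them if `p = 2`. -/
def EvenDeg (n : ℕ) : Prop := p = 2 ∨ Even n

/-- The part of `B` that is concentrated in even degrees (all of `B` if `p = 2`). -/
def evenPart : Submodule (ZMod p) B := ⨆ (n : ℕ) (_ : EvenDeg p n), 𝒜 n

/-- The part of `B` that is concentrated in odd degrees (zero if `p = 2`). -/
def oddPart : Submodule (ZMod p) B := ⨆ (n : ℕ) (_ : ¬ EvenDeg p n), 𝒜 n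

variable {𝒜}

theorem mem_evenPart {n : ℕ} (hn : EvenDeg p n) {x : B} (hx : x ∈ 𝒜 n) : x ∈ evenPart 𝒜 :=
  Submodule.mem_iSup_of_mem n (Submodule.mem_iSup_of_mem hn hx)

theorem mem_oddPart {n : ℕ} (hn : ¬ EvenDeg p n) {x : B} (hx : x ∈ 𝒜 n) : x ∈ oddPart 𝒜 :=
  Submodule.mem_iSup_of_mem n (Submodule.mem_iSup_of_mem hn hx)

theorem evenPart_le_iff {X : Submodule (ZMod p) B} :
    evenPart 𝒜 ≤ X ↔ ∀ n, EvenDeg p n → 𝒜 n ≤ X := iSup₂_le_iff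

theorem oddPart_le_iff {X : Submodule (ZMod p) B} :
    oddPart 𝒜 ≤ X ↔ ∀ n, ¬ EvenDeg p n → 𝒜 n ≤ X := iSup₂_le_iff

theorem neg_one_pow_smul {M : Type*} [AddCommGroup M] [Module (ZMod p) M] {n : ℕ}
    (hn : EvenDeg p n) (t : M) : ((-1 : ℤˣ) ^ n) • t = t := by
  rcases hn with rfl | hn
  · have h2 : t + t = 0 := by
      rw [← two_smul (ZMod 2) t, show (2 : ZMod 2) = 0 from rfl, zero_smul]
    rcases Int.units_eq_one_or ((-1 : ℤˣ) ^ n) with h | h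
    · rw [h, one_smul]
    · rw [h, Units.neg_smul, one_smul, neg_eq_of_add_eq_zero_left h2]
  · rw [hn.neg_one_pow, one_smul]

theorem EvenDeg.mul_left {n : ℕ} (hn : EvenDeg p n) (m : ℕ) : EvenDeg p (m * n) :=
  hn.imp_right fun h => h.mul_left m

theorem EvenDeg.mul_right {n : ℕ} (hn : EvenDeg p n) (m : ℕ) : EvenDeg p (n * m) :=
  hn.imp_right fun h => h.mul_right m

/-- Graded commutativity. -/
def GradedComm (𝒜 : ℕ → Submodule (ZMod p) B) : Prop :=
  ∀ (m n : ℕ), ∀ x ∈ 𝒜 m, ∀ y ∈ 𝒜 n, x * y = (-1) ^ (m * n) * (y * x)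

theorem not_evenDeg {n : ℕ} (hn : ¬ EvenDeg p n) : p ≠ 2 ∧ Odd n := by
  simpa [EvenDeg, not_or] using hn

/-- Odd elements anticommute with odd elements. -/
theorem GradedComm.anticommute (hc : GradedComm 𝒜) {x y : B} (hx : x ∈ oddPart 𝒜)
    (hy : y ∈ oddPart 𝒜) : x * y = -(y * x) := by
  suffices oddPart 𝒜 ≤ LinearMap.ker (LinearMap.mulRight (ZMod p) y +
      LinearMap.mulLeft (ZMod p) y) by
    have := this hx
    simpa [add_eq_zero_iff_eq_neg] using this
  refine oddPart_le_iff.2 fun n hn x hx => ?_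
  suffices oddPart 𝒜 ≤ LinearMap.ker (LinearMap.mulLeft (ZMod p) x +
      LinearMap.mulRight (ZMod p) x) by
    have := this hy
    simpa using this
  refine oddPart_le_iff.2 fun m hm y hy => ?_
  simp only [LinearMap.mem_ker, LinearMap.add_apply, LinearMap.mulLeft_apply,
    LinearMap.mulRight_apply]
  rw [hc n m x hx y hy, ((not_evenDeg hn).2.mul (not_evenDeg hm).2).neg_one_pow]
  simp

theorem GradedComm.sq_eq_zero (hc : GradedComm 𝒜) [Fact p.Prime] {x : B} (hx : x ∈ oddPart 𝒜) :
    x ^ 2 = 0 := by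
  rcases eq_or_ne p 2 with rfl | hp
  · have : oddPart 𝒜 = ⊥ := by
      rw [eq_bot_iff]
      exact oddPart_le_iff.2 fun n hn => absurd (Or.inl rfl) hn
    rw [this, Submodule.mem_bot] at hx
    simp [hx]
  · have h := hc.anticommute hx hx
    have h2 : (2 : ZMod p) • (x * x) = 0 := by
      rw [two_smul]; exact add_eq_zero_iff_eq_neg.2 h
    have h3 : (2 : ZMod p) ≠ 0 := by
      intro h0
      have h4 : p ∣ 2 := (ZMod.natCast_eq_zero_iff 2 p).1 (by exact_mod_cast h0)
      exact hp ((Nat.prime_dvd_prime_iff_eq Fact.out Nat.prime_two).1 h4)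
    rw [sq]
    exact (smul_eq_zero_iff_right h3).1 h2

variable [GradedAlgebra 𝒜]

open DirectSum

/-- A linear statement holds everywhere if it holds on homogeneous elements. -/
theorem homogeneous_induction {X : Submodule (ZMod p) B} (h : ∀ n, 𝒜 n ≤ X) (x : B) : x ∈ X := by
  classical
  rw [← sum_support_decompose 𝒜 x]
  exact sum_mem fun i _ => h i (SetLike.coe_mem _)

theorem evenPart_sup_oddPart : evenPart 𝒜 ⊔ oddPart 𝒜 = ⊤ := by
  refine eq_top_iff.2 fun x _ => homogeneous_induction (𝒜 := 𝒜) (fun n y hy => ?_) x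
  by_cases hn : EvenDeg p n
  · exact Submodule.mem_sup_left (mem_evenPart hn hy)
  · exact Submodule.mem_sup_right (mem_oddPart hn hy)

theorem neg_one_pow_mul_eq_smul (n : ℕ) (x : B) : (-1) ^ n * x = ((-1 : ℤˣ) ^ n) • x := by
  rw [Units.smul_def, ← Int.cast_smul_eq_zsmul ℤ]
  simp

theorem GradedComm.commute (hc : GradedComm 𝒜) {x : B} (hx : x ∈ evenPart 𝒜) (y : B) :
    x * y = y * x := by
  suffices evenPart 𝒜 ≤ LinearMap.ker (LinearMap.mulRight (ZMod p) y -
      LinearMap.mulLeft (ZMod p) y) by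
    have := this hx
    simpa [sub_eq_zero] using this
  refine evenPart_le_iff.2 fun n hn x hx => ?_
  suffices ∀ m, 𝒜 m ≤ LinearMap.ker (LinearMap.mulLeft (ZMod p) x -
      LinearMap.mulRight (ZMod p) x) by
    have := homogeneous_induction (𝒜 := 𝒜) this y
    simpa [sub_eq_zero] using this
  intro m y hy
  simp only [LinearMap.mem_ker, LinearMap.sub_apply, LinearMap.mulLeft_apply,
    LinearMap.mulRight_apply, sub_eq_zero]
  rw [hc n m x hx y hy, neg_one_pow_mul_eq_smul, neg_one_pow_smul (hn.mul_right m)]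

end Parity

/-! ### Graded tensor products -/

section Slice

open DirectSum GradedTensorProduct

variable {p : ℕ} {B : Type*} [Ring B] [Algebra (ZMod p) B]
  {𝒜 : ℕ → Submodule (ZMod p) B} [GradedAlgebra 𝒜]

/-- A linear statement holds for all elements of the graded tensor product if it holds for pure
tensors. -/
theorem gtp_induction {X : Submodule (ZMod p) (𝒜 ᵍ⊗[ZMod p] 𝒜)}
    (h : ∀ a b : B, (a ᵍ⊗ₜ[ZMod p] b : 𝒜 ᵍ⊗[ZMod p] 𝒜) ∈ X) (t : 𝒜 ᵍ⊗[ZMod p] 𝒜) : t ∈ X := by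
  have : ∀ u : B ⊗[ZMod p] B, of (ZMod p) 𝒜 𝒜 u ∈ X := by
    intro u
    induction u using TensorProduct.induction_on with
    | zero => rw [map_zero]; exact zero_mem _
    | tmul a b => exact h a b
    | add x y hx hy => rw [map_add]; exact add_mem hx hy
  exact this ((of (ZMod p) 𝒜 𝒜).symm t)

theorem tmul_one_mul_tmul (x a b : B) :
    ((x ᵍ⊗ₜ[ZMod p] 1 : 𝒜 ᵍ⊗[ZMod p] 𝒜)) * a ᵍ⊗ₜ[ZMod p] b = (x * a) ᵍ⊗ₜ[ZMod p] b := by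
  classical
  rw [← sum_support_decompose 𝒜 a, Finset.mul_sum]
  simp only [tmul, TensorProduct.sum_tmul, map_sum, Finset.mul_sum]
  exact Finset.sum_congr rfl fun i _ => tmul_one_mul_coe_tmul 𝒜 𝒜 x _ b

theorem tmul_mul_one_tmul (a b x : B) :
    ((a ᵍ⊗ₜ[ZMod p] b : 𝒜 ᵍ⊗[ZMod p] 𝒜)) * 1 ᵍ⊗ₜ[ZMod p] x = a ᵍ⊗ₜ[ZMod p] (b * x) := by
  classical
  rw [← sum_support_decompose 𝒜 b, Finset.sum_mul]
  simp only [tmul, TensorProduct.tmul_sum, map_sum, Finset.sum_mul]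
  exact Finset.sum_congr rfl fun i _ => tmul_coe_mul_one_tmul 𝒜 𝒜 a _ x

/-- Products of pure tensors of homogeneous elements, with the Koszul sign. -/
theorem tmul_mul_tmul_of_mem {m n : ℕ} {b c : B} (hb : b ∈ 𝒜 m) (hc : c ∈ 𝒜 n) (a d : B) :
    ((a ᵍ⊗ₜ[ZMod p] b : 𝒜 ᵍ⊗[ZMod p] 𝒜)) * c ᵍ⊗ₜ[ZMod p] d =
      ((-1 : ℤˣ) ^ (m * n)) • ((a * c) ᵍ⊗ₜ[ZMod p] (b * d)) :=
  tmul_coe_mul_coe_tmul 𝒜 𝒜 a ⟨b, hb⟩ ⟨c, hc⟩ d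

/-- If one of the two inner factors is concentrated in even degrees, there is no sign. -/
theorem tmul_mul_tmul_of_even {b c : B} (h : b ∈ evenPart 𝒜 ∨ c ∈ evenPart 𝒜) (a d : B) :
    ((a ᵍ⊗ₜ[ZMod p] b : 𝒜 ᵍ⊗[ZMod p] 𝒜)) * c ᵍ⊗ₜ[ZMod p] d =
      (a * c) ᵍ⊗ₜ[ZMod p] (b * d) := by
  let f : B →ₗ[ZMod p] B →ₗ[ZMod p] 𝒜 ᵍ⊗[ZMod p] 𝒜 :=
    LinearMap.mk₂ (ZMod p) (fun b c => ((a ᵍ⊗ₜ[ZMod p] b : 𝒜 ᵍ⊗[ZMod p] 𝒜)) * c ᵍ⊗ₜ[ZMod p] d -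
      (a * c) ᵍ⊗ₜ[ZMod p] (b * d))
      (fun b b' c => by
        simp only [tmul, TensorProduct.tmul_add, map_add, add_mul]; abel)
      (fun r b c => by
        simp only [tmul, TensorProduct.tmul_smul, map_smul, smul_mul_assoc, smul_sub])
      (fun b c c' => by
        simp only [tmul, TensorProduct.add_tmul, map_add, mul_add]; abel)
      (fun r b c => by
        simp only [tmul, ← TensorProduct.smul_tmul', map_smul, mul_smul_comm, smul_sub])
  suffices f b c = 0 from sub_eq_zero.1 this
  have hf : ∀ m n, EvenDeg p m ∨ EvenDeg p n → ∀ b ∈ 𝒜 m, ∀ c ∈ 𝒜 n, f b c = 0 := by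
    intro m n hmn b hb c hc
    simp only [f, LinearMap.mk₂_apply, sub_eq_zero]
    rw [tmul_mul_tmul_of_mem hb hc, neg_one_pow_smul (p := p)]
    rcases hmn with h | h
    exacts [h.mul_right n, h.mul_left m]
  rcases h with h | h
  · refine homogeneous_induction (𝒜 := 𝒜) (X := LinearMap.ker (f b)) (fun n c hc => ?_) c
    exact (evenPart_le_iff (X := LinearMap.ker (f.flip c))).2
      (fun m hm b hb => hf m n (Or.inl hm) b hb c hc) h
  · refine homogeneous_induction (𝒜 := 𝒜) (X := LinearMap.ker (f.flip c)) (fun m b hb => ?_) b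
    exact (evenPart_le_iff (X := LinearMap.ker (f b))).2
      (fun n hn c hc => hf m n (Or.inr hn) b hb c hc) h

theorem GradedComm.commute_tmul_one (hc : GradedComm 𝒜) {x : B} (hx : x ∈ evenPart 𝒜)
    (t : 𝒜 ᵍ⊗[ZMod p] 𝒜) : Commute (x ᵍ⊗ₜ[ZMod p] 1) t := by
  suffices t ∈ LinearMap.ker (LinearMap.mulLeft (ZMod p) (x ᵍ⊗ₜ[ZMod p] 1 : 𝒜 ᵍ⊗[ZMod p] 𝒜) -
      LinearMap.mulRight (ZMod p) (x ᵍ⊗ₜ[ZMod p] 1 : 𝒜 ᵍ⊗[ZMod p] 𝒜)) by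
    simpa [sub_eq_zero, commute_iff_eq] using this
  refine gtp_induction (fun a b => ?_) t
  simp only [LinearMap.mem_ker, LinearMap.sub_apply, LinearMap.mulLeft_apply,
    LinearMap.mulRight_apply, sub_eq_zero]
  rw [tmul_one_mul_tmul, tmul_mul_tmul_of_even (Or.inr hx), hc.commute hx, mul_one]

theorem GradedComm.commute_one_tmul (hc : GradedComm 𝒜) {x : B} (hx : x ∈ evenPart 𝒜)
    (t : 𝒜 ᵍ⊗[ZMod p] 𝒜) : Commute (1 ᵍ⊗ₜ[ZMod p] x) t := by
  suffices t ∈ LinearMap.ker (LinearMap.mulLeft (ZMod p) (1 ᵍ⊗ₜ[ZMod p] x : 𝒜 ᵍ⊗[ZMod p] 𝒜) -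
      LinearMap.mulRight (ZMod p) (1 ᵍ⊗ₜ[ZMod p] x : 𝒜 ᵍ⊗[ZMod p] 𝒜)) by
    simpa [sub_eq_zero, commute_iff_eq] using this
  refine gtp_induction (fun a b => ?_) t
  simp only [LinearMap.mem_ker, LinearMap.sub_apply, LinearMap.mulLeft_apply,
    LinearMap.mulRight_apply, sub_eq_zero]
  rw [tmul_mul_one_tmul, tmul_mul_tmul_of_even (Or.inl hx), hc.commute hx, one_mul]

variable (𝒜) in
/-- The contraction `a ⊗ b ↦ ψ(a) b` of the left tensor factor with a functional `ψ`. -/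
noncomputable def slice (ψ : B →ₗ[ZMod p] ZMod p) : 𝒜 ᵍ⊗[ZMod p] 𝒜 →ₗ[ZMod p] B :=
  (TensorProduct.lid (ZMod p) B).toLinearMap ∘ₗ ψ.rTensor B ∘ₗ
    (of (ZMod p) 𝒜 𝒜).symm.toLinearMap

@[simp] theorem slice_tmul (ψ : B →ₗ[ZMod p] ZMod p) (a b : B) :
    slice 𝒜 ψ (a ᵍ⊗ₜ[ZMod p] b) = ψ a • b := by
  simp [slice, tmul]

theorem slice_one_tmul_mul (ψ : B →ₗ[ZMod p] ZMod p) {x : B} (hx : x ∈ evenPart 𝒜)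
    (t : 𝒜 ᵍ⊗[ZMod p] 𝒜) : slice 𝒜 ψ (1 ᵍ⊗ₜ[ZMod p] x * t) = x * slice 𝒜 ψ t := by
  suffices t ∈ LinearMap.ker (slice 𝒜 ψ ∘ₗ LinearMap.mulLeft (ZMod p) (1 ᵍ⊗ₜ[ZMod p] x) -
      LinearMap.mulLeft (ZMod p) x ∘ₗ slice 𝒜 ψ) by
    simpa [sub_eq_zero] using this
  refine gtp_induction (fun a b => ?_) t
  simp only [LinearMap.mem_ker, LinearMap.sub_apply, LinearMap.mulLeft_apply,
    LinearMap.comp_apply, sub_eq_zero]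
  rw [tmul_mul_tmul_of_even (Or.inl hx), slice_tmul, slice_tmul, one_mul, mul_smul_comm]

/-- For odd elements and functionals that are supported in odd degrees, a sign appears. -/
theorem slice_one_tmul_mul_of_odd {ψ : B →ₗ[ZMod p] ZMod p}
    (hψ : evenPart 𝒜 ≤ LinearMap.ker ψ) {x : B} (hx : x ∈ oddPart 𝒜)
    (t : 𝒜 ᵍ⊗[ZMod p] 𝒜) : slice 𝒜 ψ (1 ᵍ⊗ₜ[ZMod p] x * t) = -(x * slice 𝒜 ψ t) := by
  suffices t ∈ LinearMap.ker (slice 𝒜 ψ ∘ₗ LinearMap.mulLeft (ZMod p) (1 ᵍ⊗ₜ[ZMod p] x) +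
      LinearMap.mulLeft (ZMod p) x ∘ₗ slice 𝒜 ψ) by
    simpa [add_eq_zero_iff_eq_neg] using this
  refine gtp_induction (fun a b => ?_) t
  simp only [LinearMap.mem_ker, LinearMap.add_apply, LinearMap.mulLeft_apply,
    LinearMap.comp_apply]
  let g : B →ₗ[ZMod p] B →ₗ[ZMod p] B :=
    LinearMap.mk₂ (ZMod p) (fun x a => slice 𝒜 ψ ((1 ᵍ⊗ₜ[ZMod p] x : 𝒜 ᵍ⊗[ZMod p] 𝒜) *
        a ᵍ⊗ₜ[ZMod p] b) + x * slice 𝒜 ψ (a ᵍ⊗ₜ[ZMod p] b))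
      (fun b b' c => by
        simp only [tmul, TensorProduct.tmul_add, map_add, add_mul]; abel)
      (fun r b c => by
        simp only [tmul, TensorProduct.tmul_smul, map_smul, smul_mul_assoc, smul_add])
      (fun b c c' => by
        simp only [tmul, TensorProduct.add_tmul, map_add, mul_add]; abel)
      (fun r b c => by
        simp only [tmul, ← TensorProduct.smul_tmul', map_smul, mul_smul_comm, smul_add])
  suffices g x a = 0 from this
  refine homogeneous_induction (𝒜 := 𝒜) (X := LinearMap.ker (g x)) (fun m a ha => ?_) a
  refine (oddPart_le_iff (X := LinearMap.ker (g.flip a))).2 (fun n hn x hx => ?_) hx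
  simp only [LinearMap.mem_ker, LinearMap.flip_apply, g, LinearMap.mk₂_apply]
  rw [tmul_mul_tmul_of_mem hx ha, one_mul, slice_tmul]
  by_cases hm : EvenDeg p m
  · rw [neg_one_pow_smul (hm.mul_left n), slice_tmul,
      show ψ a = 0 from hψ (mem_evenPart hm ha)]
    simp
  · rw [((not_evenDeg hn).2.mul (not_evenDeg hm).2).neg_one_pow, Units.neg_smul, one_smul,
      map_neg, slice_tmul]
    simp

/-- The filtration of the graded tensor product by total augmentation order. -/
noncomputable def tensorFil (𝒜 : ℕ → Submodule (ZMod p) B) [GradedAlgebra 𝒜]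
    (ε : B →ₐ[ZMod p] ZMod p) (N : ℕ) : Submodule (ZMod p) (𝒜 ᵍ⊗[ZMod p] 𝒜) :=
  Submodule.span (ZMod p) {t | ∃ i j, N ≤ i + j ∧ ∃ a ∈ fil ε i, ∃ b ∈ fil ε j,
    a ᵍ⊗ₜ[ZMod p] b = t}

variable {ε : B →ₐ[ZMod p] ZMod p}

theorem tmul_mem_tensorFil {i j N : ℕ} (h : N ≤ i + j) {a b : B} (ha : a ∈ fil ε i)
    (hb : b ∈ fil ε j) : (a ᵍ⊗ₜ[ZMod p] b : 𝒜 ᵍ⊗[ZMod p] 𝒜) ∈ tensorFil 𝒜 ε N :=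
  Submodule.subset_span ⟨i, j, h, a, ha, b, hb, rfl⟩

theorem tensorFil_antitone : Antitone (tensorFil 𝒜 ε) := fun _ _ h =>
  Submodule.span_mono fun _ ⟨i, j, hij, r⟩ => ⟨i, j, h.trans hij, r⟩

theorem mem_tensorFil_zero (t : 𝒜 ᵍ⊗[ZMod p] 𝒜) : t ∈ tensorFil 𝒜 ε 0 :=
  gtp_induction (fun a b => tmul_mem_tensorFil (i := 0) (j := 0) le_rfl
    (mem_fil_zero a) (mem_fil_zero b)) t

theorem tensorFil_mul_le (hε : ∀ n : ℕ, 0 < n → ∀ x ∈ 𝒜 n, ε x = 0) (M N : ℕ) :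
    tensorFil 𝒜 ε M * tensorFil 𝒜 ε N ≤ tensorFil 𝒜 ε (M + N) := by
  classical
  rw [tensorFil, tensorFil, Submodule.span_mul_span, Submodule.span_le]
  rintro _ ⟨_, ⟨i, j, hij, a, ha, b, hb, rfl⟩, _, ⟨i', j', hij', c, hc, d, hd, rfl⟩, rfl⟩
  simp only [SetLike.mem_coe]
  rw [← sum_support_decompose 𝒜 b, ← sum_support_decompose 𝒜 c]
  simp only [tmul, TensorProduct.tmul_sum, TensorProduct.sum_tmul, map_sum, Finset.sum_mul_sum]
  refine sum_mem fun m _ => sum_mem fun n _ => ?_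
  have h := tmul_mul_tmul_of_mem (𝒜 := 𝒜) (SetLike.coe_mem (decompose 𝒜 b m))
    (SetLike.coe_mem (decompose 𝒜 c n)) a d
  simp only [tmul] at h
  rw [h]
  have h2 : (a * (decompose 𝒜 c n : B)) ᵍ⊗ₜ[ZMod p] ((decompose 𝒜 b m : B) * d) ∈
      tensorFil 𝒜 ε (M + N) :=
    tmul_mem_tensorFil (i := i + i') (j := j + j') (by omega)
      (mul_mem_fil ha (decompose_mem_fil hε i' c hc n))
      (mul_mem_fil (decompose_mem_fil hε j b hb m) hd)
  rcases Int.units_eq_one_or ((-1 : ℤˣ) ^ (m * n)) with h | h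
  · rw [h, one_smul]; exact h2
  · rw [h, Units.neg_smul, one_smul]; exact neg_mem h2

theorem mul_mem_tensorFil (hε : ∀ n : ℕ, 0 < n → ∀ x ∈ 𝒜 n, ε x = 0) {M N : ℕ}
    {t u : 𝒜 ᵍ⊗[ZMod p] 𝒜} (ht : t ∈ tensorFil 𝒜 ε M) (hu : u ∈ tensorFil 𝒜 ε N) :
    t * u ∈ tensorFil 𝒜 ε (M + N) := tensorFil_mul_le hε M N (Submodule.mul_mem_mul ht hu)

theorem pow_mem_tensorFil (hε : ∀ n : ℕ, 0 < n → ∀ x ∈ 𝒜 n, ε x = 0) {M : ℕ}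
    {t : 𝒜 ᵍ⊗[ZMod p] 𝒜} (ht : t ∈ tensorFil 𝒜 ε M) (e : ℕ) :
    t ^ e ∈ tensorFil 𝒜 ε (e * M) := by
  induction e with
  | zero => simpa using mem_tensorFil_zero _
  | succ e ih => rw [pow_succ, Nat.succ_mul]; exact mul_mem_tensorFil hε ih ht

theorem slice_mem_fil {ψ : B →ₗ[ZMod p] ZMod p} {q : ℕ} (hψ : fil ε (q + 1) ≤ LinearMap.ker ψ)
    {N : ℕ} {t : 𝒜 ᵍ⊗[ZMod p] 𝒜} (ht : t ∈ tensorFil 𝒜 ε N) : slice 𝒜 ψ t ∈ fil ε (N - q) := by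
  suffices tensorFil 𝒜 ε N ≤ (fil ε (N - q)).comap (slice 𝒜 ψ) from this ht
  rw [tensorFil, Submodule.span_le]
  rintro _ ⟨i, j, hij, a, ha, b, hb, rfl⟩
  simp only [SetLike.mem_coe, Submodule.mem_comap, slice_tmul]
  rcases Nat.lt_or_ge q i with h | h
  · rw [show ψ a = 0 from hψ (fil_le h ha), zero_smul]
    exact zero_mem _
  · exact Submodule.smul_mem _ _ (fil_le (by omega) hb)

/-- If both contractions of `t` with the augmentation are equal to `x ∈ I`, then `t` differs from
`x ⊗ 1 + 1 ⊗ x` by an element of `I ⊗ I`. -/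
theorem sub_slices_mem_tensorFil (t : 𝒜 ᵍ⊗[ZMod p] 𝒜) (x : B) (hx : ε x = 0)
    (h1 : slice 𝒜 ε.toLinearMap t = x)
    (h2 : ε.toLinearMap.lTensor B ((of (ZMod p) 𝒜 𝒜).symm t) = x ⊗ₜ[ZMod p] 1) :
    t - (x ᵍ⊗ₜ[ZMod p] 1 + 1 ᵍ⊗ₜ[ZMod p] x) ∈ tensorFil 𝒜 ε 2 := by
  let σ : 𝒜 ᵍ⊗[ZMod p] 𝒜 →ₗ[ZMod p] B := (TensorProduct.rid (ZMod p) B).toLinearMap ∘ₗ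
    ε.toLinearMap.lTensor B ∘ₗ (of (ZMod p) 𝒜 𝒜).symm.toLinearMap
  have h2' : σ t = x := by simp [σ, h2]
  let f : 𝒜 ᵍ⊗[ZMod p] 𝒜 →ₗ[ZMod p] 𝒜 ᵍ⊗[ZMod p] 𝒜 :=
    LinearMap.id - (includeRight 𝒜 𝒜).toLinearMap ∘ₗ slice 𝒜 ε.toLinearMap -
      (includeLeft 𝒜 𝒜).toLinearMap ∘ₗ σ +
      (Algebra.linearMap (ZMod p) (𝒜 ᵍ⊗[ZMod p] 𝒜)) ∘ₗ ε.toLinearMap ∘ₗ slice 𝒜 ε.toLinearMap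
  have hf : f t = t - (x ᵍ⊗ₜ[ZMod p] 1 + 1 ᵍ⊗ₜ[ZMod p] x) := by
    simp only [f, LinearMap.add_apply, LinearMap.sub_apply, LinearMap.comp_apply, h1, h2',
      AlgHom.toLinearMap_apply, hx, map_zero, LinearMap.id_apply, includeRight_apply,
      includeLeft_apply]
    abel
  rw [← hf]
  refine gtp_induction (X := (tensorFil 𝒜 ε 2).comap f) (fun a b => ?_) t
  have key : f (a ᵍ⊗ₜ[ZMod p] b) =
      (a - algebraMap (ZMod p) B (ε a)) ᵍ⊗ₜ[ZMod p] (b - algebraMap (ZMod p) B (ε b)) := by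
    have hσ : σ (a ᵍ⊗ₜ[ZMod p] b) = ε b • a := by simp [σ, tmul]
    simp only [f, LinearMap.add_apply, LinearMap.sub_apply, LinearMap.comp_apply, hσ,
      AlgHom.toLinearMap_apply, LinearMap.id_apply, includeRight_apply,
      includeLeft_apply, slice_tmul, map_smul, Algebra.linearMap_apply,
      Algebra.algebraMap_eq_smul_one, tmul, TensorProduct.tmul_sub, TensorProduct.sub_tmul,
      TensorProduct.tmul_smul, TensorProduct.smul_tmul, map_sub, smul_sub]
    have h1 : (of (ZMod p) 𝒜 𝒜) (1 ⊗ₜ[ZMod p] 1) = 1 := rfl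
    rw [h1, smul_comm (ε b) (ε a)]
    abel
  rw [Submodule.mem_comap, key]
  refine tmul_mem_tensorFil (i := 1) (j := 1) le_rfl ?_ ?_ <;>
  · rw [mem_fil_one]; simp

end Slice

/-! ### Derivations from functionals -/

section Derivation

open DirectSum GradedTensorProduct

variable {p : ℕ} {B : Type*} [Ring B] [Algebra (ZMod p) B]
  {𝒜 : ℕ → Submodule (ZMod p) B} [GradedAlgebra 𝒜] (H : GradedHopfAlgebra p 𝒜)

/-- The operator `(ψ ⊗ 1) ∘ Δ` on a graded Hopf algebra. If `ψ` vanishes on `I ^ (q + 1)`, it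
lowers the augmentation filtration by `q`, and on the associated graded algebra it acts as a
derivation with respect to multiplication by `p ^ j`-th powers of elements of `I` for
`p ^ j ≥ q`. -/
noncomputable def der (ψ : B →ₗ[ZMod p] ZMod p) : B →ₗ[ZMod p] B :=
  slice 𝒜 ψ ∘ₗ H.comul.toLinearMap

theorem der_apply (ψ : B →ₗ[ZMod p] ZMod p) (x : B) : der H ψ x = slice 𝒜 ψ (H.comul x) := rfl

theorem slice_counit_comul (x : B) : slice 𝒜 H.counit.toLinearMap (H.comul x) = x := by
  have := H.counit_comul x
  simp only [slice, LinearMap.comp_apply, LinearEquiv.coe_coe]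
  rw [this]
  simp

/-- The reduced coproduct of an element of the augmentation ideal `I` lies in `I ⊗ I`. -/
theorem comul_sub_mem {x : B} (hx : x ∈ fil H.counit 1) :
    H.comul x - (x ᵍ⊗ₜ[ZMod p] 1 + 1 ᵍ⊗ₜ[ZMod p] x) ∈ tensorFil 𝒜 H.counit 2 :=
  sub_slices_mem_tensorFil _ x (mem_fil_one.1 hx) (slice_counit_comul H x) (H.comul_counit x)

theorem comul_mem_tensorFil (n : ℕ) : ∀ x ∈ fil H.counit n, H.comul x ∈ tensorFil 𝒜 H.counit n := by
  induction n with
  | zero => exact fun x _ => mem_tensorFil_zero _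
  | succ n ih =>
    have h1 : ∀ x ∈ fil H.counit 1, H.comul x ∈ tensorFil 𝒜 H.counit 1 := by
      intro x hx
      have h2 : x ᵍ⊗ₜ[ZMod p] 1 + 1 ᵍ⊗ₜ[ZMod p] x ∈ tensorFil 𝒜 H.counit 1 :=
        add_mem (tmul_mem_tensorFil (i := 1) (j := 0) le_rfl hx (mem_fil_zero _))
          (tmul_mem_tensorFil (i := 0) (j := 1) le_rfl (mem_fil_zero _) hx)
      rw [← sub_add_cancel (H.comul x) (x ᵍ⊗ₜ[ZMod p] 1 + 1 ᵍ⊗ₜ[ZMod p] x)]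
      exact add_mem (tensorFil_antitone (by omega) (comul_sub_mem H hx)) h2
    intro z hz
    rw [fil_succ] at hz
    induction hz using Submodule.mul_induction_on' with
    | mem_mul_mem x hx y hy =>
      rw [map_mul, add_comm n 1]
      exact mul_mem_tensorFil H.counit_of_pos (h1 x hx) (ih y hy)
    | add x _ y _ hx hy => rw [map_add]; exact add_mem hx hy

variable {ψ : B →ₗ[ZMod p] ZMod p} {q : ℕ}

theorem der_mem_fil (hψ : fil H.counit (q + 1) ≤ LinearMap.ker ψ) {n : ℕ} {x : B}
    (hx : x ∈ fil H.counit n) : der H ψ x ∈ fil H.counit (n - q) :=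
  slice_mem_fil hψ (comul_mem_tensorFil H n x hx)

theorem slice_mem_of_mem_range {A : Subalgebra (ZMod p) B} (ψ : B →ₗ[ZMod p] ZMod p)
    {t : B ⊗[ZMod p] B}
    (ht : t ∈ LinearMap.range (TensorProduct.mapIncl (Subalgebra.toSubmodule A)
      (Subalgebra.toSubmodule A))) :
    slice 𝒜 ψ (of (ZMod p) 𝒜 𝒜 t) ∈ A ∧
      ((∀ a ∈ A, ψ a = 0) → slice 𝒜 ψ (of (ZMod p) 𝒜 𝒜 t) = 0) := by
  obtain ⟨u, rfl⟩ := ht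
  induction u using TensorProduct.induction_on with
  | zero => simp
  | tmul a b =>
    have h : slice 𝒜 ψ (of (ZMod p) 𝒜 𝒜 (TensorProduct.mapIncl (Subalgebra.toSubmodule A)
        (Subalgebra.toSubmodule A) (a ⊗ₜ[ZMod p] b))) = ψ a • (b : B) :=
      slice_tmul ψ (a : B) (b : B)
    rw [h]
    exact ⟨A.smul_mem b.2 _, fun h0 => by rw [h0 _ a.2, zero_smul]⟩
  | add x y hx hy =>
    rw [map_add, map_add, map_add]
    exact ⟨add_mem hx.1 hy.1, fun h0 => by rw [hx.2 h0, hy.2 h0, add_zero]⟩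

variable {H} in
theorem der_mem_of_isHopfSubalgebra {A : Subalgebra (ZMod p) B} (hA : H.IsHopfSubalgebra A)
    {x : B} (hx : x ∈ A) : der H ψ x ∈ A := (slice_mem_of_mem_range ψ (hA x hx)).1

variable {H} in
theorem der_eq_zero_of_isHopfSubalgebra {A : Subalgebra (ZMod p) B} (hA : H.IsHopfSubalgebra A)
    (hψ : ∀ a ∈ A, ψ a = 0) {x : B} (hx : x ∈ A) : der H ψ x = 0 :=
  (slice_mem_of_mem_range ψ (hA x hx)).2 hψ

theorem slice_tmul_one_mul_comul {y : B} (hψ : fil H.counit (q + 1) ≤ LinearMap.ker ψ) {q' : ℕ}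
    (hq : q ≤ q') (hy : y ∈ fil H.counit q') (b : B) :
    slice 𝒜 ψ (y ᵍ⊗ₜ[ZMod p] 1 * H.comul b) = ψ y • b := by
  conv_rhs => rw [← slice_counit_comul H b]
  suffices H.comul b ∈ LinearMap.ker (slice 𝒜 ψ ∘ₗ LinearMap.mulLeft (ZMod p)
      (y ᵍ⊗ₜ[ZMod p] 1) - ψ y • slice 𝒜 H.counit.toLinearMap) by
    simpa [sub_eq_zero] using this
  refine gtp_induction (fun a b => ?_) _
  simp only [LinearMap.mem_ker, LinearMap.sub_apply, LinearMap.comp_apply, LinearMap.mulLeft_apply,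
    LinearMap.smul_apply, tmul_one_mul_tmul, slice_tmul, AlgHom.toLinearMap_apply, sub_eq_zero]
  have h1 : ψ (y * (a - algebraMap (ZMod p) B (H.counit a))) = 0 := by
    refine hψ (fil_le (by omega) (mul_mem_fil hy (n := 1) ?_))
    rw [mem_fil_one]; simp
  rw [mul_sub, map_sub, sub_eq_zero, Algebra.algebraMap_eq_smul_one, mul_smul_comm, mul_one,
    map_smul] at h1
  rw [h1, smul_smul, smul_eq_mul, mul_comm]

theorem charP_gradedTensor [Fact p.Prime] (H : GradedHopfAlgebra p 𝒜) :
    CharP (𝒜 ᵍ⊗[ZMod p] 𝒜) p := by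
  have : Nontrivial (𝒜 ᵍ⊗[ZMod p] 𝒜) := by
    refine ⟨0, 1, fun h => ?_⟩
    have h1 : H.counit (slice 𝒜 H.counit.toLinearMap (H.comul 1)) = 1 := by
      rw [slice_counit_comul, map_one]
    rw [map_one, ← h, map_zero, map_zero] at h1
    exact zero_ne_one h1
  exact charP_of_injective_algebraMap (algebraMap (ZMod p) (𝒜 ᵍ⊗[ZMod p] 𝒜)).injective p

/-- The derivation property of `(ψ ⊗ 1) ∘ Δ` with respect to `p ^ j`-th powers of even elements:
in characteristic `p`, the reduced coproduct of such a power is the power of the reduced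
coproduct, hence of high filtration. -/
theorem der_pow_mul_sub_mem [Fact p.Prime] (hc : GradedComm 𝒜)
    (hψ : fil H.counit (q + 1) ≤ LinearMap.ker ψ) {j : ℕ} (hq : q ≤ p ^ j) {x : B}
    (hx : x ∈ fil H.counit 1) (hxe : x ∈ evenPart 𝒜) {n : ℕ} {b : B} (hb : b ∈ fil H.counit n) :
    der H ψ (x ^ p ^ j * b) - (ψ (x ^ p ^ j) • b + x ^ p ^ j * der H ψ b) ∈
      fil H.counit (n + p ^ j + 1 - q) := by
  have := charP_gradedTensor H
  set z := H.comul x - (x ᵍ⊗ₜ[ZMod p] 1 + 1 ᵍ⊗ₜ[ZMod p] x) with hz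
  have hΔ : H.comul (x ^ p ^ j) = (x ^ p ^ j) ᵍ⊗ₜ[ZMod p] 1 + 1 ᵍ⊗ₜ[ZMod p] (x ^ p ^ j) +
      z ^ p ^ j := by
    have h1 : H.comul x = x ᵍ⊗ₜ[ZMod p] 1 + (1 ᵍ⊗ₜ[ZMod p] x + z) := by rw [hz]; abel
    rw [map_pow, h1, add_pow_char_pow_of_commute p j (hc.commute_tmul_one hxe _),
      add_pow_char_pow_of_commute p j (hc.commute_one_tmul hxe _), ← add_assoc]
    congr 2
    · exact (map_pow (includeLeft 𝒜 𝒜) x _).symm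
    · exact (map_pow (includeRight 𝒜 𝒜) x _).symm
  have hslice : ∀ (m : ℕ) (t : 𝒜 ᵍ⊗[ZMod p] 𝒜),
      slice 𝒜 ψ (1 ᵍ⊗ₜ[ZMod p] (x ^ m) * t) = x ^ m * slice 𝒜 ψ t := by
    intro m
    induction m with
    | zero =>
      intro t
      rw [pow_zero, one_mul]
      exact congrArg _ (one_mul t)
    | succ m ih =>
      intro t
      have h2 : (1 ᵍ⊗ₜ[ZMod p] (x ^ (m + 1)) : 𝒜 ᵍ⊗[ZMod p] 𝒜) =
          1 ᵍ⊗ₜ[ZMod p] (x ^ m) * 1 ᵍ⊗ₜ[ZMod p] x := by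
        rw [pow_succ]; exact map_mul (includeRight 𝒜 𝒜) (x ^ m) x
      rw [h2, mul_assoc, ih, slice_one_tmul_mul ψ hxe, ← mul_assoc, pow_succ]
  have hxq : x ^ p ^ j ∈ fil H.counit (p ^ j) := by simpa using pow_mem_fil hx (p ^ j)
  rw [der_apply, der_apply, map_mul, hΔ, add_mul, add_mul, map_add, map_add,
    slice_tmul_one_mul_comul H hψ hq hxq, hslice, add_sub_cancel_left]
  have h3 : z ^ p ^ j * H.comul b ∈ tensorFil 𝒜 H.counit (p ^ j * 2 + n) :=
    mul_mem_tensorFil H.counit_of_pos (pow_mem_tensorFil H.counit_of_pos (comul_sub_mem H hx) _)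
      (comul_mem_tensorFil H n b hb)
  have h4 : 1 ≤ p ^ j := Nat.one_le_pow _ _ (Fact.out : p.Prime).pos
  exact fil_le (by omega) (slice_mem_fil hψ h3)

/-- The derivation property for odd elements, with its sign. -/
theorem der_mul_sub_mem_of_odd (hψ : fil H.counit 2 ≤ LinearMap.ker ψ)
    (hψe : evenPart 𝒜 ≤ LinearMap.ker ψ) {x : B}
    (hx : x ∈ fil H.counit 1) (hxo : x ∈ oddPart 𝒜) {n : ℕ} {b : B} (hb : b ∈ fil H.counit n) :
    der H ψ (x * b) - (ψ x • b + -(x * der H ψ b)) ∈ fil H.counit (n + 1) := by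
  set z := H.comul x - (x ᵍ⊗ₜ[ZMod p] 1 + 1 ᵍ⊗ₜ[ZMod p] x) with hz
  have h1 : H.comul x = x ᵍ⊗ₜ[ZMod p] 1 + 1 ᵍ⊗ₜ[ZMod p] x + z := by rw [hz]; abel
  rw [der_apply, der_apply, map_mul, h1, add_mul, add_mul, map_add, map_add,
    slice_tmul_one_mul_comul H hψ le_rfl hx, slice_one_tmul_mul_of_odd hψe hxo,
    add_sub_cancel_left]
  have h3 : z * H.comul b ∈ tensorFil 𝒜 H.counit (2 + n) :=
    mul_mem_tensorFil H.counit_of_pos (comul_sub_mem H hx) (comul_mem_tensorFil H n b hb)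
  exact fil_le (by omega) (slice_mem_fil (q := 1) hψ h3)

end Derivation

/-! ### Elimination of symbols -/

section Elimination

variable {k B : Type*} [Field k] [Ring B] [Algebra k B]

/-- A subalgebra of the associated graded algebra of the augmentation filtration, encoded by the
family of its preimages `R n` in `fil ε n`. -/
structure IsSymbolFamily (ε : B →ₐ[k] k) (R : ℕ → Submodule k B) : Prop where
  one_mem : 1 ∈ R 0
  mul_le : ∀ m n, R m * R n ≤ R (m + n)
  le_fil : ∀ n, R n ≤ fil ε n
  fil_le : ∀ n, fil ε (n + 1) ≤ R n

/-- The family obtained from the symbol algebra `R` by adjoining on the left the elements of a space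
`U` of elements of weight `q`. -/
def adjoinFam (R : ℕ → Submodule k B) (U : Submodule k B) (q n : ℕ) : Submodule k B :=
  ⨆ (m : ℕ) (_ : m * q ≤ n), U ^ m * R (n - m * q)

variable {ε : B →ₐ[k] k} {R : ℕ → Submodule k B} {U V : Submodule k B} {q n : ℕ}

theorem adjoinFam_mono (h : U ≤ V) : adjoinFam R U q n ≤ adjoinFam R V q n :=
  iSup₂_mono fun m _ => mul_le_mul_left (pow_le_pow_left' h m) _

theorem le_adjoinFam : R n ≤ adjoinFam R U q n := by
  refine le_trans ?_ (le_iSup₂ (f := fun m (_ : m * q ≤ n) => U ^ m * R (n - m * q)) 0 (by simp))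
  simp

theorem mul_mem_adjoinFam {u y : B} (hu : u ∈ U) (hy : y ∈ adjoinFam R U q n) :
    u * y ∈ adjoinFam R U q (n + q) := by
  suffices adjoinFam R U q n ≤ (adjoinFam R U q (n + q)).comap (LinearMap.mulLeft k u) from this hy
  refine iSup₂_le fun m hm y hy => ?_
  have h1 : n + q - (m + 1) * q = n - m * q := by rw [Nat.succ_mul]; omega
  refine (le_iSup₂ (f := fun m (_ : m * q ≤ n + q) => U ^ m * R (n + q - m * q)) (m + 1)
    (by rw [Nat.succ_mul]; omega)) ?_
  rw [h1, pow_succ', mul_assoc]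
  exact Submodule.mul_mem_mul hu hy

/-- The induction principle for `adjoinFam`. -/
theorem adjoinFam_le {X : ℕ → Submodule k B} (h0 : ∀ n, R n ≤ X n)
    (h1 : ∀ n, ∀ u ∈ U, ∀ y ∈ X n, u * y ∈ X (n + q)) (n : ℕ) : adjoinFam R U q n ≤ X n := by
  have key : ∀ m j, U ^ m * R j ≤ X (j + m * q) := by
    intro m
    induction m with
    | zero => intro j; simpa using h0 j
    | succ m ih =>
      intro j
      rw [pow_succ', mul_assoc, Nat.succ_mul, ← add_assoc]
      exact Submodule.mul_le.2 fun u hu y hy => h1 _ u hu y (ih j hy)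
  refine iSup₂_le fun m hm => (key m _).trans ?_
  rw [Nat.sub_add_cancel hm]

theorem adjoinFam_le_fil (hR : IsSymbolFamily ε R) (hU : U ≤ fil ε q) (n : ℕ) :
    adjoinFam R U q n ≤ fil ε n := by
  refine adjoinFam_le hR.le_fil (fun n u hu y hy => ?_) n
  rw [add_comm]
  exact mul_mem_fil (hU hu) hy

theorem fil_le_adjoinFam (hR : IsSymbolFamily ε R) (n : ℕ) :
    fil ε (n + 1) ≤ adjoinFam R U q n := (hR.fil_le n).trans le_adjoinFam

/-- Elements of `U` of higher filtration contribute nothing. -/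
theorem adjoinFam_le_of_le_fil (hR : IsSymbolFamily ε R) (hU : U ≤ fil ε (q + 1)) (n : ℕ) :
    adjoinFam R U q n ≤ R n := by
  refine adjoinFam_le (fun _ => le_rfl) (fun n u hu y hy => hR.fil_le _ ?_) n
  have := mul_mem_fil (hU hu) (hR.le_fil n hy)
  rwa [show q + 1 + n = n + q + 1 by omega] at this

theorem central_mul_mem_adjoinFam (hR : IsSymbolFamily ε R) {j : ℕ} {y : B} (hy : y ∈ R j)
    (hyc : ∀ b, y * b = b * y) {x : B} (hx : x ∈ adjoinFam R U q n) :
    y * x ∈ adjoinFam R U q (n + j) := by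
  refine adjoinFam_le (X := fun n => (adjoinFam R U q (n + j)).comap (LinearMap.mulLeft k y))
    (fun n x hx => le_adjoinFam ?_) (fun n u hu x hx => ?_) n hx
  · rw [add_comm]; exact hR.mul_le j n (Submodule.mul_mem_mul hy hx)
  · rw [Submodule.mem_comap, LinearMap.mulLeft_apply] at hx ⊢
    rw [← mul_assoc, hyc, mul_assoc, Nat.add_right_comm]
    exact mul_mem_adjoinFam hu hx

theorem exists_fg_mem_pow_mul {S : Submodule k B} (m : ℕ) :
    ∀ x ∈ U ^ m * S, ∃ U' ≤ U, U'.FG ∧ x ∈ U' ^ m * S := by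
  induction m with
  | zero => intro x hx; exact ⟨⊥, bot_le, Submodule.fg_bot, by simpa using hx⟩
  | succ m ih =>
    intro z hz
    rw [pow_succ', mul_assoc] at hz
    induction hz using Submodule.mul_induction_on' with
    | mem_mul_mem u hu y hy =>
      obtain ⟨U', hU', hfg, hy'⟩ := ih y hy
      refine ⟨U' ⊔ Submodule.span k {u}, sup_le hU' (by simpa using hu),
        hfg.sup (Submodule.fg_span_singleton u), ?_⟩
      rw [pow_succ', mul_assoc]
      refine Submodule.mul_mem_mul
        (Submodule.mem_sup_right (Submodule.mem_span_singleton_self u)) ?_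
      exact mul_le_mul_left (pow_le_pow_left' le_sup_left m) S hy'
    | add x _ y _ hx hy =>
      obtain ⟨U₁, h1, f1, m1⟩ := hx
      obtain ⟨U₂, h2, f2, m2⟩ := hy
      refine ⟨U₁ ⊔ U₂, sup_le h1 h2, f1.sup f2, add_mem ?_ ?_⟩
      · exact mul_le_mul_left (pow_le_pow_left' le_sup_left _) S m1
      · exact mul_le_mul_left (pow_le_pow_left' le_sup_right _) S m2

theorem exists_fg_mem_adjoinFam {x : B} (hx : x ∈ adjoinFam R U q n) :
    ∃ U' ≤ U, U'.FG ∧ x ∈ adjoinFam R U' q n := by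
  induction hx using Submodule.iSup_induction' with
  | mem m x hx =>
    by_cases hm : m * q ≤ n
    · rw [iSup_pos hm] at hx
      obtain ⟨U', h, f, hx'⟩ := exists_fg_mem_pow_mul m x hx
      exact ⟨U', h, f, le_iSup₂ (f := fun m (_ : m * q ≤ n) => U' ^ m * R (n - m * q)) m hm hx'⟩
    · rw [iSup_neg hm, Submodule.mem_bot] at hx
      exact ⟨⊥, bot_le, Submodule.fg_bot, hx ▸ zero_mem _⟩
  | zero => exact ⟨⊥, bot_le, Submodule.fg_bot, zero_mem _⟩
  | add x y _ _ hx hy =>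
    obtain ⟨U₁, h1, f1, m1⟩ := hx
    obtain ⟨U₂, h2, f2, m2⟩ := hy
    exact ⟨U₁ ⊔ U₂, sup_le h1 h2, f1.sup f2,
      add_mem (adjoinFam_mono le_sup_left m1) (adjoinFam_mono le_sup_right m2)⟩

/-- The elements of the form `∑ i ≤ e, w ^ i * M i` with `M i` in the symbol algebra `E`, where `w`
has weight `q`. -/
def polyFam (E : ℕ → Submodule k B) (w : B) (q e n : ℕ) : Submodule k B :=
  ⨆ (i : ℕ) (_ : i ≤ e), (E (n - i * q)).map (LinearMap.mulLeft k (w ^ i))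

variable {E : ℕ → Submodule k B} {w : B} {e : ℕ}

theorem polyFam_le_iff {X : Submodule k B} :
    polyFam E w q e n ≤ X ↔ ∀ i ≤ e, ∀ M ∈ E (n - i * q), w ^ i * M ∈ X := by
  simp only [polyFam, iSup_le_iff, Submodule.map_le_iff_le_comap]
  exact Iff.rfl

theorem mem_of_mem_polyFam {b : B} (hb : b ∈ polyFam E w q e n) (X : Submodule k B)
    (h : ∀ i ≤ e, ∀ M ∈ E (n - i * q), w ^ i * M ∈ X) : b ∈ X := polyFam_le_iff.2 h hb

theorem mul_mem_polyFam {i : ℕ} (hi : i ≤ e) {M : B} (hM : M ∈ E (n - i * q)) :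
    w ^ i * M ∈ polyFam E w q e n := polyFam_le_iff.1 le_rfl i hi M hM

theorem polyFam_zero : polyFam E w q 0 n = E n := by
  refine le_antisymm (polyFam_le_iff.2 fun i hi M hM => ?_) fun x hx => ?_
  · obtain rfl : i = 0 := by omega
    simpa using hM
  · have := mul_mem_polyFam (E := E) (w := w) (q := q) (n := n) (le_refl 0) (M := x)
      (by simpa using hx)
    simpa using this

theorem polyFam_mono {e e' : ℕ} (h : e ≤ e') : polyFam E w q e n ≤ polyFam E w q e' n :=
  polyFam_le_iff.2 fun _ hi _ hM => mul_mem_polyFam (hi.trans h) hM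

theorem exists_of_mem_polyFam_succ {b : B} (hb : b ∈ polyFam E w q (e + 1) n) :
    ∃ b' ∈ polyFam E w q e n, ∃ M ∈ E (n - (e + 1) * q), b = b' + w ^ (e + 1) * M := by
  have : polyFam E w q (e + 1) n ≤ polyFam E w q e n ⊔
      (E (n - (e + 1) * q)).map (LinearMap.mulLeft k (w ^ (e + 1))) := by
    refine polyFam_le_iff.2 fun i hi M hM => ?_
    rcases Nat.eq_or_lt_of_le hi with rfl | hi
    · exact Submodule.mem_sup_right (Submodule.mem_map_of_mem hM)
    · exact Submodule.mem_sup_left (mul_mem_polyFam (by omega) hM)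
  obtain ⟨b', hb', z, hz, rfl⟩ := Submodule.mem_sup.1 (this hb)
  obtain ⟨M, hM, rfl⟩ := hz
  exact ⟨b', hb', M, hM, rfl⟩

/-- If `w ^ r` lies in the symbol algebra `R`, then every element of the algebra generated over `R`
by `w` and `V` is a polynomial in `w` of degree less than `r` over the algebra generated by `V`. -/
theorem adjoinFam_le_polyFam (hR : IsSymbolFamily ε R) (hV : V ≤ fil ε q) (hw : w ∈ fil ε q)
    (hU : U ≤ Submodule.span k {w} ⊔ V) {s : k} (hs : ∀ u ∈ V, u * w = s • (w * u)) {r : ℕ}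
    (hr : 1 ≤ r) (hwr : w ^ r ∈ R (r * q)) (hwc : ∀ b, w ^ r * b = b * w ^ r) (n : ℕ) :
    adjoinFam R U q n ≤ polyFam (adjoinFam R V q) w q (r - 1) n := by
  have hfil : ∀ n, fil ε (n + 1) ≤ polyFam (adjoinFam R V q) w q (r - 1) n := fun n =>
    (fil_le_adjoinFam hR n).trans (polyFam_zero.symm.le.trans (polyFam_mono (Nat.zero_le _)))
  have hpow : ∀ u ∈ V, ∀ i, u * w ^ i = s ^ i • (w ^ i * u) := by
    intro u hu i
    induction i with
    | zero => simp
    | succ i ih =>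
      rw [pow_succ w, ← mul_assoc, ih, smul_mul_assoc, mul_assoc, hs u hu, mul_smul_comm, smul_smul,
        ← pow_succ, mul_assoc]
  refine adjoinFam_le (fun n x hx => ?_) (fun n u hu y hy => ?_) n
  · exact polyFam_mono (Nat.zero_le _) (polyFam_zero.symm.le (le_adjoinFam hx))
  · obtain ⟨c, hc, v, hv, rfl⟩ := Submodule.mem_sup.1 (hU hu)
    obtain ⟨a, rfl⟩ := Submodule.mem_span_singleton.1 hc
    suffices polyFam (adjoinFam R V q) w q (r - 1) n ≤
        (polyFam (adjoinFam R V q) w q (r - 1) (n + q)).comap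
          (LinearMap.mulLeft k (a • w + v)) from this hy
    refine polyFam_le_iff.2 fun i hi M hM => ?_
    rw [Submodule.mem_comap, LinearMap.mulLeft_apply, add_mul, smul_mul_assoc]
    by_cases hin : i * q ≤ n
    · refine add_mem (Submodule.smul_mem _ _ ?_) ?_
      · rw [← mul_assoc, ← pow_succ']
        rcases Nat.lt_or_ge (i + 1) r with h | h
        · refine mul_mem_polyFam (by omega) ?_
          rwa [show n + q - (i + 1) * q = n - i * q by rw [Nat.succ_mul]; omega]
        · obtain rfl : i + 1 = r := by omega
          refine polyFam_mono (Nat.zero_le _) (polyFam_zero.symm.le ?_)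
          have h3 := central_mul_mem_adjoinFam hR hwr hwc hM
          rwa [show n - i * q + (i + 1) * q = n + q by rw [Nat.succ_mul]; omega] at h3
      · rw [← mul_assoc, hpow v hv, smul_mul_assoc, mul_assoc]
        refine Submodule.smul_mem _ _ (mul_mem_polyFam hi ?_)
        rw [show n + q - i * q = n - i * q + q by omega]
        exact mul_mem_adjoinFam hv hM
    · -- here `w ^ i` alone has filtration greater than `n`
      refine hfil _ ?_
      have h1 : w ^ i * M ∈ fil ε (n + 1) := by
        rw [← add_zero (n + 1)]
        exact mul_mem_fil (fil_le (by omega) (pow_mem_fil hw i)) (mem_fil_zero M)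
      have h2 : ∀ y ∈ fil ε q, y * (w ^ i * M) ∈ fil ε (n + q + 1) := fun y hy => by
        rw [show n + q + 1 = q + (n + 1) by omega]
        exact mul_mem_fil hy h1
      exact add_mem (Submodule.smul_mem _ _ (h2 w hw)) (h2 v (hV hv))

/-- The coefficient of `w ^ (e - 1)` in the derivative of `w ^ e` with respect to a derivation with
sign `s`. -/
def dcoef (s : k) : ℕ → k
  | 0 => 0
  | e + 1 => 1 + s * dcoef s e

/-- The coefficient of `w ^ (e - j)` in the `j`-th derivative of `w ^ e`. -/
def dfac (s : k) : ℕ → ℕ → k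
  | _, 0 => 1
  | e, j + 1 => dcoef s e * dfac s (e - 1) j

theorem dfac_eq_zero {s : k} {e j : ℕ} (h : e < j) : dfac s e j = 0 := by
  induction j generalizing e with
  | zero => omega
  | succ j ih =>
    rw [dfac]
    rcases Nat.eq_zero_or_pos e with rfl | he
    · rw [dcoef, zero_mul]
    · rw [ih (by omega), mul_zero]

theorem dfac_self_ne_zero {s : k} {e : ℕ} (h : ∀ i, 1 ≤ i → i ≤ e → dcoef s i ≠ 0) :
    dfac s e e ≠ 0 := by
  induction e with
  | zero => exact one_ne_zero
  | succ e ih => exact mul_ne_zero (h _ (by omega) le_rfl) (ih fun i h1 h2 => h i h1 (by omega))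

/-- An operator `D` that acts on the associated graded algebra as the derivation `∂/∂w` of the
algebra generated over `R` by `w` and `V`. -/
structure IsPartialDerivation (ε : B →ₐ[k] k) (R : ℕ → Submodule k B) (V : Submodule k B) (w : B)
    (q : ℕ) (s : k) (D : B →ₗ[k] B) : Prop where
  mem_fil : ∀ n, ∀ x ∈ fil ε n, D x ∈ fil ε (n - q)
  mem_fil_of_mem : ∀ n, ∀ x ∈ R n, D x ∈ fil ε (n + 1 - q)
  mul_left : ∀ u ∈ V, ∀ n, ∀ b ∈ fil ε n, D (u * b) - s • (u * D b) ∈ fil ε (n + 1)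
  mul_self : ∀ n, ∀ b ∈ fil ε n, D (w * b) - (b + s • (w * D b)) ∈ fil ε (n + 1)

variable {s : k} {D : B →ₗ[k] B}

theorem IsPartialDerivation.mem_fil_of_mem_adjoinFam (hD : IsPartialDerivation ε R V w q s D)
    (hR : IsSymbolFamily ε R) (hV : V ≤ fil ε q) {x : B} (hx : x ∈ adjoinFam R V q n) :
    D x ∈ fil ε (n + 1 - q) := by
  refine (adjoinFam_le (X := fun n => fil ε n ⊓ (fil ε (n + 1 - q)).comap D)
    (fun n x hx => ⟨hR.le_fil n hx, hD.mem_fil_of_mem n x hx⟩) (fun n u hu y hy => ⟨?_, ?_⟩) n hx).2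
  · rw [add_comm]; exact mul_mem_fil (hV hu) hy.1
  · have h1 := hD.mul_left u hu n y hy.1
    have h2 : u * D y ∈ fil ε (n + 1) := fil_le (by omega) (mul_mem_fil (hV hu) hy.2)
    rw [SetLike.mem_coe, Submodule.mem_comap, show n + q + 1 - q = n + 1 by omega]
    rw [← sub_add_cancel (D (u * y)) (s • (u * D y))]
    exact add_mem h1 (Submodule.smul_mem _ _ h2)

theorem IsPartialDerivation.pow_mul_sub_mem (hD : IsPartialDerivation ε R V w q s D)
    (hR : IsSymbolFamily ε R) (hV : V ≤ fil ε q) (hw : w ∈ fil ε q) {M : B}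
    (hM : M ∈ adjoinFam R V q n) (e : ℕ) :
    D (w ^ e * M) - dcoef s e • (w ^ (e - 1) * M) ∈ fil ε (n + e * q + 1 - q) := by
  have hMf := adjoinFam_le_fil hR hV n hM
  induction e with
  | zero => simpa [dcoef] using hD.mem_fil_of_mem_adjoinFam hR hV hM
  | succ e ih =>
    have hb : w ^ e * M ∈ fil ε (n + e * q) := by
      rw [add_comm]; exact mul_mem_fil (pow_mem_fil hw e) hMf
    have h1 := hD.mul_self _ _ hb
    have h2 : w * (D (w ^ e * M) - dcoef s e • (w ^ (e - 1) * M)) ∈ fil ε (n + e * q + 1) :=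
      fil_le (by omega) (mul_mem_fil hw ih)
    have h3 : w * (dcoef s e • (w ^ (e - 1) * M)) = dcoef s e • (w ^ e * M) := by
      rcases Nat.eq_zero_or_pos e with rfl | he
      · simp [dcoef]
      · obtain ⟨f, rfl⟩ : ∃ f, e = f + 1 := ⟨e - 1, by omega⟩
        rw [mul_smul_comm, ← mul_assoc, Nat.add_sub_cancel, ← pow_succ']
    rw [show n + (e + 1) * q + 1 - q = n + e * q + 1 by rw [Nat.succ_mul]; omega]
    rw [pow_succ', mul_assoc, Nat.add_sub_cancel, dcoef]
    have h4 : D (w * (w ^ e * M)) - (1 + s * dcoef s e) • (w ^ e * M) =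
        (D (w * (w ^ e * M)) - (w ^ e * M + s • (w * D (w ^ e * M)))) +
          s • (w * (D (w ^ e * M) - dcoef s e • (w ^ (e - 1) * M))) := by
      rw [mul_sub, h3, add_smul, one_smul, mul_smul, smul_sub]
      abel
    rw [h4]
    exact add_mem h1 (Submodule.smul_mem _ _ h2)

theorem IsPartialDerivation.iterate_mem_fil (hD : IsPartialDerivation ε R V w q s D) (j : ℕ) {x : B}
    (hx : x ∈ fil ε n) : (D ^ j) x ∈ fil ε (n - j * q) := by
  induction j with
  | zero => simpa using hx
  | succ j ih =>
    rw [pow_succ', Module.End.mul_apply]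
    refine fil_le ?_ (hD.mem_fil _ _ ih)
    rw [Nat.succ_mul]; omega

theorem IsPartialDerivation.iterate_pow_mul_sub_mem (hD : IsPartialDerivation ε R V w q s D)
    (hR : IsSymbolFamily ε R) (hV : V ≤ fil ε q) (hw : w ∈ fil ε q) {M : B}
    (hM : M ∈ adjoinFam R V q n) (j e : ℕ) :
    (D ^ j) (w ^ e * M) - dfac s e j • (w ^ (e - j) * M) ∈ fil ε (n + e * q + 1 - j * q) := by
  induction j generalizing e with
  | zero => simp [dfac]
  | succ j ih =>
    have h1 := hD.iterate_mem_fil j (hD.pow_mul_sub_mem hR hV hw hM e)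
    rw [map_sub, map_smul] at h1
    rw [pow_succ, Module.End.mul_apply, dfac]
    rcases Nat.eq_zero_or_pos e with rfl | he
    · simp only [dcoef, zero_smul, sub_zero, zero_mul, pow_zero, one_mul, add_zero] at h1 ⊢
      exact fil_le (by rw [Nat.succ_mul]; omega) h1
    · obtain ⟨f, rfl⟩ : ∃ f, e = f + 1 := ⟨e - 1, by omega⟩
      have h2 := Submodule.smul_mem _ (dcoef s (f + 1)) (ih f)
      rw [Nat.add_sub_cancel] at h1 ⊢
      rw [Nat.add_sub_add_right, mul_smul, ← sub_add_sub_cancel _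
        (dcoef s (f + 1) • (D ^ j) (w ^ f * M)), ← smul_sub]
      refine add_mem (fil_le ?_ h1) (fil_le ?_ h2)
      · rw [Nat.succ_mul, Nat.succ_mul]; omega
      · rw [Nat.succ_mul, Nat.succ_mul]; omega

/-- The leading coefficient of a polynomial in `w` is recovered by iterating `∂/∂w`. -/
theorem IsPartialDerivation.leading_coeff_mem (hD : IsPartialDerivation ε R V w q s D)
    (hR : IsSymbolFamily ε R) (hV : V ≤ fil ε q) (hw : w ∈ fil ε q) (he : (e + 1) * q ≤ n)
    {b' M : B} (hb' : b' ∈ polyFam (adjoinFam R V q) w q e n)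
    (hM : M ∈ adjoinFam R V q (n - (e + 1) * q)) :
    (D ^ (e + 1)) (b' + w ^ (e + 1) * M) - dfac s (e + 1) (e + 1) • M ∈
      fil ε (n - (e + 1) * q + 1) := by
  have h1 := hD.iterate_pow_mul_sub_mem hR hV hw hM (e + 1) (e + 1)
  rw [Nat.sub_self, pow_zero, one_mul] at h1
  rw [map_add, add_sub_assoc]
  refine add_mem ?_ (fil_le (by omega) h1)
  refine mem_of_mem_polyFam hb' ((fil ε (n - (e + 1) * q + 1)).comap (D ^ (e + 1)))
    fun i hi M hM => ?_
  have h2 := hD.iterate_pow_mul_sub_mem hR hV hw hM (e + 1) i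
  rw [dfac_eq_zero (by omega), zero_smul, sub_zero] at h2
  have h3 : i * q ≤ (e + 1) * q := Nat.mul_le_mul_right _ (by omega)
  rw [Submodule.mem_comap]
  exact fil_le (by omega) h2

/-- One step of the elimination of `w`: the leading term of a polynomial in `w` that lies in `A` can
be removed modulo `C`, either because `w` has a representative in `C`, or because the leading
coefficient vanishes. -/
theorem IsPartialDerivation.inf_polyFam_succ_le {A C : Subalgebra k B}
    (hD : IsPartialDerivation ε R V w q s D)
    (hR : IsSymbolFamily ε R) (hV : V ≤ fil ε q) (hw : w ∈ fil ε q) (hq : 1 ≤ q)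
    (hdA : ∀ x ∈ A, D x ∈ A)
    (hcase : (∃ c ∈ C, c - w ∈ fil ε (q + 1)) ∨ ∀ x ∈ A, D x = 0)
    (hfac : dfac s (e + 1) (e + 1) ≠ 0)
    (ih : ∀ m < n, ∀ a ∈ A, a ∈ fil ε m → ∃ c ∈ C, a - c ∈ fil ε (m + 1))
    {b : B} (hbA : b ∈ A) (hb : b ∈ polyFam (adjoinFam R V q) w q (e + 1) n) :
    ∃ c ∈ C, b - c ∈ polyFam (adjoinFam R V q) w q e n := by
  have hfil : fil ε (n + 1) ≤ polyFam (adjoinFam R V q) w q e n :=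
    (fil_le_adjoinFam hR n).trans (polyFam_zero.symm.le.trans (polyFam_mono (Nat.zero_le _)))
  obtain ⟨b', hb', M, hM, rfl⟩ := exists_of_mem_polyFam_succ hb
  by_cases he : (e + 1) * q ≤ n
  swap
  · refine ⟨0, zero_mem _, ?_⟩
    rw [sub_zero]
    refine add_mem hb' (hfil ?_)
    have := mul_mem_fil (pow_mem_fil hw (e + 1)) (mem_fil_zero (ε := ε) M)
    exact fil_le (by omega) this
  have hlead := hD.leading_coeff_mem hR hV hw he hb' hM
  set d := dfac s (e + 1) (e + 1)
  set b := b' + w ^ (e + 1) * M with hbdef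
  have hMf := adjoinFam_le_fil hR hV _ hM
  have hDA : ∀ j, (D ^ j) b ∈ A := fun j => by
    induction j with
    | zero => simpa using hbA
    | succ j ih => rw [pow_succ', Module.End.mul_apply]; exact hdA _ ih
  have hM' : d⁻¹ • (D ^ (e + 1)) b - M ∈ fil ε (n - (e + 1) * q + 1) := by
    have := Submodule.smul_mem _ d⁻¹ hlead
    rwa [smul_sub, smul_smul, inv_mul_cancel₀ hfac, one_smul] at this
  rcases hcase with ⟨c, hc, hcw⟩ | h0
  · have hcq : c ∈ fil ε q := by
      rw [← sub_add_cancel c w]; exact add_mem (fil_le (by omega) hcw) hw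
    have hDb : (D ^ (e + 1)) b ∈ fil ε (n - (e + 1) * q) := by
      refine hD.iterate_mem_fil (e + 1) ?_
      refine add_mem ?_ (fil_le (by omega) (mul_mem_fil (pow_mem_fil hw (e + 1)) hMf))
      refine mem_of_mem_polyFam hb' _ fun i hi N hN => ?_
      exact fil_le (by omega) (mul_mem_fil (pow_mem_fil hw i) (adjoinFam_le_fil hR hV _ hN))
    have hlt : n - (e + 1) * q < n := by
      have : 1 ≤ (e + 1) * q := Nat.mul_pos (by omega) hq
      omega
    obtain ⟨c', hc', hcc'⟩ := ih _ hlt _ (A.smul_mem (hDA (e + 1)) d⁻¹)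
      (Submodule.smul_mem _ _ hDb)
    refine ⟨c ^ (e + 1) * c', mul_mem (pow_mem hc _) hc', ?_⟩
    have h5 : w ^ (e + 1) * M - c ^ (e + 1) * c' ∈ fil ε (n + 1) := by
      have h6 : M - c' ∈ fil ε (n - (e + 1) * q + 1) := by
        have := sub_mem hcc' hM'
        rwa [sub_sub_sub_cancel_left] at this
      have h7 : w ^ (e + 1) - c ^ (e + 1) ∈ fil ε ((e + 1) * q + 1) :=
        pow_sub_pow_mem_fil hw hcq (by rw [← neg_sub]; exact neg_mem hcw) _
      have hc'f : c' ∈ fil ε (n - (e + 1) * q) := by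
        rw [← sub_sub_self M c']
        exact sub_mem hMf (fil_le (by omega) h6)
      have := mul_sub_mul_mem_fil (pow_mem_fil hw (e + 1)) hc'f h7 h6
      rwa [Nat.add_sub_cancel' he] at this
    rw [hbdef, add_sub_assoc]
    exact add_mem hb' (hfil h5)
  · refine ⟨0, zero_mem _, ?_⟩
    have h8 : (D ^ (e + 1)) b = 0 := by
      rw [pow_succ', Module.End.mul_apply]; exact h0 _ (hDA e)
    rw [h8, smul_zero, zero_sub, ← neg_mem_iff, neg_neg] at hM'
    rw [sub_zero, hbdef]
    refine add_mem hb' (hfil ?_)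
    exact fil_le (by omega) (mul_mem_fil (pow_mem_fil hw (e + 1)) hM')

/-- The powers of `w` are removed one after the other, beginning with the highest. -/
theorem IsPartialDerivation.inf_polyFam_le {A C : Subalgebra k B}
    (hD : IsPartialDerivation ε R V w q s D)
    (hR : IsSymbolFamily ε R) (hV : V ≤ fil ε q) (hw : w ∈ fil ε q) (hq : 1 ≤ q) (hCA : C ≤ A)
    (hdA : ∀ x ∈ A, D x ∈ A)
    (hcase : (∃ c ∈ C, c - w ∈ fil ε (q + 1)) ∨ ∀ x ∈ A, D x = 0)
    (ih : ∀ m < n, ∀ a ∈ A, a ∈ fil ε m → ∃ c ∈ C, a - c ∈ fil ε (m + 1)) (e : ℕ)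
    (hcoef : ∀ i, 1 ≤ i → i ≤ e → dcoef s i ≠ 0) :
    ∀ b ∈ A, b ∈ polyFam (adjoinFam R V q) w q e n → ∃ c ∈ C, b - c ∈ adjoinFam R V q n := by
  induction e with
  | zero =>
    intro b _ hb
    rw [polyFam_zero] at hb
    exact ⟨0, zero_mem _, by rwa [sub_zero]⟩
  | succ e ihe =>
    intro b hbA hb
    obtain ⟨c, hc, hbc⟩ := hD.inf_polyFam_succ_le hR hV hw hq hdA hcase
      (dfac_self_ne_zero hcoef) ih hbA hb
    obtain ⟨c', hc', hbc'⟩ := ihe (fun i h1 h2 => hcoef i h1 (by omega)) _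
      (sub_mem hbA (hCA hc)) hbc
    exact ⟨c + c', add_mem hc hc', by rwa [← sub_sub]⟩

/-- Enough derivations to separate elements of `U` from `fil ε (q + 1)` and from
`A + fil ε (q + 1)`. -/
def HasPartialDerivations (ε : B →ₐ[k] k) (R : ℕ → Submodule k B) (A : Subalgebra k B)
    (U : Submodule k B) (q : ℕ) (s : k) : Prop :=
  ∀ K : Submodule k B, K = fil ε (q + 1) ∨ K = Subalgebra.toSubmodule A ⊔ fil ε (q + 1) →
    ∀ w ∈ U, w ∉ K → ∃ (ψ : B →ₗ[k] k) (D : B →ₗ[k] B), ψ w = 1 ∧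
      (∀ V ≤ U, (∀ u ∈ V, ψ u = 0) → IsPartialDerivation ε R V w q s D) ∧
      (∀ x ∈ A, D x ∈ A) ∧ (Subalgebra.toSubmodule A ≤ K → ∀ x ∈ A, D x = 0)

/-- **Elimination of a space of generators.** Suppose that modulo higher filtration every element
of `U` with a representative in `A` has one in `C`. Then elements of `A` whose symbol is a
polynomial in elements of `U` over `R` are congruent modulo `C` to elements with symbol in `R`. -/
theorem exists_sub_mem_of_mem_adjoinFam {A C : Subalgebra k B}
    (hR : IsSymbolFamily ε R) (hU : U ≤ fil ε q) (hq : 1 ≤ q) (hCA : C ≤ A) {r : ℕ} (hr : 1 ≤ r)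
    (hcoef : ∀ i, 1 ≤ i → i < r → dcoef s i ≠ 0)
    (hs : ∀ u ∈ U, ∀ w ∈ U, u * w = s • (w * u))
    (hUr : ∀ w ∈ U, w ^ r ∈ R (r * q) ∧ ∀ b, w ^ r * b = b * w ^ r)
    (hder : HasPartialDerivations ε R A U q s)
    (hC : ∀ w ∈ U, w ∈ Subalgebra.toSubmodule A ⊔ fil ε (q + 1) →
      w ∈ Subalgebra.toSubmodule C ⊔ fil ε (q + 1))
    (ih : ∀ m < n, ∀ a ∈ A, a ∈ fil ε m → ∃ c ∈ C, a - c ∈ fil ε (m + 1)) :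
    ∀ b ∈ A, b ∈ adjoinFam R U q n → ∃ c ∈ C, b - c ∈ R n := by
  -- only finitely many generators are involved; eliminate them one at a time
  have key : ∀ (d : ℕ) (U' : Submodule k B), U' ≤ U → U'.FG → Module.finrank k U' = d →
      ∀ b ∈ A, b ∈ adjoinFam R U' q n → ∃ c ∈ C, b - c ∈ R n := by
    intro d
    induction d using Nat.strong_induction_on with
    | _ d ihd =>
      intro U' hU' hfg hd b hbA hb
      by_cases hle : U' ≤ fil ε (q + 1)
      · exact ⟨0, zero_mem _, by rw [sub_zero]; exact adjoinFam_le_of_le_fil hR hle n hb⟩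
      -- choose `w` with a representative in `C` as long as possible; after that `A` is killed
      obtain ⟨K, hK, w, hw, hwK, hcase⟩ : ∃ K : Submodule k B,
          (K = fil ε (q + 1) ∨ K = Subalgebra.toSubmodule A ⊔ fil ε (q + 1)) ∧ ∃ w ∈ U', w ∉ K ∧
            ((∃ c ∈ C, c - w ∈ fil ε (q + 1)) ∨ Subalgebra.toSubmodule A ≤ K) := by
        by_cases h : ∃ w ∈ U', w ∉ fil ε (q + 1) ∧ w ∈ Subalgebra.toSubmodule A ⊔ fil ε (q + 1)
        · obtain ⟨w, hw, hwf, hwA⟩ := h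
          obtain ⟨c, hc, y, hy, hcy⟩ := Submodule.mem_sup.1 (hC w (hU' hw) hwA)
          refine ⟨_, Or.inl rfl, w, hw, hwf, Or.inl ⟨c, hc, ?_⟩⟩
          rw [← hcy, sub_add_cancel_left]
          exact neg_mem hy
        · push Not at h
          obtain ⟨w, hw, hwf⟩ := SetLike.not_le_iff_exists.1 hle
          exact ⟨_, Or.inr rfl, w, hw, h w hw hwf, Or.inr le_sup_left⟩
      obtain ⟨ψ, D, hψw, hD, hDA, hD0⟩ := hder K hK w (hU' hw) hwK
      -- split off `w` by means of the functional `ψ`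
      set V := U' ⊓ LinearMap.ker ψ with hVdef
      have hVU : V ≤ U' := inf_le_left
      have hspan : U' ≤ Submodule.span k {w} ⊔ V := by
        intro u hu
        refine Submodule.mem_sup.2 ⟨ψ u • w, Submodule.smul_mem _ _
          (Submodule.mem_span_singleton_self w), u - ψ u • w, ⟨?_, ?_⟩, by abel⟩
        · exact sub_mem hu (Submodule.smul_mem _ _ hw)
        · simp [hψw]
      have : Module.Finite k U' := Module.Finite.iff_fg.2 hfg
      have hlt : V < U' := lt_of_le_of_ne hVU fun h => by
        have h1 : w ∈ V := h ▸ hw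
        have h2 : ψ w = 0 := h1.2
        rw [hψw] at h2
        exact one_ne_zero h2
      have hDV := hD V (hVU.trans hU') fun u hu => hu.2
      have hVf : V ≤ fil ε q := (hVU.trans hU').trans hU
      have hwU := hU' hw
      have hpoly := adjoinFam_le_polyFam hR hVf (hU hwU) hspan
        (fun u hu => hs u (hU' (hVU hu)) w hwU) hr (hUr w hwU).1 (hUr w hwU).2 n hb
      obtain ⟨c, hc, hbc⟩ := hDV.inf_polyFam_le hR hVf (hU hwU) hq hCA hDA
        (hcase.imp_right hD0) ih (r - 1) (fun i h1 h2 => hcoef i h1 (by omega)) b hbA hpoly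
      have hVfg : V.FG := by
        have : Module.Finite k V := Submodule.finiteDimensional_of_le hVU
        exact Module.Finite.iff_fg.1 this
      obtain ⟨c', hc', hbc'⟩ := ihd (Module.finrank k V)
        (hd ▸ Submodule.finrank_lt_finrank_of_lt hlt) V (hVU.trans hU') hVfg rfl _
        (sub_mem hbA (hCA hc)) hbc
      exact ⟨c + c', add_mem hc hc', by rwa [← sub_sub]⟩
  intro b hbA hb
  obtain ⟨U', hU', hfg, hb'⟩ := exists_fg_mem_adjoinFam hb
  exact key _ U' hU' hfg rfl b hbA hb'

end Elimination

/-! ### Hopf subalgebras are determined by their symbols -/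

section Levels

open DirectSum

variable {p : ℕ} {B : Type*} [Ring B] [Algebra (ZMod p) B]
  {𝒜 : ℕ → Submodule (ZMod p) B}

variable (𝒜) in
/-- The space of `p ^ j`-th powers of elements of the augmentation ideal that are concentrated in
even degrees. -/
def frobSpan (ε : B →ₐ[ZMod p] ZMod p) (j : ℕ) : Submodule (ZMod p) B :=
  Submodule.span (ZMod p) {y | ∃ x ∈ evenPart 𝒜 ⊓ fil ε 1, x ^ p ^ j = y}

variable (𝒜) in
/-- The subalgebra of the associated graded algebra that is generated by the `p ^ j`-th powers of
even elements, encoded by its preimages in `B` as in `IsSymbolFamily`. -/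
def frobFam (ε : B →ₐ[ZMod p] ZMod p) (j n : ℕ) : Submodule (ZMod p) B :=
  (⨆ (m : ℕ) (_ : m * p ^ j = n), frobSpan 𝒜 ε j ^ m) ⊔ fil ε (n + 1)

variable {ε : B →ₐ[ZMod p] ZMod p}

theorem pow_mem_frobSpan {j : ℕ} {x : B} (hx : x ∈ evenPart 𝒜) (hx1 : x ∈ fil ε 1) :
    x ^ p ^ j ∈ frobSpan 𝒜 ε j := Submodule.subset_span ⟨x, ⟨hx, hx1⟩, rfl⟩

theorem frobSpan_le_fil (j : ℕ) : frobSpan 𝒜 ε j ≤ fil ε (p ^ j) := by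
  refine Submodule.span_le.2 ?_
  rintro _ ⟨x, hx, rfl⟩
  simpa using pow_mem_fil hx.2 (p ^ j)

theorem frobSpan_pow_le_fil (j m : ℕ) : frobSpan 𝒜 ε j ^ m ≤ fil ε (m * p ^ j) := by
  induction m with
  | zero =>
    rw [zero_mul]
    exact fun x _ => mem_fil_zero x
  | succ m ih =>
    rw [pow_succ, Nat.succ_mul]
    exact (mul_le_mul' ih (frobSpan_le_fil j)).trans (fil_mul_le _ _)

theorem frobSpan_pow_le_frobFam (j m : ℕ) : frobSpan 𝒜 ε j ^ m ≤ frobFam 𝒜 ε j (m * p ^ j) :=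
  le_trans (le_iSup₂ (f := fun m' (_ : m' * p ^ j = m * p ^ j) => frobSpan 𝒜 ε j ^ m') m rfl)
    le_sup_left

theorem frobFam_le_fil_of_lt {j n : ℕ} (hn : 0 < n) (h : n < p ^ j) :
    frobFam 𝒜 ε j n ≤ fil ε (n + 1) := by
  refine sup_le (iSup₂_le fun m hm => ?_) le_rfl
  rcases Nat.eq_zero_or_pos m with rfl | hm0
  · omega
  · have := Nat.le_mul_of_pos_left (p ^ j) hm0
    omega

theorem GradedComm.commute_pow [GradedAlgebra 𝒜] (hc : GradedComm 𝒜) {x : B}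
    (hx : x ∈ evenPart 𝒜) (m : ℕ) (b : B) :
    x ^ m * b = b * x ^ m := ((show Commute x b from hc.commute hx b).pow_left m).eq

theorem oddPart_le_fil_one [GradedAlgebra 𝒜] (H : GradedHopfAlgebra p 𝒜) :
    oddPart 𝒜 ≤ fil H.counit 1 :=
  oddPart_le_iff.2 fun n hn x hx => mem_fil_one.2 <| H.counit_of_pos n
    (Nat.pos_of_ne_zero fun h => hn (Or.inr (h ▸ Even.zero))) x hx

variable [Fact p.Prime]

theorem frobFam_isSymbolFamily (j : ℕ) : IsSymbolFamily ε (frobFam 𝒜 ε j) := by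
  have hle : ∀ n, frobFam 𝒜 ε j n ≤ fil ε n := fun n => sup_le
    (iSup₂_le fun m hm => hm ▸ frobSpan_pow_le_fil j m) (fil_antitone (Nat.le_succ n))
  refine ⟨?_, fun m n => ?_, hle, fun n => le_sup_right⟩
  · have := frobSpan_pow_le_frobFam (𝒜 := 𝒜) (ε := ε) j 0
    rw [pow_zero, zero_mul] at this
    exact Submodule.one_le.1 this
  · conv_lhs => rw [frobFam]
    rw [Submodule.sup_mul]
    refine sup_le ?_ ?_
    · conv_lhs => rw [frobFam]
      rw [Submodule.mul_sup]
      refine sup_le ?_ ?_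
      · simp only [Submodule.iSup_mul, Submodule.mul_iSup]
        refine iSup₂_le fun a ha => iSup₂_le fun b hb => ?_
        rw [← ha, ← hb, ← pow_add, ← add_mul]
        rw [add_comm]
        exact frobSpan_pow_le_frobFam j _
      · refine le_trans ?_ le_sup_right
        rw [add_assoc]
        refine le_trans (mul_le_mul_left ?_ _) (fil_mul_le _ _)
        exact iSup₂_le fun a ha => ha ▸ frobSpan_pow_le_fil j a
    · refine le_trans ?_ le_sup_right
      rw [Nat.add_right_comm]
      exact (mul_le_mul_right (hle n) _).trans (fil_mul_le _ _)

theorem frobFam_le_adjoinFam (j n : ℕ) :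
    frobFam 𝒜 ε j n ≤ adjoinFam (frobFam 𝒜 ε (j + 1)) (frobSpan 𝒜 ε j) (p ^ j) n := by
  refine sup_le (iSup₂_le fun m hm => ?_) (fil_le_adjoinFam (frobFam_isSymbolFamily _) n)
  refine le_trans ?_ (le_iSup₂ (f := fun m (_ : m * p ^ j ≤ n) =>
    frobSpan 𝒜 ε j ^ m * frobFam 𝒜 ε (j + 1) (n - m * p ^ j)) m hm.le)
  rw [hm, Nat.sub_self]
  intro x hx
  rw [← mul_one x]
  exact Submodule.mul_mem_mul hx (frobFam_isSymbolFamily _).one_mem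

theorem dcoef_one (e : ℕ) : dcoef (1 : ZMod p) e = e := by
  induction e with
  | zero => simp [dcoef]
  | succ e ih => rw [dcoef, ih]; push_cast; ring

variable [GradedAlgebra 𝒜]

theorem charP_of_augmented (ε : B →ₐ[ZMod p] ZMod p) : CharP B p := by
  have : Nontrivial B := ⟨0, 1, fun h => zero_ne_one (α := ZMod p) (by
    rw [← map_zero ε, h, map_one])⟩
  exact charP_of_injective_algebraMap (algebraMap (ZMod p) B).injective p

/-- In characteristic `p`, the `p ^ j`-th powers of even elements form a subspace. -/
theorem exists_of_mem_frobSpan (hc : GradedComm 𝒜) {j : ℕ} {y : B} (hy : y ∈ frobSpan 𝒜 ε j) :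
    ∃ x ∈ evenPart 𝒜 ⊓ fil ε 1, x ^ p ^ j = y := by
  have := charP_of_augmented ε
  induction hy using Submodule.span_induction with
  | mem y hy => exact hy
  | zero =>
    exact ⟨0, zero_mem _, zero_pow (pow_ne_zero _ (Fact.out : p.Prime).ne_zero)⟩
  | add y z _ _ hy hz =>
    obtain ⟨a, ha, rfl⟩ := hy
    obtain ⟨b, hb, rfl⟩ := hz
    exact ⟨a + b, add_mem ha hb, add_pow_char_pow_of_commute p j (hc.commute ha.1 b)⟩
  | smul c y _ hy =>
    obtain ⟨a, ha, rfl⟩ := hy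
    refine ⟨c • a, Submodule.smul_mem _ _ ha, ?_⟩
    rw [smul_pow, ZMod.pow_card_pow]

variable (H : GradedHopfAlgebra p 𝒜) {A C : Subalgebra (ZMod p) B}

theorem exists_functional {K : Submodule (ZMod p) B} {w : B} (hw : w ∉ K) :
    ∃ ψ : B →ₗ[ZMod p] ZMod p, ψ w = 1 ∧ K ≤ LinearMap.ker ψ := by
  obtain ⟨f, hf, hK⟩ := Submodule.exists_le_ker_of_notMem hw
  exact ⟨(f w)⁻¹ • f, by simp [hf], fun x hx => by
    simp [show f x = 0 from hK hx]⟩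

theorem der_mem_fil_of_mem_frobFam (hc : GradedComm 𝒜) {ψ : B →ₗ[ZMod p] ZMod p} {q j : ℕ}
    (hψ : fil H.counit (q + 1) ≤ LinearMap.ker ψ) (hq : 1 ≤ q) (hqj : q ≤ p ^ j)
    (hψ' : ∀ x ∈ evenPart 𝒜 ⊓ fil H.counit 1, ψ (x ^ p ^ j) = 0) (n : ℕ) :
    ∀ x ∈ frobFam 𝒜 H.counit j n, der H ψ x ∈ fil H.counit (n + 1 - q) := by
  suffices frobFam 𝒜 H.counit j n ≤ (fil H.counit (n + 1 - q)).comap (der H ψ) from this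
  refine sup_le (iSup₂_le ?_) fun x hx => der_mem_fil H hψ hx
  rintro m rfl
  induction m with
  | zero =>
    intro x _
    rw [Submodule.mem_comap, show 0 * p ^ j + 1 - q = 0 by omega]
    exact mem_fil_zero _
  | succ m ih =>
    rw [pow_succ']
    refine Submodule.mul_le.2 fun y hy z hz => ?_
    obtain ⟨x, hx, rfl⟩ := exists_of_mem_frobSpan hc hy
    have h1 := der_pow_mul_sub_mem H hc hψ hqj hx.2 hx.1 (frobSpan_pow_le_fil j m hz)
    rw [hψ' x hx, zero_smul, zero_add] at h1
    have h2 : x ^ p ^ j * der H ψ z ∈ fil H.counit ((m + 1) * p ^ j + 1 - q) := by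
      refine fil_le ?_ (mul_mem_fil (by simpa using pow_mem_fil hx.2 (p ^ j)) (ih hz))
      rw [Nat.succ_mul]; omega
    rw [Submodule.mem_comap, ← sub_add_cancel (der H ψ (x ^ p ^ j * z)) (x ^ p ^ j * der H ψ z)]
    rw [Nat.succ_mul] at h2 ⊢
    exact add_mem h1 h2

theorem hasPartialDerivations_even (hc : GradedComm 𝒜) (hA : H.IsHopfSubalgebra A) (j : ℕ) :
    HasPartialDerivations H.counit (frobFam 𝒜 H.counit (j + 1)) A (frobSpan 𝒜 H.counit j) (p ^ j)
      1 := by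
  intro K hK w hw hwK
  obtain ⟨ψ, hψw, hψK⟩ := exists_functional hwK
  have hψ : fil H.counit (p ^ j + 1) ≤ LinearMap.ker ψ := by
    rcases hK with rfl | rfl
    exacts [hψK, le_sup_right.trans hψK]
  have hq : 1 ≤ p ^ j := Nat.one_le_pow _ _ (Fact.out : p.Prime).pos
  have hlt : p ^ j < p ^ (j + 1) := Nat.pow_lt_pow_right (Fact.out : p.Prime).one_lt (by omega)
  have hmul : ∀ u ∈ frobSpan 𝒜 H.counit j, ∀ n, ∀ b ∈ fil H.counit n,
      der H ψ (u * b) - (ψ u • b + u * der H ψ b) ∈ fil H.counit (n + 1) := by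
    intro u hu n b hb
    obtain ⟨x, hx, rfl⟩ := exists_of_mem_frobSpan hc hu
    exact fil_le (by omega) (der_pow_mul_sub_mem H hc hψ le_rfl hx.2 hx.1 hb)
  refine ⟨ψ, der H ψ, hψw, fun V hV hV0 => ⟨fun n x hx => der_mem_fil H hψ hx, ?_, ?_, ?_⟩,
    fun x hx => der_mem_of_isHopfSubalgebra hA hx, fun hAK x hx =>
      der_eq_zero_of_isHopfSubalgebra hA (fun a ha => hψK (hAK ha)) hx⟩
  · refine der_mem_fil_of_mem_frobFam H hc hψ hq hlt.le fun x hx => ?_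
    have hpow : x ^ p ^ (j + 1) ∈ fil H.counit (p ^ (j + 1)) := by
      simpa using pow_mem_fil hx.2 (p ^ (j + 1))
    exact hψ (fil_le hlt hpow)
  · intro u hu n b hb
    have := hmul u (hV hu) n b hb
    rwa [hV0 u hu, zero_smul, zero_add, ← one_smul (ZMod p) (u * der H ψ b)] at this
  · intro n b hb
    have := hmul w hw n b hb
    rwa [hψw, one_smul, ← one_smul (ZMod p) (w * der H ψ b)] at this

theorem decompose_eq_zero_of_mem_evenPart {x : B} (hx : x ∈ evenPart 𝒜) {n : ℕ}
    (hn : ¬ EvenDeg p n) : (decompose 𝒜 x n : B) = 0 := by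
  suffices evenPart 𝒜 ≤ LinearMap.ker (GradedAlgebra.proj 𝒜 n) by
    have h := this hx
    rwa [LinearMap.mem_ker, GradedAlgebra.proj_apply] at h
  refine evenPart_le_iff.2 fun m hm y hy => ?_
  rw [LinearMap.mem_ker, GradedAlgebra.proj_apply]
  exact decompose_of_mem_ne 𝒜 hy fun h => hn (h ▸ hm)

theorem decompose_eq_zero_of_mem_oddPart {x : B} (hx : x ∈ oddPart 𝒜) {n : ℕ}
    (hn : EvenDeg p n) : (decompose 𝒜 x n : B) = 0 := by
  suffices oddPart 𝒜 ≤ LinearMap.ker (GradedAlgebra.proj 𝒜 n) by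
    have h := this hx
    rwa [LinearMap.mem_ker, GradedAlgebra.proj_apply] at h
  refine oddPart_le_iff.2 fun m hm y hy => ?_
  rw [LinearMap.mem_ker, GradedAlgebra.proj_apply]
  exact decompose_of_mem_ne 𝒜 hy fun h => hm (h ▸ hn)

theorem mem_of_forall_decompose_mem {K : Submodule (ZMod p) B} {x : B}
    (h : ∀ n, (decompose 𝒜 x n : B) ∈ K) : x ∈ K := by
  classical
  rw [← sum_support_decompose 𝒜 x]
  exact sum_mem fun i _ => h i

theorem decompose_mem_sup {K L : Submodule (ZMod p) B}
    (hK : ∀ x ∈ K, ∀ n, (decompose 𝒜 x n : B) ∈ K) (hL : ∀ x ∈ L, ∀ n, (decompose 𝒜 x n : B) ∈ L) :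
    ∀ x ∈ K ⊔ L, ∀ n, (decompose 𝒜 x n : B) ∈ K ⊔ L := by
  intro x hx n
  obtain ⟨a, ha, b, hb, rfl⟩ := Submodule.mem_sup.1 hx
  rw [decompose_add]
  exact Submodule.add_mem_sup (hK a ha n) (hL b hb n)

theorem mem_of_mem_sup_evenPart {K : Submodule (ZMod p) B}
    (hK : ∀ x ∈ K, ∀ n, (decompose 𝒜 x n : B) ∈ K) {w : B} (hw : w ∈ oddPart 𝒜)
    (h : w ∈ K ⊔ evenPart 𝒜) : w ∈ K := by
  refine mem_of_forall_decompose_mem (𝒜 := 𝒜) fun n => ?_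
  by_cases hn : EvenDeg p n
  · rw [decompose_eq_zero_of_mem_oddPart hw hn]; exact zero_mem _
  · obtain ⟨x, hx, e, he, rfl⟩ := Submodule.mem_sup.1 h
    rw [decompose_add, DirectSum.add_apply, Submodule.coe_add,
      decompose_eq_zero_of_mem_evenPart he hn, add_zero]
    exact hK x hx n

theorem hasPartialDerivations_odd (hc : GradedComm 𝒜) (hA : H.IsHopfSubalgebra A)
    (hAh : ∀ x ∈ A, ∀ n, (decompose 𝒜 x n : B) ∈ A) :
    HasPartialDerivations H.counit (frobFam 𝒜 H.counit 0) A (oddPart 𝒜) 1 (-1) := by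
  intro K hK w hw hwK
  have hKh : ∀ x ∈ K, ∀ n, (decompose 𝒜 x n : B) ∈ K := by
    have h2 := decompose_mem_fil H.counit_of_pos (𝒜 := 𝒜) 2
    rcases hK with rfl | rfl
    · exact h2
    · exact decompose_mem_sup hAh h2
  -- the functional is chosen to vanish on even elements
  obtain ⟨ψ, hψw, hψK⟩ := exists_functional fun h => hwK (mem_of_mem_sup_evenPart hKh hw h)
  have hψ : fil H.counit (1 + 1) ≤ LinearMap.ker ψ := by
    rcases hK with rfl | rfl
    exacts [le_sup_left.trans hψK, (le_sup_right.trans le_sup_left).trans hψK]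
  have hψe : evenPart 𝒜 ≤ LinearMap.ker ψ := le_sup_right.trans hψK
  have hmul : ∀ u ∈ oddPart 𝒜, ∀ n, ∀ b ∈ fil H.counit n,
      der H ψ (u * b) - (ψ u • b + (-1 : ZMod p) • (u * der H ψ b)) ∈ fil H.counit (n + 1) := by
    intro u hu n b hb
    rw [neg_one_smul]
    exact der_mul_sub_mem_of_odd H hψ hψe (oddPart_le_fil_one H hu) hu hb
  refine ⟨ψ, der H ψ, hψw, fun V hV hV0 => ⟨fun n x hx => der_mem_fil H hψ hx, ?_, ?_, ?_⟩,
    fun x hx => der_mem_of_isHopfSubalgebra hA hx, fun hAK x hx =>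
      der_eq_zero_of_isHopfSubalgebra hA (fun a ha => hψK (le_sup_left (a := K) (hAK ha))) hx⟩
  · refine der_mem_fil_of_mem_frobFam H hc hψ le_rfl (by simp) fun x hx => ?_
    rw [pow_zero, pow_one]
    exact hψe hx.1
  · intro u hu n b hb
    have := hmul u (hV hu) n b hb
    rwa [hV0 u hu, zero_smul, zero_add] at this
  · intro n b hb
    have := hmul w hw n b hb
    rwa [hψw, one_smul] at this

theorem fil_le_adjoinFam_oddPart (hc : GradedComm 𝒜) (n : ℕ) :
    fil H.counit n ≤ adjoinFam (frobFam 𝒜 H.counit 0) (oddPart 𝒜) 1 n := by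
  have hR := frobFam_isSymbolFamily (𝒜 := 𝒜) (ε := H.counit) 0
  induction n with
  | zero =>
    intro x _
    refine le_adjoinFam ?_
    rw [← add_sub_cancel (algebraMap (ZMod p) B (H.counit x)) x]
    refine add_mem ?_ (hR.fil_le 0 ?_)
    · rw [Algebra.algebraMap_eq_smul_one]
      exact Submodule.smul_mem _ _ hR.one_mem
    · rw [mem_fil_one]; simp
  | succ n ih =>
    rw [fil_succ]
    refine Submodule.mul_le.2 fun x hx y hy => ?_
    have hx' : x ∈ evenPart 𝒜 ⊔ oddPart 𝒜 := by rw [evenPart_sup_oddPart]; exact Submodule.mem_top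
    obtain ⟨e, he, o, ho, rfl⟩ := Submodule.mem_sup.1 hx'
    have he1 : e ∈ fil H.counit 1 := by
      have := sub_mem hx (oddPart_le_fil_one H ho)
      rwa [add_sub_cancel_right] at this
    rw [add_mul]
    refine add_mem (central_mul_mem_adjoinFam hR (j := 1) ?_ (hc.commute he) (ih hy))
      (mul_mem_adjoinFam ho (ih hy))
    have h1 := frobSpan_pow_le_frobFam (𝒜 := 𝒜) (ε := H.counit) 0 1
    rw [pow_one, pow_zero, one_mul] at h1
    simpa using h1 (pow_mem_frobSpan (j := 0) he he1)

/-- **Generation of Hopf subalgebras by `p`-th powers.** Let `C ⊆ A` be subalgebras of a graded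
Hopf algebra, `A` a Hopf subalgebra. If, modulo higher filtration, every odd element and every
`p ^ j`-th power of an even element that has a representative in `A` has one in `C`, then every
element of `A` is congruent to an element of `C` modulo higher filtration. -/
theorem exists_sub_mem_fil_succ (hc : GradedComm 𝒜) (hA : H.IsHopfSubalgebra A)
    (hAh : ∀ x ∈ A, ∀ n, (decompose 𝒜 x n : B) ∈ A) (hCA : C ≤ A)
    (hodd : ∀ x ∈ oddPart 𝒜, x ∈ Subalgebra.toSubmodule A ⊔ fil H.counit 2 →
      x ∈ Subalgebra.toSubmodule C ⊔ fil H.counit 2)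
    (heven : ∀ j, ∀ x ∈ evenPart 𝒜, x ∈ fil H.counit 1 →
      x ^ p ^ j ∈ Subalgebra.toSubmodule A ⊔ fil H.counit (p ^ j + 1) →
      x ^ p ^ j ∈ Subalgebra.toSubmodule C ⊔ fil H.counit (p ^ j + 1)) (n : ℕ) :
    ∀ a ∈ A, a ∈ fil H.counit n → ∃ c ∈ C, a - c ∈ fil H.counit (n + 1) := by
  have hp : p.Prime := Fact.out
  induction n using Nat.strong_induction_on with
  | _ n ih =>
    intro a ha han
    rcases Nat.eq_zero_or_pos n with rfl | hn
    · exact ⟨algebraMap (ZMod p) B (H.counit a), C.algebraMap_mem _, by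
        rw [mem_fil_one]; simp⟩
    -- eliminate odd elements, then `p ^ j`-th powers of even elements for `j = 0, 1, 2, …`
    have step0 : ∃ c ∈ C, a - c ∈ frobFam 𝒜 H.counit 0 n := by
      refine exists_sub_mem_of_mem_adjoinFam (s := -1) (r := 2) (q := 1) (U := oddPart 𝒜)
        (frobFam_isSymbolFamily 0) (oddPart_le_fil_one H) le_rfl hCA (by omega) ?_ ?_ ?_
        (hasPartialDerivations_odd H hc hA hAh) hodd ih a ha (fil_le_adjoinFam_oddPart H hc n han)
      · intro i h1 h2
        obtain rfl : i = 1 := by omega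
        simp [dcoef]
      · intro u hu w hw
        rw [neg_one_smul]
        exact hc.anticommute hu hw
      · intro w hw
        rw [hc.sq_eq_zero hw]
        exact ⟨zero_mem _, fun b => by rw [zero_mul, mul_zero]⟩
    have step : ∀ j, ∀ b ∈ A, b ∈ frobFam 𝒜 H.counit j n →
        ∃ c ∈ C, b - c ∈ frobFam 𝒜 H.counit (j + 1) n := by
      intro j b hb hbj
      refine exists_sub_mem_of_mem_adjoinFam (s := 1) (r := p) (q := p ^ j)
        (frobFam_isSymbolFamily (j + 1)) (frobSpan_le_fil j) (Nat.one_le_pow _ _ hp.pos) hCA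
        hp.one_le ?_ ?_ ?_ (hasPartialDerivations_even H hc hA j) ?_ ih b hb
        (frobFam_le_adjoinFam j n hbj)
      · intro i h1 h2
        rw [dcoef_one, Ne, ZMod.natCast_eq_zero_iff]
        exact Nat.not_dvd_of_pos_of_lt h1 h2
      · intro u hu w hw
        obtain ⟨x, hx, rfl⟩ := exists_of_mem_frobSpan hc hu
        rw [one_smul]
        exact hc.commute_pow hx.1 _ w
      · intro w hw
        obtain ⟨x, hx, rfl⟩ := exists_of_mem_frobSpan hc hw
        rw [← pow_mul, ← pow_succ]
        refine ⟨?_, hc.commute_pow hx.1 _⟩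
        have h1 := frobSpan_pow_le_frobFam (𝒜 := 𝒜) (ε := H.counit) (j + 1) 1
        rw [pow_one, one_mul] at h1
        rw [← pow_succ']
        exact h1 (pow_mem_frobSpan hx.1 hx.2)
      · intro w hw hwA
        obtain ⟨x, hx, rfl⟩ := exists_of_mem_frobSpan hc hw
        exact heven j x hx.1 hx.2 hwA
    have all : ∀ j, ∃ c ∈ C, a - c ∈ frobFam 𝒜 H.counit j n := by
      intro j
      induction j with
      | zero => exact step0
      | succ j ihj =>
        obtain ⟨c, hcC, hac⟩ := ihj
        obtain ⟨c', hc', hac'⟩ := step j _ (sub_mem ha (hCA hcC)) hac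
        exact ⟨c + c', add_mem hcC hc', by rwa [← sub_sub]⟩
    -- for `p ^ j > n > 0` no symbols are left in filtration `n`
    obtain ⟨c, hcC, hac⟩ := all n
    exact ⟨c, hcC, frobFam_le_fil_of_lt hn (Nat.lt_pow_self hp.one_lt) hac⟩

/-- In the situation of `exists_sub_mem_fil_succ` with `B` connected and `C` homogeneous, the
filtration is finite in every degree, and `C` is all of `A`. -/
theorem le_of_symbols (hc : GradedComm 𝒜) (hconn : 𝒜 0 = 1) (hA : H.IsHopfSubalgebra A)
    (hAh : ∀ x ∈ A, ∀ n, (decompose 𝒜 x n : B) ∈ A) (hCA : C ≤ A)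
    (hCh : ∀ x ∈ C, ∀ n, (decompose 𝒜 x n : B) ∈ C)
    (hodd : ∀ x ∈ oddPart 𝒜, x ∈ Subalgebra.toSubmodule A ⊔ fil H.counit 2 →
      x ∈ Subalgebra.toSubmodule C ⊔ fil H.counit 2)
    (heven : ∀ j, ∀ x ∈ evenPart 𝒜, x ∈ fil H.counit 1 →
      x ^ p ^ j ∈ Subalgebra.toSubmodule A ⊔ fil H.counit (p ^ j + 1) →
      x ^ p ^ j ∈ Subalgebra.toSubmodule C ⊔ fil H.counit (p ^ j + 1)) : A ≤ C := by
  intro a ha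
  have h1 : ∀ n, ∃ c ∈ C, a - c ∈ fil H.counit n := by
    intro n
    induction n with
    | zero => exact ⟨0, zero_mem _, mem_fil_zero _⟩
    | succ n ih =>
      obtain ⟨c, hcC, hac⟩ := ih
      obtain ⟨c', hc', hac'⟩ := exists_sub_mem_fil_succ H hc hA hAh hCA hodd heven n _
        (sub_mem ha (hCA hcC)) hac
      exact ⟨c + c', add_mem hcC hc', by rwa [← sub_sub]⟩
  refine mem_of_forall_decompose_mem (𝒜 := 𝒜) (K := Subalgebra.toSubmodule C) fun n => ?_
  obtain ⟨c, hcC, hac⟩ := h1 (n + 1)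
  have h2 := decompose_eq_zero_of_mem_fil H.counit_of_pos hconn (n + 1) _ hac n (Nat.lt_succ_self n)
  rw [decompose_sub, DirectSum.sub_apply, Submodule.coe_sub, sub_eq_zero] at h2
  rw [h2]
  exact hCh c hcC n

end Levels

/-! ### Finiteness in each degree, and the Steenrod operations as linear maps -/

section FiniteType

variable {k M : Type*} [Field k] [AddCommGroup M] [Module k M] {s : ℕ} {P : ℕ → M →ₗ[k] M}
  {β : M →ₗ[k] M} {L 𝓜 : ℕ → Submodule k M}

/-- A module that is finitely generated modulo `L` under operations `P i` and `β`, all of positive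
degree for `i > 0`, is finite modulo `L` in each degree. -/
theorem exists_finset_span_of_generated (hs : 1 ≤ s) (hP0 : ∀ x, P 0 x = x)
    (hL : OpClosed s P L) (hLβ : ∀ d, ∀ x ∈ L d, β x ∈ L (d + 1))
    (hM : OpClosed s P 𝓜) (hMβ : ∀ d, ∀ x ∈ 𝓜 d, β x ∈ 𝓜 (d + 1)) (hLM : L ≤ 𝓜)
    {S : Finset (ℕ × M)} (hS : ∀ x ∈ S, x.2 ∈ 𝓜 x.1)
    (hgen : ∀ Q, OpClosed s P Q → (∀ d, ∀ x ∈ Q d, β x ∈ Q (d + 1)) → L ≤ Q →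
      (∀ x ∈ S, x.2 ∈ Q x.1) → 𝓜 ≤ Q) (d : ℕ) :
    ∃ F : Finset M, (∀ x ∈ F, x ∈ 𝓜 d) ∧ 𝓜 d ≤ L d ⊔ Submodule.span k F := by
  classical
  let D : ℕ → Submodule k M := fun d => (Finset.range d).sup fun d' =>
    (if d' + 1 = d then (𝓜 d').map β else ⊥) ⊔
      (Finset.range (d + 1)).sup fun i => if d' + i * s = d then (𝓜 d').map (P i) else ⊥
  let G : ℕ → Finset M := fun d => (S.filter fun x => x.1 = d).image Prod.snd
  let Q : ℕ → Submodule k M := fun d => L d ⊔ Submodule.span k (G d) ⊔ D d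
  have hG : ∀ d, ∀ x ∈ G d, x ∈ 𝓜 d := by
    intro d x hx
    obtain ⟨y, hy, rfl⟩ := Finset.mem_image.1 hx
    obtain ⟨hyS, rfl⟩ := Finset.mem_filter.1 hy
    exact hS y hyS
  have hD : ∀ d, D d ≤ 𝓜 d := by
    intro d
    refine Finset.sup_le fun d' _ => sup_le ?_ (Finset.sup_le fun i _ => ?_)
    · split_ifs with h
      · exact Submodule.map_le_iff_le_comap.2 fun x hx => mem_of_deg_eq (hMβ d' x hx) h
      · exact bot_le
    · split_ifs with h
      · exact Submodule.map_le_iff_le_comap.2 fun x hx => mem_of_deg_eq (hM i d' x hx) h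
      · exact bot_le
  have hQM : Q ≤ 𝓜 := fun d =>
    sup_le (sup_le (hLM d) (Submodule.span_le.2 fun x hx => hG d x hx)) (hD d)
  have hMQ : 𝓜 ≤ Q := by
    refine hgen Q ?_ ?_ (fun d => le_sup_left.trans le_sup_left) ?_
    · intro i d x hx
      rcases Nat.eq_zero_or_pos i with rfl | hi
      · rw [hP0]
        exact mem_of_deg_eq hx (by simp)
      · have hpos : 0 < i * s := Nat.mul_pos hi hs
        have hi' : i ≤ i * s := Nat.le_mul_of_pos_right i hs
        refine Submodule.mem_sup_right (?_ : P i x ∈ D (d + i * s))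
        refine (Finset.le_sup (f := fun d' => (if d' + 1 = d + i * s then (𝓜 d').map β else ⊥) ⊔
          (Finset.range (d + i * s + 1)).sup fun i' => if d' + i' * s = d + i * s then
            (𝓜 d').map (P i') else ⊥) (Finset.mem_range.2 (by omega : d < d + i * s))) ?_
        refine Submodule.mem_sup_right ?_
        refine (Finset.le_sup (f := fun i' => if d + i' * s = d + i * s then
            (𝓜 d).map (P i') else ⊥) (Finset.mem_range.2 (by omega : i < d + i * s + 1))) ?_
        rw [if_pos rfl]
        exact Submodule.mem_map_of_mem (hQM d hx)
    · intro d x hx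
      refine Submodule.mem_sup_right (?_ : β x ∈ D (d + 1))
      refine (Finset.le_sup (f := fun d' => (if d' + 1 = d + 1 then (𝓜 d').map β else ⊥) ⊔
          (Finset.range (d + 1 + 1)).sup fun i' => if d' + i' * s = d + 1 then
            (𝓜 d').map (P i') else ⊥) (Finset.mem_range.2 (by omega : d < d + 1))) ?_
      refine Submodule.mem_sup_left ?_
      rw [if_pos rfl]
      exact Submodule.mem_map_of_mem (hQM d hx)
    · intro x hx
      refine Submodule.mem_sup_left (Submodule.mem_sup_right (Submodule.subset_span ?_))
      exact Finset.mem_coe.2 (Finset.mem_image.2 ⟨x, Finset.mem_filter.2 ⟨hx, rfl⟩, rfl⟩)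
  -- `Fin d X` says that `X` is finite modulo `L` in degree `d`
  let Fin : ℕ → Submodule k M → Prop := fun d X =>
    ∃ F : Submodule k M, F.FG ∧ F ≤ 𝓜 d ∧ X ≤ L d ⊔ F
  have hbot : ∀ d, Fin d ⊥ := fun d => ⟨⊥, Submodule.fg_bot, bot_le, bot_le⟩
  have hsup : ∀ d X, Fin d X → ∀ Y, Fin d Y → Fin d (X ⊔ Y) := by
    rintro d X ⟨F, hF, hFM, hX⟩ Y ⟨F', hF', hFM', hY⟩
    refine ⟨F ⊔ F', hF.sup hF', sup_le hFM hFM', sup_le (hX.trans ?_) (hY.trans ?_)⟩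
    exacts [sup_le_sup_left le_sup_left _, sup_le_sup_left le_sup_right _]
  suffices ∀ d, Fin d (𝓜 d) by
    obtain ⟨F, ⟨T, rfl⟩, hFM, h⟩ := this d
    exact ⟨T, fun x hx => hFM (Submodule.subset_span hx), h⟩
  intro d
  induction d using Nat.strong_induction_on with
  | _ d ih =>
    have hmap : ∀ d' < d, ∀ f : M →ₗ[k] M, (∀ x ∈ 𝓜 d', f x ∈ 𝓜 d) → (∀ x ∈ L d', f x ∈ L d) →
        Fin d ((𝓜 d').map f) := by
      intro d' hd' f hf hfL
      obtain ⟨F, hF, hFM, h⟩ := ih d' hd'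
      refine ⟨F.map f, hF.map f, Submodule.map_le_iff_le_comap.2 fun x hx => hf x (hFM hx), ?_⟩
      refine (Submodule.map_mono h).trans ?_
      rw [Submodule.map_sup]
      exact sup_le_sup_right (Submodule.map_le_iff_le_comap.2 fun x hx => hfL x hx) _
    have hQ : Fin d (Q d) := by
      refine hsup d _ (hsup d _ ⟨⊥, Submodule.fg_bot, bot_le, le_sup_left⟩ _
        ⟨_, ⟨G d, rfl⟩, Submodule.span_le.2 fun x hx => hG d x hx, le_sup_right⟩) _ ?_
      refine Finset.sup_induction (hbot d) (hsup d) fun d' hd' => ?_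
      have hd'' := Finset.mem_range.1 hd'
      refine hsup d _ ?_ _ (Finset.sup_induction (hbot d) (hsup d) fun i _ => ?_)
      · split_ifs with h
        · exact hmap d' hd'' β (fun x hx => mem_of_deg_eq (hMβ d' x hx) h)
            fun x hx => mem_of_deg_eq (hLβ d' x hx) h
        · exact hbot d
      · split_ifs with h
        · exact hmap d' hd'' (P i) (fun x hx => mem_of_deg_eq (hM i d' x hx) h)
            fun x hx => mem_of_deg_eq (hL i d' x hx) h
        · exact hbot d
    obtain ⟨F, hF, hFM, h⟩ := hQ
    exact ⟨F, hF, hFM, (hMQ d).trans h⟩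

end FiniteType

section Operations

open SteenrodAlgebra

variable (p : ℕ)

/-- The smallest positive degree that is even in the sense of `EvenDeg`: it is `1` if `p = 2` and
`2` otherwise. -/
def evenUnit : ℕ := if p = 2 then 1 else 2

theorem evenUnit_pos : 0 < evenUnit p := by unfold evenUnit; split_ifs <;> omega

theorem degP_eq (i : ℕ) : degP p i = i * (evenUnit p * (p - 1)) := by
  unfold degP evenUnit
  split_ifs with h
  · subst h; simp
  · ring

theorem evenDeg_evenUnit_mul (d : ℕ) : EvenDeg p (evenUnit p * d) := by
  unfold evenUnit EvenDeg
  split_ifs with h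
  · exact Or.inl h
  · exact Or.inr (even_two_mul d)

theorem exists_of_evenDeg {n : ℕ} (hn : EvenDeg p n) : ∃ d, n = evenUnit p * d := by
  unfold evenUnit
  split_ifs with h
  · exact ⟨n, (one_mul n).symm⟩
  · obtain ⟨d, hd⟩ := hn.resolve_left h
    exact ⟨d, by omega⟩

theorem exists_of_not_evenDeg {n : ℕ} (hn : ¬ EvenDeg p n) :
    1 < evenUnit p ∧ ∃ d, n = evenUnit p * d + 1 := by
  obtain ⟨h, d, hd⟩ := not_evenDeg hn
  simp only [evenUnit, if_neg h]
  exact ⟨one_lt_two, d, hd⟩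

theorem P_zero : P p 0 = 1 := by
  have := RingQuot.mkAlgHom_rel (ZMod p) (Rel.P_zero (p := p))
  rw [map_one] at this
  exact this

theorem bockstein_two (hp : p = 2) : bockstein p = P p 1 :=
  RingQuot.mkAlgHom_rel (ZMod p) (Rel.bockstein_two hp)

theorem bockstein_sq (hp : p ≠ 2) : bockstein p * bockstein p = 0 := by
  have := RingQuot.mkAlgHom_rel (ZMod p) (Rel.bockstein_sq hp)
  rw [map_mul, map_zero] at this
  exact this

theorem P_mul_P_two (hp : p = 2) (a b : ℕ) (ha : 0 < a) (hab : a < 2 * b) :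
    P p a * P p b = ∑ t ∈ Finset.range (a / 2 + 1),
      (((b - 1 - t).choose (a - 2 * t) : ℕ) : ZMod p) • (P p (a + b - t) * P p t) := by
  have := RingQuot.mkAlgHom_rel (ZMod p) (Rel.adem_two hp a b ha hab)
  simp only [map_sum, map_smul, map_mul] at this
  exact this

theorem P_mul_P_odd (hp : p ≠ 2) (a b : ℕ) (ha : 0 < a) (hab : a < p * b) :
    P p a * P p b = ∑ t ∈ Finset.range (a / p + 1),
      ((-1 : ZMod p) ^ (a + t) * (((p - 1) * (b - t) - 1).choose (a - p * t) : ℕ)) •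
        (P p (a + b - t) * P p t) := by
  have := RingQuot.mkAlgHom_rel (ZMod p) (Rel.adem_odd hp a b ha hab)
  simp only [map_sum, map_smul, map_mul] at this
  exact this

theorem P_mul_bockstein_mul_P (hp : p ≠ 2) (a b : ℕ) (ha : 0 < a) (hab : a ≤ p * b) :
    P p a * bockstein p * P p b =
      (∑ t ∈ Finset.range (a / p + 1),
        ((-1 : ZMod p) ^ (a + t) * (((p - 1) * (b - t)).choose (a - p * t) : ℕ)) •
          (bockstein p * P p (a + b - t) * P p t)) +
      ∑ t ∈ Finset.range ((a - 1) / p + 1),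
        ((-1 : ZMod p) ^ (a + t + 1) * (((p - 1) * (b - t) - 1).choose (a - p * t - 1) : ℕ)) •
          (P p (a + b - t) * bockstein p * P p t) := by
  have := RingQuot.mkAlgHom_rel (ZMod p) (Rel.adem_bockstein_odd hp a b ha hab)
  simp only [map_add, map_sum, map_smul, map_mul] at this
  exact this

variable (B : Type*) [Ring B] [Algebra (ZMod p) B] [Module (SteenrodAlgebra p) B]

/-- The operation `P^i` as a linear map. -/
def power (i : ℕ) : B →ₗ[ZMod p] B :=
  (DistribSMul.toAddMonoidHom B (P p i)).toZModLinearMap p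

/-- The Bockstein as a linear map. -/
def bock : B →ₗ[ZMod p] B := (DistribSMul.toAddMonoidHom B (bockstein p)).toZModLinearMap p

variable {p B}

theorem power_apply (i : ℕ) (x : B) : power p B i x = P p i • x := rfl

theorem bock_apply (x : B) : bock p B x = bockstein p • x := rfl

theorem power_zero (x : B) : power p B 0 x = x := by rw [power_apply, P_zero, one_smul]

theorem bock_bock (hp : p ≠ 2) (x : B) : bock p B (bock p B x) = 0 := by
  rw [bock_apply, bock_apply, ← mul_smul, bockstein_sq p hp, zero_smul]

theorem bock_eq_power (hp : p = 2) : bock p B = power p B 1 := by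
  ext x
  rw [bock_apply, power_apply, bockstein_two p hp]

variable [IsScalarTower (ZMod p) (SteenrodAlgebra p) B]

theorem sum_smul_P {ι : Type*} (T : Finset ι) (c : ι → ZMod p) (θ η : ι → SteenrodAlgebra p)
    (x : B) : (∑ t ∈ T, c t • (θ t * η t)) • x = ∑ t ∈ T, c t • (θ t • (η t • x)) := by
  rw [Finset.sum_smul]
  exact Finset.sum_congr rfl fun t _ => by rw [smul_assoc, mul_smul]

theorem neg_one_pow_add_mul_choose (hp : p ≠ 2) [Fact p.Prime] {a n : ℕ} (h : p ∣ a) :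
    (-1 : ZMod p) ^ (a + a / p) * ((n.choose (a - p * (a / p)) : ℕ) : ZMod p) = 1 := by
  obtain ⟨t, rfl⟩ := h
  have hpp : p.Prime := Fact.out
  rw [Nat.mul_div_cancel_left _ hpp.pos, Nat.sub_self, Nat.choose_zero_right, Nat.cast_one, mul_one]
  refine Even.neg_one_pow ?_
  have h1 : Even (p + 1) := (hpp.odd_of_ne_two hp).add_one
  have h2 : p * t + t = (p + 1) * t := by ring
  rw [h2]
  exact h1.mul_right t

theorem power_ademLike [Fact p.Prime] : AdemLike (p - 1) (power p B) := by
  have hpp : p.Prime := Fact.out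
  have h1 : p - 1 + 1 = p := Nat.sub_add_cancel hpp.one_le
  intro a b hab
  rw [h1] at hab ⊢
  rcases Nat.eq_zero_or_pos a with rfl | ha
  · exact ⟨fun _ => 1, fun x => by simp [power_zero], fun _ => rfl⟩
  by_cases hp : p = 2
  · refine ⟨fun t => ((b - 1 - t).choose (a - 2 * t) : ℕ), fun x => ?_, fun h => ?_⟩
    · rw [power_apply, power_apply, ← mul_smul,
        P_mul_P_two p hp a b ha (by rwa [hp] at hab), sum_smul_P]
      simp only [hp]
      rfl
    · obtain ⟨t, rfl⟩ := h
      have h2 : 2 * t / 2 = t := by omega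
      simp [hp, h2]
  · refine ⟨fun t => (-1 : ZMod p) ^ (a + t) * (((p - 1) * (b - t) - 1).choose (a - p * t) : ℕ),
      fun x => ?_, fun h => neg_one_pow_add_mul_choose hp h⟩
    rw [power_apply, power_apply, ← mul_smul, P_mul_P_odd p hp a b ha hab, sum_smul_P]
    rfl

theorem power_bocksteinAdemLike [Fact p.Prime] (hp : p ≠ 2) :
    BocksteinAdemLike (p - 1) (power p B) (bock p B) := by
  have hpp : p.Prime := Fact.out
  have h1 : p - 1 + 1 = p := Nat.sub_add_cancel hpp.one_le
  intro a b ha hab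
  rw [h1] at hab ⊢
  refine ⟨fun t => (-1 : ZMod p) ^ (a + t) * (((p - 1) * (b - t)).choose (a - p * t) : ℕ),
    fun t => (-1 : ZMod p) ^ (a + t + 1) * (((p - 1) * (b - t) - 1).choose (a - p * t - 1) : ℕ),
    fun x => ?_, fun h => neg_one_pow_add_mul_choose hp h⟩
  rw [power_apply, power_apply, bock_apply, ← mul_smul, ← mul_smul,
    P_mul_bockstein_mul_P p hp a b ha hab, add_smul, sum_smul_P, sum_smul_P]
  simp only [mul_smul]
  rfl

/-- A subspace that is stable under the generators of the Steenrod algebra is stable under all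
operations. -/
theorem smul_mem_of_power_mem {X : Submodule (ZMod p) B} (hP : ∀ i, ∀ x ∈ X, power p B i x ∈ X)
    (hβ : ∀ x ∈ X, bock p B x ∈ X) (θ : SteenrodAlgebra p) : ∀ x ∈ X, θ • x ∈ X := by
  obtain ⟨w, rfl⟩ := RingQuot.mkAlgHom_surjective (ZMod p) (Rel p) θ
  change ∀ x ∈ X, mk p w • x ∈ X
  induction w using FreeAlgebra.induction with
  | grade0 r =>
    intro x hx
    rw [AlgHom.commutes, algebraMap_smul]
    exact X.smul_mem r hx
  | grade1 g =>
    cases g with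
    | bockstein => exact hβ
    | P i => exact hP i
  | mul a b ha hb =>
    intro x hx
    rw [map_mul, mul_smul]
    exact ha _ (hb x hx)
  | add a b ha hb =>
    intro x hx
    rw [map_add, add_smul]
    exact add_mem (ha x hx) (hb x hx)

end Operations

/-! ### The module of indecomposables -/

section UnstableAlgebra

open SteenrodAlgebra DirectSum

variable {p : ℕ} {B : Type*} [Ring B] [Algebra (ZMod p) B]
  {𝒜 : ℕ → Submodule (ZMod p) B}

theorem decompose_map_mem [GradedAlgebra 𝒜] {f : B →ₗ[ZMod p] B} {t : ℕ}
    (hf : ∀ d, ∀ x ∈ 𝒜 d, f x ∈ 𝒜 (d + t))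
    {Q : ℕ → Submodule (ZMod p) B} {x : B}
    (h : ∀ d, f (decompose 𝒜 x d : B) ∈ Q (d + t)) (n : ℕ) : (decompose 𝒜 (f x) n : B) ∈ Q n := by
  classical
  have h1 : f x = ∑ d ∈ (decompose 𝒜 x).support, f (decompose 𝒜 x d : B) := by
    conv_lhs => rw [← sum_support_decompose 𝒜 x, map_sum]
  rw [h1, decompose_sum, DFinsupp.finsetSum_apply, AddSubmonoidClass.coe_finsetSum]
  refine sum_mem fun d _ => ?_
  have h2 := hf d _ (SetLike.coe_mem (decompose 𝒜 x d))
  rcases eq_or_ne (d + t) n with rfl | hne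
  · rw [decompose_of_mem_same 𝒜 h2]; exact h d
  · rw [decompose_of_mem_ne 𝒜 h2 hne]; exact zero_mem _

variable (𝒜) in
/-- The classes of degree `d` that are decomposable up to a constant. -/
def decomposables (ε : B →ₐ[ZMod p] ZMod p) (d : ℕ) : Submodule (ZMod p) B := 𝒜 d ⊓ (1 ⊔ fil ε 2)

theorem decomposables_le {ε : B →ₐ[ZMod p] ZMod p} : decomposables 𝒜 ε ≤ 𝒜 := fun _ => inf_le_left

variable [Module (SteenrodAlgebra p) B]

theorem power_mem (hB : IsUnstableAlgebra p 𝒜) {i d : ℕ} {x : B} (hx : x ∈ 𝒜 d) :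
    power p B i x ∈ 𝒜 (d + i * (evenUnit p * (p - 1))) := by
  rw [← degP_eq]; exact hB.P_mem i d x hx

theorem bock_mem (hB : IsUnstableAlgebra p 𝒜) {d : ℕ} {x : B} (hx : x ∈ 𝒜 d) :
    bock p B x ∈ 𝒜 (d + 1) :=
  hB.bockstein_mem d x hx

theorem power_eq_zero (hB : IsUnstableAlgebra p 𝒜) {i d δ : ℕ} (hδ : δ < evenUnit p) {x : B}
    (hx : x ∈ 𝒜 (evenUnit p * d + δ)) (hi : d < i) : power p B i x = 0 := by
  unfold evenUnit at hδ hx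
  split_ifs at hδ hx with h
  · exact hB.unstable_two h _ x hx i (by omega)
  · have := hB.unstable_odd h _ x hx 0 i (by omega) (by omega)
    rwa [pow_zero, one_mul] at this

theorem power_one [GradedAlgebra 𝒜] (hB : IsUnstableAlgebra p 𝒜) {i : ℕ} (hi : 0 < i) :
    power p B i 1 = 0 :=
  power_eq_zero hB (d := 0) (evenUnit_pos p) (by simpa using SetLike.GradedOne.one_mem) hi

theorem bock_one [GradedAlgebra 𝒜] (hB : IsUnstableAlgebra p 𝒜) : bock p B 1 = 0 := by
  have h1 : (1 : B) ∈ 𝒜 0 := SetLike.GradedOne.one_mem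
  by_cases hp : p = 2
  · rw [bock_eq_power hp]; exact power_one hB one_pos
  · have := hB.unstable_odd hp 0 1 h1 1 0 le_rfl (by omega)
    rwa [pow_one, P_zero, mul_one] at this

theorem power_mul (hB : IsUnstableAlgebra p 𝒜) (i : ℕ) (x y : B) :
    power p B i (x * y) = ∑ jk ∈ Finset.HasAntidiagonal.antidiagonal i,
      power p B jk.1 x * power p B jk.2 y := hB.cartan_P i x y

variable [GradedAlgebra 𝒜] {ε : B →ₐ[ZMod p] ZMod p}

theorem power_mem_fil [Fact p.Prime] (hB : IsUnstableAlgebra p 𝒜)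
    (hε : ∀ n : ℕ, 0 < n → ∀ x ∈ 𝒜 n, ε x = 0) (n : ℕ) :
    ∀ i, ∀ x ∈ fil ε n, power p B i x ∈ fil ε n := by
  induction n with
  | zero => exact fun _ _ _ => mem_fil_zero _
  | succ n ih =>
    intro i
    have h1 : ∀ i, ∀ x ∈ fil ε 1, power p B i x ∈ fil ε 1 := by
      intro i x hx
      rcases Nat.eq_zero_or_pos i with rfl | hi
      · rwa [power_zero]
      · suffices x ∈ (fil ε 1).comap (power p B i) from this
        refine homogeneous_induction (𝒜 := 𝒜) (fun d y hy => ?_) x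
        refine mem_fil_one.2 (hε _ ?_ _ (power_mem hB hy))
        have := Nat.mul_pos hi (Nat.mul_pos (evenUnit_pos p)
          (Nat.sub_pos_of_lt (Fact.out : p.Prime).one_lt))
        omega
    rw [fil_succ]
    suffices fil ε 1 * fil ε n ≤ (fil ε 1 * fil ε n).comap (power p B i) from this
    refine Submodule.mul_le.2 fun x hx y hy => ?_
    rw [Submodule.mem_comap, power_mul hB]
    exact sum_mem fun jk _ => Submodule.mul_mem_mul (h1 _ x hx) (ih _ y hy)

theorem bock_mem_fil (hB : IsUnstableAlgebra p 𝒜)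
    (hε : ∀ n : ℕ, 0 < n → ∀ x ∈ 𝒜 n, ε x = 0) (n : ℕ) :
    ∀ x ∈ fil ε n, bock p B x ∈ fil ε n := by
  classical
  induction n with
  | zero => exact fun _ _ => mem_fil_zero _
  | succ n ih =>
    have h1 : ∀ x, bock p B x ∈ fil ε 1 := by
      intro x
      suffices x ∈ (fil ε 1).comap (bock p B) from this
      refine homogeneous_induction (𝒜 := 𝒜) (fun d y hy => ?_) x
      exact mem_fil_one.2 (hε _ (Nat.succ_pos d) _ (bock_mem hB hy))
    rw [fil_succ]
    suffices fil ε 1 * fil ε n ≤ (fil ε 1 * fil ε n).comap (bock p B) from this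
    refine Submodule.mul_le.2 fun x hx y hy => ?_
    rw [← sum_support_decompose 𝒜 x, Finset.sum_mul]
    refine sum_mem fun d _ => ?_
    have hd := decompose_mem_fil hε (𝒜 := 𝒜) 1 x hx d
    rw [Submodule.mem_comap, bock_apply,
      hB.cartan_bockstein d _ (SetLike.coe_mem (decompose 𝒜 x d)), neg_one_pow_mul_eq_smul]
    refine add_mem (Submodule.mul_mem_mul (h1 _) hy) ?_
    rw [Units.smul_def]
    exact zsmul_mem (Submodule.mul_mem_mul hd (ih y hy)) _

theorem power_mem_one_sup_fil [Fact p.Prime] (hB : IsUnstableAlgebra p 𝒜)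
    (hε : ∀ n : ℕ, 0 < n → ∀ x ∈ 𝒜 n, ε x = 0) {n i : ℕ} {x : B}
    (hx : x ∈ (1 : Submodule (ZMod p) B) ⊔ fil ε n) :
    power p B i x ∈ (1 : Submodule (ZMod p) B) ⊔ fil ε n := by
  obtain ⟨c, hc, y, hy, rfl⟩ := Submodule.mem_sup.1 hx
  rw [map_add]
  refine add_mem ?_ (Submodule.mem_sup_right (power_mem_fil hB hε n i y hy))
  obtain ⟨c, rfl⟩ := Submodule.mem_one.1 hc
  rcases Nat.eq_zero_or_pos i with rfl | hi
  · rw [power_zero]; exact Submodule.mem_sup_left hc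
  · rw [Algebra.algebraMap_eq_smul_one, map_smul, power_one hB hi, smul_zero]
    exact zero_mem _

theorem decomposables_closed [Fact p.Prime] (hB : IsUnstableAlgebra p 𝒜)
    (hε : ∀ n : ℕ, 0 < n → ∀ x ∈ 𝒜 n, ε x = 0) :
    OpClosed (evenUnit p * (p - 1)) (power p B) (decomposables 𝒜 ε) := fun _ _ _ hx =>
  ⟨power_mem hB hx.1, power_mem_one_sup_fil hB hε hx.2⟩

theorem decomposables_bock (hB : IsUnstableAlgebra p 𝒜)
    (hε : ∀ n : ℕ, 0 < n → ∀ x ∈ 𝒜 n, ε x = 0) {d : ℕ} {x : B} (hx : x ∈ decomposables 𝒜 ε d) :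
    bock p B x ∈ decomposables 𝒜 ε (d + 1) := by
  refine ⟨bock_mem hB hx.1, ?_⟩
  obtain ⟨c, hc, y, hy, rfl⟩ := Submodule.mem_sup.1 hx.2
  obtain ⟨c, rfl⟩ := Submodule.mem_one.1 hc
  rw [map_add, Algebra.algebraMap_eq_smul_one, map_smul, bock_one hB, smul_zero, zero_add]
  exact Submodule.mem_sup_right (bock_mem_fil hB hε 2 y hy)

/-- The module of indecomposables of `B` is generated by algebra generators of `B`: the elements
whose components lie in `Q` form a stable subalgebra, as products of elements of positive degree
are decomposable. -/
theorem le_of_generators [Fact p.Prime]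
    [IsScalarTower (ZMod p) (SteenrodAlgebra p) B] (hB : IsUnstableAlgebra p 𝒜)
    (hε : ∀ n : ℕ, 0 < n → ∀ x ∈ 𝒜 n, ε x = 0)
    (hconn : 𝒜 0 = 1) {S : Finset B}
    (hS : ∀ C : Subalgebra (ZMod p) B, (∀ (θ : SteenrodAlgebra p), ∀ x ∈ C, θ • x ∈ C) →
      (S : Set B) ⊆ C → C = ⊤) {Q : ℕ → Submodule (ZMod p) B}
    (hQ : OpClosed (evenUnit p * (p - 1)) (power p B) Q)
    (hQβ : ∀ d, ∀ x ∈ Q d, bock p B x ∈ Q (d + 1)) (hL : decomposables 𝒜 ε ≤ Q)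
    (hSQ : ∀ x ∈ S, ∀ d, (decompose 𝒜 x d : B) ∈ Q d) : 𝒜 ≤ Q := by
  have hmul : ∀ i j x y, x ∈ 𝒜 i → y ∈ 𝒜 j → x ∈ Q i → y ∈ Q j → x * y ∈ Q (i + j) := by
    intro i j x y hx hy hxQ hyQ
    rcases Nat.eq_zero_or_pos i with rfl | hi
    · rw [hconn] at hx
      obtain ⟨c, rfl⟩ := Submodule.mem_one.1 hx
      rw [← Algebra.smul_def]
      exact mem_of_deg_eq ((Q j).smul_mem c hyQ) (Nat.zero_add j).symm
    rcases Nat.eq_zero_or_pos j with rfl | hj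
    · rw [hconn] at hy
      obtain ⟨c, rfl⟩ := Submodule.mem_one.1 hy
      rw [← Algebra.commutes, ← Algebra.smul_def]
      exact (Q i).smul_mem c hxQ
    · exact hL _ ⟨SetLike.GradedMul.mul_mem hx hy, Submodule.mem_sup_right <|
        mul_mem_fil (m := 1) (n := 1) (mem_fil_one.2 (hε i hi x hx))
          (mem_fil_one.2 (hε j hj y hy))⟩
  let X : Submodule (ZMod p) B := ⨅ d, (Q d).comap (GradedAlgebra.proj 𝒜 d)
  have hX : ∀ x, x ∈ X ↔ ∀ d, (decompose 𝒜 x d : B) ∈ Q d := by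
    intro x
    simp only [X, Submodule.mem_iInf, Submodule.mem_comap, GradedAlgebra.proj_apply]
  have hX1 : 1 ∈ X := by
    refine (hX 1).2 fun d => ?_
    have h1 : (1 : B) ∈ 𝒜 0 := SetLike.GradedOne.one_mem
    rcases eq_or_ne 0 d with rfl | hd
    · rw [decompose_of_mem_same 𝒜 h1]
      exact hL 0 ⟨h1, Submodule.mem_sup_left (Submodule.one_le.1 le_rfl)⟩
    · rw [decompose_of_mem_ne 𝒜 h1 hd]; exact zero_mem _
  let C : Subalgebra (ZMod p) B := X.toSubalgebra hX1 fun x y hx hy => by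
    rw [hX] at hx hy ⊢
    intro n
    refine decompose_mul_mem fun i j hij => ?_
    subst hij
    exact hmul i j _ _ (SetLike.coe_mem _) (SetLike.coe_mem _) (hx i) (hy j)
  have hC : C = ⊤ := by
    refine hS C (fun θ x hx => smul_mem_of_power_mem (X := X) (fun i y hy => ?_) (fun y hy => ?_)
      θ x hx) fun x hx => (hX x).2 (hSQ x hx)
    · rw [hX] at hy ⊢
      exact decompose_map_mem (𝒜 := 𝒜) (fun d z hz => power_mem hB hz) fun d => hQ i d _ (hy d)
    · rw [hX] at hy ⊢
      exact decompose_map_mem (𝒜 := 𝒜) (fun d z hz => bock_mem hB hz) fun d => hQβ d _ (hy d)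
  intro d x hx
  have hxX : x ∈ C := hC ▸ Algebra.mem_top
  have := (hX x).1 hxX d
  rwa [decompose_of_mem_same 𝒜 hx] at this

/-- The module of indecomposables of a finitely generated unstable algebra is finitely generated
over the reduced powers alone. -/
theorem exists_power_generators [Fact p.Prime]
    [IsScalarTower (ZMod p) (SteenrodAlgebra p) B] (hB : IsUnstableAlgebra p 𝒜)
    (hε : ∀ n : ℕ, 0 < n → ∀ x ∈ 𝒜 n, ε x = 0)
    (hconn : 𝒜 0 = 1)
    (hfg : ∃ S : Finset B, ∀ C : Subalgebra (ZMod p) B,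
      (∀ (θ : SteenrodAlgebra p), ∀ x ∈ C, θ • x ∈ C) → (S : Set B) ⊆ C → C = ⊤) :
    ∃ S : Finset (ℕ × B), (∀ x ∈ S, x.2 ∈ 𝒜 x.1) ∧
      (∀ Q, OpClosed (evenUnit p * (p - 1)) (power p B) Q → decomposables 𝒜 ε ≤ Q →
        (∀ x ∈ S, x.2 ∈ Q x.1) → 𝒜 ≤ Q) ∧
      ∀ d, ∃ F : Finset B, (∀ x ∈ F, x ∈ 𝒜 d) ∧
        𝒜 d ≤ decomposables 𝒜 ε d ⊔ Submodule.span (ZMod p) F := by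
  classical
  have hpp : p.Prime := Fact.out
  have hs : 1 ≤ p - 1 := Nat.le_sub_one_of_lt hpp.one_lt
  have hM : OpClosed (evenUnit p * (p - 1)) (power p B) 𝒜 := fun i d x hx => power_mem hB hx
  have hMβ : ∀ d, ∀ x ∈ 𝒜 d, bock p B x ∈ 𝒜 (d + 1) := fun d x hx => bock_mem hB hx
  have hL := decomposables_closed hB hε
  have hLβ : ∀ d, ∀ x ∈ decomposables 𝒜 ε d, bock p B x ∈ decomposables 𝒜 ε (d + 1) :=
    fun d x hx => decomposables_bock hB hε hx
  obtain ⟨S, hS⟩ := hfg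
  let T : Finset (ℕ × B) := S.biUnion fun x =>
    (decompose 𝒜 x).support.image fun d => (d, (decompose 𝒜 x d : B))
  have hT : ∀ x ∈ T, x.2 ∈ 𝒜 x.1 := by
    intro y hy
    obtain ⟨x, _, hx⟩ := Finset.mem_biUnion.1 hy
    obtain ⟨d, _, rfl⟩ := Finset.mem_image.1 hx
    exact SetLike.coe_mem _
  have hgen : ∀ Q, OpClosed (evenUnit p * (p - 1)) (power p B) Q →
      (∀ d, ∀ x ∈ Q d, bock p B x ∈ Q (d + 1)) → decomposables 𝒜 ε ≤ Q →
      (∀ x ∈ T, x.2 ∈ Q x.1) → 𝒜 ≤ Q := by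
    intro Q hQ hQβ hLQ hTQ
    refine le_of_generators hB hε hconn hS hQ hQβ hLQ fun x hx d => ?_
    by_cases hd : d ∈ (decompose 𝒜 x).support
    · exact hTQ (d, _) (Finset.mem_biUnion.2 ⟨x, hx, Finset.mem_image.2 ⟨d, hd, rfl⟩⟩)
    · rw [DFinsupp.notMem_support_iff.1 hd]; exact zero_mem _
  have hfin := exists_finset_span_of_generated (Nat.mul_pos (evenUnit_pos p) hs) power_zero hL hLβ
    hM hMβ decomposables_le hT hgen
  suffices ∃ S : Finset (ℕ × B), (∀ x ∈ S, x.2 ∈ 𝒜 x.1) ∧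
      ∀ Q, OpClosed (evenUnit p * (p - 1)) (power p B) Q → decomposables 𝒜 ε ≤ Q →
        (∀ x ∈ S, x.2 ∈ Q x.1) → 𝒜 ≤ Q by
    obtain ⟨S', h1, h2⟩ := this
    exact ⟨S', h1, h2, hfin⟩
  by_cases hp : p = 2
  · refine ⟨T, hT, fun Q hQ => hgen Q hQ fun d x hx => ?_⟩
    rw [bock_eq_power hp]
    exact mem_of_deg_eq (hQ 1 d x hx) (by simp [evenUnit, hp])
  · have he : evenUnit p = 2 := if_neg hp
    rw [he] at hL hM hgen ⊢
    let N := T.sup Prod.fst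
    refine exists_finset_reducedPower_generators hs power_zero power_ademLike
      (power_bocksteinAdemLike hp) (bock_bock hp) hM hMβ (N := N) (N + 1) 0 (Nat.zero_add _)
      (decomposables 𝒜 ε) hL hLβ decomposables_le ?_ hfin ?_
    · refine fun d i x hx => ⟨fun hd => ?_, fun hd => ?_⟩
      · have := hB.unstable_odd hp d x hx 0 i (by omega) (by omega)
        rw [pow_zero, one_mul] at this
        rw [power_apply, this]; exact zero_mem _
      · have := hB.unstable_odd hp d x hx 1 i (by omega) (by omega)
        rw [pow_one, mul_smul] at this
        rw [power_apply, bock_apply, this]; exact zero_mem _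
    · exact fun Q hQ hQβ hLQ hQN => hgen Q hQ hQβ hLQ fun x hx =>
        hQN x.1 (Finset.le_sup (f := Prod.fst) hx) (hT x hx)

/-- The Noetherian property of the module of indecomposables, in the degrees congruent to `δ`. -/
theorem chainCondition_decomposables [Fact p.Prime]
    [IsScalarTower (ZMod p) (SteenrodAlgebra p) B] (hB : IsUnstableAlgebra p 𝒜)
    (hε : ∀ n : ℕ, 0 < n → ∀ x ∈ 𝒜 n, ε x = 0)
    (hconn : 𝒜 0 = 1)
    (hfg : ∃ S : Finset B, ∀ C : Subalgebra (ZMod p) B,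
      (∀ (θ : SteenrodAlgebra p), ∀ x ∈ C, θ • x ∈ C) → (S : Set B) ⊆ C → C = ⊤)
    {δ : ℕ} (hδ : δ < evenUnit p) :
    ChainCondition (p - 1) (power p B) (fun d => decomposables 𝒜 ε (evenUnit p * d + δ))
      fun d => 𝒜 (evenUnit p * d + δ) := by
  classical
  have hs : 1 ≤ p - 1 := Nat.le_sub_one_of_lt (Fact.out : p.Prime).one_lt
  have hM : OpClosed (evenUnit p * (p - 1)) (power p B) 𝒜 := fun i d x hx => power_mem hB hx
  have hshift : ∀ Q : ℕ → Submodule (ZMod p) B, OpClosed (evenUnit p * (p - 1)) (power p B) Q →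
      OpClosed (p - 1) (power p B) fun d => Q (evenUnit p * d + δ) := fun Q hQ i d x hx =>
    mem_of_deg_eq (hQ i _ x hx) (by ring)
  obtain ⟨S, hS, hgen, hfin⟩ := exists_power_generators hB hε hconn hfg
  let N := S.sup Prod.fst
  refine chainCondition_of_generated hs power_zero power_ademLike (hshift _ hM) (N := N) (N + 1) 0
    (Nat.zero_add _) _ (hshift _ (decomposables_closed hB hε)) (fun d => decomposables_le _)
    ?_ ?_ ?_
  · intro d i x hx hd
    rw [power_eq_zero hB hδ hx (by omega)]
    exact zero_mem _
  · intro d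
    obtain ⟨F, _, hF⟩ := hfin (evenUnit p * d + δ)
    exact ⟨_, ⟨F, rfl⟩, hF⟩
  · intro Q hQ hLQ hQN
    -- extend `Q` by everything in the degrees that are not congruent to `δ`
    let Q' : ℕ → Submodule (ZMod p) B := fun d =>
      if d % evenUnit p = δ then Q (d / evenUnit p) else 𝒜 d
    have hdeg : ∀ d, (evenUnit p * d + δ) % evenUnit p = δ ∧
        (evenUnit p * d + δ) / evenUnit p = d := fun d =>
      ⟨by rw [Nat.mul_add_mod, Nat.mod_eq_of_lt hδ],
        by rw [Nat.mul_add_div (evenUnit_pos p), Nat.div_eq_of_lt hδ, add_zero]⟩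
    have hQ1 : ∀ d, Q' (evenUnit p * d + δ) = Q d := fun d => by
      simp only [Q', (hdeg d).1, (hdeg d).2, if_true]
    have hQ2 : ∀ n, n % evenUnit p ≠ δ → Q' n = 𝒜 n := fun n hn => if_neg hn
    have hn : ∀ n, n % evenUnit p = δ → ∃ d, n = evenUnit p * d + δ := fun n hn =>
      ⟨n / evenUnit p, by rw [← hn, Nat.div_add_mod]⟩
    have hle : 𝒜 ≤ Q' := by
      refine hgen Q' ?_ ?_ ?_
      · intro i n x hx
        by_cases h : n % evenUnit p = δ
        · obtain ⟨d, rfl⟩ := hn n h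
          rw [hQ1] at hx
          rw [show evenUnit p * d + δ + i * (evenUnit p * (p - 1)) =
            evenUnit p * (d + i * (p - 1)) + δ by ring, hQ1]
          exact hQ i d x hx
        · rw [hQ2 n h] at hx
          rw [hQ2]
          · exact hM i n x hx
          · rwa [show n + i * (evenUnit p * (p - 1)) = n + evenUnit p * (i * (p - 1)) by ring,
              Nat.add_mul_mod_self_left]
      · intro n x hx
        by_cases h : n % evenUnit p = δ
        · obtain ⟨d, rfl⟩ := hn n h
          rw [hQ1]
          exact hLQ d hx
        · rw [hQ2 n h]; exact decomposables_le _ hx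
      · intro x hx
        by_cases h : x.1 % evenUnit p = δ
        · obtain ⟨d, hd⟩ := hn _ h
          have h1 : x.1 ≤ N := Finset.le_sup (f := Prod.fst) hx
          have h2 : d ≤ evenUnit p * d := Nat.le_mul_of_pos_left d (evenUnit_pos p)
          have h3 := hS x hx
          rw [hd] at h3 ⊢
          rw [hQ1]
          exact hQN d (by omega) h3
        · rw [hQ2 _ h]; exact hS x hx
    intro d x hx
    have := hle _ hx
    rwa [hQ1] at this

end UnstableAlgebra

/-! ### Symbols and Steenrod operations -/

section Frobenius

open SteenrodAlgebra DirectSum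

theorem sum_pow_char_pow_of_commute {R ι : Type*} [Semiring R] (p : ℕ) [Fact p.Prime] [CharP R p]
    (j : ℕ) (T : Finset ι) (f : ι → R) (hf : ∀ a b, Commute (f a) (f b)) :
    (∑ a ∈ T, f a) ^ p ^ j = ∑ a ∈ T, f a ^ p ^ j := by
  classical
  induction T using Finset.induction_on with
  | empty => simp [(Fact.out : p.Prime).ne_zero]
  | insert a T ha ih =>
    rw [Finset.sum_insert ha, Finset.sum_insert ha,
      add_pow_char_pow_of_commute p j (Commute.sum_right _ _ _ fun b _ => hf a b), ih]

variable {p : ℕ} [Fact p.Prime] {B : Type*} [Ring B] [Algebra (ZMod p) B]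
  {𝒜 : ℕ → Submodule (ZMod p) B} [GradedAlgebra 𝒜]

/-- Powers `x ^ p ^ j` of even elements may be computed component by component. -/
theorem pow_eq_sum_decompose [CharP B p] (hc : GradedComm 𝒜) (j : ℕ) {x : B}
    (hx : x ∈ evenPart 𝒜) [DecidableEq B] [∀ n, DecidableEq (𝒜 n)] :
    x ^ p ^ j = ∑ n ∈ (decompose 𝒜 x).support, (decompose 𝒜 x n : B) ^ p ^ j := by
  conv_lhs => rw [← sum_support_decompose 𝒜 x]
  refine sum_pow_char_pow_of_commute p j _ _ fun a b => hc.commute ?_ _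
  by_cases ha : EvenDeg p a
  · exact mem_evenPart ha (SetLike.coe_mem _)
  · rw [decompose_eq_zero_of_mem_evenPart hx ha]; exact zero_mem _

theorem decompose_pow [CharP B p] (hc : GradedComm 𝒜) (j : ℕ) {x : B} (hx : x ∈ evenPart 𝒜)
    (n : ℕ) : (decompose 𝒜 (x ^ p ^ j) (p ^ j * n) : B) = (decompose 𝒜 x n : B) ^ p ^ j := by
  classical
  have hp : 0 < p ^ j := pow_pos (Fact.out : p.Prime).pos j
  have hmem : ∀ m, (decompose 𝒜 x m : B) ^ p ^ j ∈ 𝒜 (p ^ j * m) := fun m => by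
    have := SetLike.pow_mem_graded (p ^ j) (SetLike.coe_mem (decompose 𝒜 x m))
    rwa [smul_eq_mul] at this
  rw [pow_eq_sum_decompose hc j hx, decompose_sum, DFinsupp.finsetSum_apply,
    AddSubmonoidClass.coe_finsetSum, Finset.sum_eq_single n]
  · rw [decompose_of_mem_same 𝒜 (hmem n)]
  · intro m _ hm
    exact decompose_of_mem_ne 𝒜 (hmem m) fun h => hm (Nat.eq_of_mul_eq_mul_left hp h)
  · intro hn
    rw [DFinsupp.notMem_support_iff.1 hn, ZeroMemClass.coe_zero, zero_pow hp.ne', decompose_zero]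
    rfl

variable [Module (SteenrodAlgebra p) B]

/-- The total operation is multiplicative, so on even elements it commutes with `p ^ j`-th
powers. -/
theorem power_pow [CharP B p] (hB : IsUnstableAlgebra p 𝒜) (j : ℕ) {d i : ℕ} {x : B}
    (hx : x ∈ 𝒜 (evenUnit p * d)) :
    power p B (i * p ^ j) (x ^ p ^ j) = (power p B i x) ^ p ^ j := by
  classical
  have hp : 0 < p ^ j := pow_pos (Fact.out : p.Prime).pos j
  have hc : GradedComm 𝒜 := hB.mul_comm
  have hcentral : ∀ i b, Commute (power p B i x) b := fun i b => by
    refine hc.commute (mem_evenPart (n := evenUnit p * (d + i * (p - 1)))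
      (evenDeg_evenUnit_mul p _) ?_) b
    exact mem_of_deg_eq (power_mem hB hx) (by ring)
  have hzero : ∀ i, d < i → power p B i x = 0 := fun i hi =>
    power_eq_zero hB (evenUnit_pos p) (by rwa [add_zero]) hi
  -- the total operation on `x`, a polynomial with central coefficients by instability
  let f : Polynomial B := ∑ i ∈ Finset.range (d + 1), Polynomial.monomial i (power p B i x)
  have hf : ∀ i, f.coeff i = power p B i x := by
    intro i
    simp only [f, Polynomial.finsetSum_coeff, Polynomial.coeff_monomial,
      Finset.sum_ite_eq', Finset.mem_range]
    split_ifs with h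
    · rfl
    · exact (hzero i (by omega)).symm
  have hpow : ∀ m i, (f ^ m).coeff i = power p B i (x ^ m) := by
    intro m
    induction m with
    | zero =>
      intro i
      rw [pow_zero, pow_zero, Polynomial.coeff_one]
      split_ifs with h
      · rw [h, power_zero]
      · exact (power_one hB (Nat.pos_of_ne_zero h)).symm
    | succ m ih =>
      intro i
      rw [pow_succ, pow_succ, Polynomial.coeff_mul, power_mul hB]
      exact Finset.sum_congr rfl fun jk _ => by rw [ih, hf]
  have hfq : f ^ p ^ j = ∑ i ∈ Finset.range (d + 1),
      Polynomial.monomial (i * p ^ j) (power p B i x ^ p ^ j) := by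
    refine (sum_pow_char_pow_of_commute p j _ _ fun a b => ?_).trans ?_
    · change _ * _ = _ * _
      rw [Polynomial.monomial_mul_monomial, Polynomial.monomial_mul_monomial, add_comm,
        (hcentral a _).eq]
    · exact Finset.sum_congr rfl fun i _ => Polynomial.monomial_pow _ _ _
  rw [← hpow, hfq, Polynomial.finsetSum_coeff]
  simp only [Polynomial.coeff_monomial]
  rw [Finset.sum_eq_single i]
  · rw [if_pos rfl]
  · exact fun b _ hb => if_neg fun h => hb (Nat.eq_of_mul_eq_mul_right hp h)
  · intro hi
    rw [if_pos rfl, hzero i (by simpa using hi), zero_pow hp.ne']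

end Frobenius

section Symbols

open SteenrodAlgebra DirectSum

variable {p : ℕ} [Fact p.Prime] {B : Type*} [Ring B] [Algebra (ZMod p) B]
  {𝒜 : ℕ → Submodule (ZMod p) B} {ε : B →ₐ[ZMod p] ZMod p}

variable (𝒜 ε) in
/-- The classes of degree `evenUnit p * d + 1` that have a representative in `D` modulo
decomposables; this is of interest for odd `p`, where the degree is `2 * d + 1`. -/
def oddSymbols (D : Subalgebra (ZMod p) B) (d : ℕ) : Submodule (ZMod p) B :=
  𝒜 (evenUnit p * d + 1) ⊓ (Subalgebra.toSubmodule D ⊔ fil ε 2)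

variable {D : Subalgebra (ZMod p) B}

theorem decomposables_le_oddSymbols (d : ℕ) :
    decomposables 𝒜 ε (evenUnit p * d + 1) ≤ oddSymbols 𝒜 ε D d := by
  refine inf_le_inf_left _ (sup_le_sup_right ?_ _)
  rw [Submodule.one_le]
  exact D.one_mem

variable [GradedAlgebra 𝒜]

variable (ε) in
/-- The even classes, of degree `d` if `p = 2` and `2 * d` if `p` is odd, whose `p ^ j`-th power
has a representative in `D` modulo higher filtration. They form a subspace since Frobenius is
additive on even classes. -/
def evenSymbols (hc : GradedComm 𝒜) (D : Subalgebra (ZMod p) B) (j d : ℕ) :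
    Submodule (ZMod p) B where
  carrier := {x | x ∈ 𝒜 (evenUnit p * d) ∧
    x ^ p ^ j ∈ Subalgebra.toSubmodule D ⊔ fil ε (p ^ j + 1)}
  zero_mem' := ⟨zero_mem _, by
    rw [zero_pow (pow_ne_zero _ (Fact.out : p.Prime).ne_zero)]; exact zero_mem _⟩
  add_mem' {x y} hx hy := by
    have := charP_of_augmented ε
    refine ⟨add_mem hx.1 hy.1, ?_⟩
    rw [add_pow_char_pow_of_commute p j
      (hc.commute (mem_evenPart (evenDeg_evenUnit_mul p d) hx.1) y)]
    exact add_mem hx.2 hy.2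
  smul_mem' c x hx := by
    refine ⟨Submodule.smul_mem _ _ hx.1, ?_⟩
    rw [smul_pow]
    exact Submodule.smul_mem _ _ hx.2

/-- If `a ∈ D` represents `x ^ p ^ j` modulo higher filtration, then `a ^ p` represents
`x ^ p ^ (j + 1)`. -/
theorem evenSymbols_mono (hc : GradedComm 𝒜) (hε : ∀ n : ℕ, 0 < n → ∀ x ∈ 𝒜 n, ε x = 0)
    (hconn : 𝒜 0 = 1) : Monotone (evenSymbols ε hc D) := by
  refine monotone_nat_of_le_succ fun j d x hx => ⟨hx.1, ?_⟩
  rcases Nat.eq_zero_or_pos d with rfl | hd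
  · have h0 := hx.1
    rw [mul_zero, hconn] at h0
    obtain ⟨c, rfl⟩ := Submodule.mem_one.1 h0
    exact Submodule.mem_sup_left (D.pow_mem (D.algebraMap_mem c) _)
  · have hx1 : x ∈ fil ε 1 := mem_fil_one.2 (hε _ (Nat.mul_pos (evenUnit_pos p) hd) x hx.1)
    obtain ⟨a, ha, z, hz, haz⟩ := Submodule.mem_sup.1 hx.2
    have hxq : x ^ p ^ j ∈ fil ε (p ^ j) := by simpa using pow_mem_fil hx1 (p ^ j)
    have haq : a ∈ fil ε (p ^ j) := by
      rw [eq_sub_of_add_eq haz]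
      exact sub_mem hxq (fil_le (Nat.le_succ _) hz)
    have hsub : x ^ p ^ j - a ∈ fil ε (p ^ j + 1) := by
      rw [← haz, add_sub_cancel_left]; exact hz
    have h := pow_sub_pow_mem_fil hxq haq hsub p
    rw [← pow_mul, ← pow_succ, ← pow_succ'] at h
    rw [← add_sub_cancel (a ^ p) (x ^ p ^ (j + 1))]
    exact Submodule.add_mem_sup (D.pow_mem ha p) h

theorem decomposables_le_evenSymbols (hc : GradedComm 𝒜) (j d : ℕ) :
    decomposables 𝒜 ε (evenUnit p * d) ≤ evenSymbols ε hc D j d := by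
  have := charP_of_augmented ε
  rintro x ⟨hx, hx'⟩
  refine ⟨hx, ?_⟩
  obtain ⟨c, hc', y, hy, rfl⟩ := Submodule.mem_sup.1 hx'
  obtain ⟨c, rfl⟩ := Submodule.mem_one.1 hc'
  rw [add_pow_char_pow_of_commute p j (Algebra.commutes c y)]
  refine Submodule.add_mem_sup (D.pow_mem (D.algebraMap_mem c) _) (fil_le ?_ (pow_mem_fil hy _))
  have := pow_pos (Fact.out : p.Prime).pos j
  omega

variable [Module (SteenrodAlgebra p) B]

theorem power_mem_sup_fil (hB : IsUnstableAlgebra p 𝒜)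
    (hε : ∀ n : ℕ, 0 < n → ∀ x ∈ 𝒜 n, ε x = 0)
    (hD : ∀ (θ : SteenrodAlgebra p), ∀ x ∈ D, θ • x ∈ D) {n i : ℕ} {x : B}
    (hx : x ∈ Subalgebra.toSubmodule D ⊔ fil ε n) :
    power p B i x ∈ Subalgebra.toSubmodule D ⊔ fil ε n := by
  obtain ⟨a, ha, z, hz, rfl⟩ := Submodule.mem_sup.1 hx
  rw [map_add]
  exact Submodule.add_mem_sup (hD _ a ha) (power_mem_fil hB hε n i z hz)

theorem evenSymbols_closed (hB : IsUnstableAlgebra p 𝒜)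
    (hε : ∀ n : ℕ, 0 < n → ∀ x ∈ 𝒜 n, ε x = 0)
    (hD : ∀ (θ : SteenrodAlgebra p), ∀ x ∈ D, θ • x ∈ D) (j : ℕ) :
    OpClosed (p - 1) (power p B) (evenSymbols ε hB.mul_comm D j) := by
  have := charP_of_augmented ε
  refine fun i d x hx => ⟨mem_of_deg_eq (power_mem hB hx.1) (by ring), ?_⟩
  rw [← power_pow hB j hx.1]
  exact power_mem_sup_fil hB hε hD hx.2

theorem oddSymbols_closed (hB : IsUnstableAlgebra p 𝒜)
    (hε : ∀ n : ℕ, 0 < n → ∀ x ∈ 𝒜 n, ε x = 0)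
    (hD : ∀ (θ : SteenrodAlgebra p), ∀ x ∈ D, θ • x ∈ D) :
    OpClosed (p - 1) (power p B) (oddSymbols 𝒜 ε D) := fun _ _ _ hx =>
  ⟨mem_of_deg_eq (power_mem hB hx.1) (by ring), power_mem_sup_fil hB hε hD hx.2⟩

/-- Finitely many representatives of even symbols of level `j` suffice. -/
theorem exists_finset_evenSymbols [IsScalarTower (ZMod p) (SteenrodAlgebra p) B]
    (hB : IsFGUnstableAlgebra p 𝒜) (hε : ∀ n : ℕ, 0 < n → ∀ x ∈ 𝒜 n, ε x = 0) (hconn : 𝒜 0 = 1)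
    (hD : ∀ (θ : SteenrodAlgebra p), ∀ x ∈ D, θ • x ∈ D) (j : ℕ) :
    ∃ S : Finset B, (∀ a ∈ S, a ∈ D) ∧ ∀ C : Subalgebra (ZMod p) B,
      (∀ (θ : SteenrodAlgebra p), ∀ x ∈ C, θ • x ∈ C) → (∀ a ∈ S, a ∈ C) →
      evenSymbols ε hB.mul_comm D j ≤ evenSymbols ε hB.mul_comm C j := by
  classical
  have hB' := hB.toIsUnstableAlgebra
  obtain ⟨S, hS, hgen⟩ := (chainCondition_decomposables hB' hε hconn hB.fg
    (evenUnit_pos p)).exists_finset (evenSymbols_closed hB' hε hD j)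
      (fun d => decomposables_le_evenSymbols _ j d) fun d x hx => hx.1
  have hrep : ∀ x : ℕ × B, ∃ a ∈ D, x ∈ S → x.2 ^ p ^ j - a ∈ fil ε (p ^ j + 1) := by
    intro x
    by_cases hx : x ∈ S
    · obtain ⟨a, ha, z, hz, haz⟩ := Submodule.mem_sup.1 (hS x hx).2
      exact ⟨a, ha, fun _ => by rw [← haz, add_sub_cancel_left]; exact hz⟩
    · exact ⟨0, zero_mem _, fun h => absurd h hx⟩
  choose r hrD hr using hrep
  refine ⟨S.image r, fun a ha => ?_, fun C hC hSC => ?_⟩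
  · obtain ⟨x, _, rfl⟩ := Finset.mem_image.1 ha
    exact hrD x
  · refine hgen _ (evenSymbols_closed hB' hε hC j)
      (fun d => decomposables_le_evenSymbols _ j d) fun x hx => ⟨(hS x hx).1, ?_⟩
    rw [← add_sub_cancel (r x) (x.2 ^ p ^ j)]
    exact Submodule.add_mem_sup (hSC _ (Finset.mem_image_of_mem r hx)) (hr x hx)

/-- Finitely many representatives of odd symbols suffice. -/
theorem exists_finset_oddSymbols [IsScalarTower (ZMod p) (SteenrodAlgebra p) B]
    (hB : IsFGUnstableAlgebra p 𝒜) (hε : ∀ n : ℕ, 0 < n → ∀ x ∈ 𝒜 n, ε x = 0) (hconn : 𝒜 0 = 1)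
    (hD : ∀ (θ : SteenrodAlgebra p), ∀ x ∈ D, θ • x ∈ D) (hp : 1 < evenUnit p) :
    ∃ S : Finset B, (∀ a ∈ S, a ∈ D) ∧ ∀ C : Subalgebra (ZMod p) B,
      (∀ (θ : SteenrodAlgebra p), ∀ x ∈ C, θ • x ∈ C) → (∀ a ∈ S, a ∈ C) →
      oddSymbols 𝒜 ε D ≤ oddSymbols 𝒜 ε C := by
  classical
  have hB' := hB.toIsUnstableAlgebra
  obtain ⟨S, hS, hgen⟩ := (chainCondition_decomposables hB' hε hconn hB.fg
    hp).exists_finset (oddSymbols_closed hB' hε hD)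
      (fun d => decomposables_le_oddSymbols d) fun d x hx => hx.1
  have hrep : ∀ x : ℕ × B, ∃ a ∈ D, x ∈ S → x.2 - a ∈ fil ε 2 := by
    intro x
    by_cases hx : x ∈ S
    · obtain ⟨a, ha, z, hz, haz⟩ := Submodule.mem_sup.1 (hS x hx).2
      exact ⟨a, ha, fun _ => by rw [← haz, add_sub_cancel_left]; exact hz⟩
    · exact ⟨0, zero_mem _, fun h => absurd h hx⟩
  choose r hrD hr using hrep
  refine ⟨S.image r, fun a ha => ?_, fun C hC hSC => ?_⟩
  · obtain ⟨x, _, rfl⟩ := Finset.mem_image.1 ha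
    exact hrD x
  · refine hgen _ (oddSymbols_closed hB' hε hC)
      (fun d => decomposables_le_oddSymbols d) fun x hx => ⟨(hS x hx).1, ?_⟩
    rw [← add_sub_cancel (r x) x.2]
    exact Submodule.add_mem_sup (hSC _ (Finset.mem_image_of_mem r hx)) (hr x hx)

/-- Finitely many representatives control all symbols: the even symbols form an ascending chain in
the level `j`, which stabilises. -/
theorem exists_finset_symbols [IsScalarTower (ZMod p) (SteenrodAlgebra p) B]
    (hB : IsFGUnstableAlgebra p 𝒜) (hε : ∀ n : ℕ, 0 < n → ∀ x ∈ 𝒜 n, ε x = 0) (hconn : 𝒜 0 = 1)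
    (hD : ∀ (θ : SteenrodAlgebra p), ∀ x ∈ D, θ • x ∈ D) :
    ∃ S : Finset B, (∀ a ∈ S, a ∈ D) ∧ ∀ C : Subalgebra (ZMod p) B,
      (∀ (θ : SteenrodAlgebra p), ∀ x ∈ C, θ • x ∈ C) → (∀ a ∈ S, a ∈ C) →
      (∀ j, evenSymbols ε hB.mul_comm D j ≤ evenSymbols ε hB.mul_comm C j) ∧
        (1 < evenUnit p → oddSymbols 𝒜 ε D ≤ oddSymbols 𝒜 ε C) := by
  classical
  have hB' := hB.toIsUnstableAlgebra
  have hmono := fun C : Subalgebra (ZMod p) B => evenSymbols_mono (D := C) hB.mul_comm hε hconn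
  obtain ⟨s, hs⟩ := chainCondition_decomposables hB' hε hconn hB.fg (evenUnit_pos p)
    (evenSymbols ε hB.mul_comm D) (evenSymbols_closed hB' hε hD)
    (fun j d => decomposables_le_evenSymbols _ j d) (fun j d x hx => hx.1) (hmono D)
  choose S hSD hS using exists_finset_evenSymbols hB hε hconn hD
  have hodd : ∃ T : Finset B, (∀ a ∈ T, a ∈ D) ∧ ∀ C : Subalgebra (ZMod p) B,
      (∀ (θ : SteenrodAlgebra p), ∀ x ∈ C, θ • x ∈ C) → (∀ a ∈ T, a ∈ C) →
      1 < evenUnit p → oddSymbols 𝒜 ε D ≤ oddSymbols 𝒜 ε C := by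
    by_cases hp : 1 < evenUnit p
    · obtain ⟨T, hTD, hT⟩ := exists_finset_oddSymbols hB hε hconn hD hp
      exact ⟨T, hTD, fun C hC hTC _ => hT C hC hTC⟩
    · exact ⟨∅, by simp, fun C _ _ h => absurd h hp⟩
  obtain ⟨T, hTD, hT⟩ := hodd
  refine ⟨(Finset.range (s + 1)).biUnion S ∪ T, fun a ha => ?_, fun C hC hSC => ⟨?_, ?_⟩⟩
  · rcases Finset.mem_union.1 ha with h | h
    · obtain ⟨j, _, hj⟩ := Finset.mem_biUnion.1 h
      exact hSD j a hj
    · exact hTD a h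
  · have hle : ∀ j ≤ s, evenSymbols ε hB.mul_comm D j ≤ evenSymbols ε hB.mul_comm C j :=
      fun j hj => hS j C hC fun a ha => hSC a <| Finset.mem_union_left _ <|
        Finset.mem_biUnion.2 ⟨j, Finset.mem_range.2 (by omega), ha⟩
    intro j
    rcases le_total j s with hj | hj
    · exact hle j hj
    · rw [hs j hj]
      exact (hle s le_rfl).trans (hmono C hj)
  · exact hT C hC fun a ha => hSC a (Finset.mem_union_right _ ha)

end Symbols

/-! ### Conclusion -/

section Conclusion

open SteenrodAlgebra DirectSum

variable {p : ℕ} {B : Type*} [Ring B] [Algebra (ZMod p) B]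
  {𝒜 : ℕ → Submodule (ZMod p) B} [GradedAlgebra 𝒜]

variable (𝒜) in
/-- The largest homogeneous subalgebra of `D`. -/
def homogeneousCore (D : Subalgebra (ZMod p) B) : Subalgebra (ZMod p) B :=
  (⨅ n, (Subalgebra.toSubmodule D).comap (GradedAlgebra.proj 𝒜 n)).toSubalgebra
    (by
      refine (Submodule.mem_iInf _).2 fun n => ?_
      rw [Submodule.mem_comap, GradedAlgebra.proj_apply]
      have h1 : (1 : B) ∈ 𝒜 0 := SetLike.GradedOne.one_mem
      rcases eq_or_ne 0 n with rfl | hn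
      · rw [decompose_of_mem_same 𝒜 h1]; exact D.one_mem
      · rw [decompose_of_mem_ne 𝒜 h1 hn]; exact zero_mem _)
    (by
      intro x y hx hy
      simp only [Submodule.mem_iInf, Submodule.mem_comap, GradedAlgebra.proj_apply] at hx hy ⊢
      exact fun n => decompose_mul_mem fun i j _ => D.mul_mem (hx i) (hy j))

theorem mem_homogeneousCore {D : Subalgebra (ZMod p) B} {x : B} :
    x ∈ homogeneousCore 𝒜 D ↔ ∀ n, (decompose 𝒜 x n : B) ∈ D := by
  unfold homogeneousCore
  rw [Submodule.mem_toSubalgebra]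
  simp only [Submodule.mem_iInf, Submodule.mem_comap, GradedAlgebra.proj_apply,
    Subalgebra.mem_toSubmodule]

theorem homogeneousCore_le [Fact p.Prime] (D : Subalgebra (ZMod p) B) :
    homogeneousCore 𝒜 D ≤ D := fun _ hx =>
  mem_of_forall_decompose_mem (𝒜 := 𝒜) (K := Subalgebra.toSubmodule D) (mem_homogeneousCore.1 hx)

theorem decompose_mem_homogeneousCore {D : Subalgebra (ZMod p) B} {x : B}
    (hx : ∀ n, (decompose 𝒜 x n : B) ∈ D) (n : ℕ) :
    (decompose 𝒜 x n : B) ∈ homogeneousCore 𝒜 D := by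
  refine mem_homogeneousCore.2 fun m => ?_
  rcases eq_or_ne n m with rfl | h
  · rw [decompose_of_mem_same 𝒜 (SetLike.coe_mem _)]; exact hx n
  · rw [decompose_of_mem_ne 𝒜 (SetLike.coe_mem _) h]; exact zero_mem _

/-- `le_of_symbols` in terms of homogeneous symbols. -/
theorem le_of_symbols_le [Fact p.Prime] (hc : GradedComm 𝒜) (hconn : 𝒜 0 = 1)
    (H : GradedHopfAlgebra p 𝒜) {A C : Subalgebra (ZMod p) B} (hA : H.IsHopfSubalgebra A)
    (hAh : ∀ x ∈ A, ∀ n, (decompose 𝒜 x n : B) ∈ A) (hCA : C ≤ A)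
    (hCh : ∀ x ∈ C, ∀ n, (decompose 𝒜 x n : B) ∈ C)
    (heven : ∀ j, evenSymbols H.counit hc A j ≤ evenSymbols H.counit hc C j)
    (hodd : 1 < evenUnit p → oddSymbols 𝒜 H.counit A ≤ oddSymbols 𝒜 H.counit C) : A ≤ C := by
  classical
  have := charP_of_augmented H.counit
  have hfil := decompose_mem_fil H.counit_of_pos (𝒜 := 𝒜)
  refine le_of_symbols H hc hconn hA hAh hCA hCh (fun x hx hxA => ?_) fun j x hx _ hxA => ?_
  · refine mem_of_forall_decompose_mem (𝒜 := 𝒜) fun n => ?_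
    have hn := decompose_mem_sup (𝒜 := 𝒜) (K := Subalgebra.toSubmodule A) hAh (hfil 2) x hxA n
    by_cases h : EvenDeg p n
    · rw [decompose_eq_zero_of_mem_oddPart hx h]; exact zero_mem _
    · obtain ⟨hp, d, hd⟩ := exists_of_not_evenDeg p h
      have hmem := SetLike.coe_mem (decompose 𝒜 x n)
      exact (hodd hp d ⟨mem_of_deg_eq hmem hd, hn⟩).2
  · have hpow : ∀ n, (decompose 𝒜 x n : B) ^ p ^ j ∈
        Subalgebra.toSubmodule C ⊔ fil H.counit (p ^ j + 1) := by
      intro n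
      have hn := decompose_mem_sup (𝒜 := 𝒜) (K := Subalgebra.toSubmodule A) hAh
        (hfil (p ^ j + 1)) _ hxA (p ^ j * n)
      rw [decompose_pow hc j hx] at hn
      by_cases h : EvenDeg p n
      · obtain ⟨d, hd⟩ := exists_of_evenDeg p h
        have hmem := SetLike.coe_mem (decompose 𝒜 x n)
        exact (heven j d ⟨mem_of_deg_eq hmem hd, hn⟩).2
      · rw [decompose_eq_zero_of_mem_evenPart hx h,
          zero_pow (pow_ne_zero _ (Fact.out : p.Prime).ne_zero)]
        exact zero_mem _
    rw [pow_eq_sum_decompose hc j hx]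
    exact sum_mem fun n _ => hpow n

variable [Module (SteenrodAlgebra p) B]

theorem homogeneousCore_stable [IsScalarTower (ZMod p) (SteenrodAlgebra p) B]
    (hB : IsUnstableAlgebra p 𝒜) {D : Subalgebra (ZMod p) B}
    (hD : ∀ (θ : SteenrodAlgebra p), ∀ x ∈ D, θ • x ∈ D) (θ : SteenrodAlgebra p) :
    ∀ x ∈ homogeneousCore 𝒜 D, θ • x ∈ homogeneousCore 𝒜 D := by
  refine smul_mem_of_power_mem (X := Subalgebra.toSubmodule (homogeneousCore 𝒜 D))
    (fun i x hx => ?_) (fun x hx => ?_) θ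
  · exact mem_homogeneousCore.2 <| decompose_map_mem (𝒜 := 𝒜)
      (Q := fun _ => Subalgebra.toSubmodule D) (fun d y hy => power_mem hB hy)
      fun d => hD _ _ (mem_homogeneousCore.1 hx d)
  · exact mem_homogeneousCore.2 <| decompose_map_mem (𝒜 := 𝒜)
      (Q := fun _ => Subalgebra.toSubmodule D) (fun d y hy => bock_mem hB hy)
      fun d => hD _ _ (mem_homogeneousCore.1 hx d)

theorem isUnstableAlgebra_grading (hB : IsUnstableAlgebra p 𝒜) (A : UnstableSubalgebra p 𝒜) :
    IsUnstableAlgebra p A.grading where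
  mul_comm m n x hx y hy := Subtype.ext (by simpa using hB.mul_comm m n x hx y hy)
  P_mem i n x hx := hB.P_mem i n x hx
  bockstein_mem n x hx := hB.bockstein_mem n x hx
  cartan_P i x y := Subtype.ext (by simpa using hB.cartan_P i x y)
  cartan_bockstein n x hx y := Subtype.ext (by simpa using hB.cartan_bockstein n x hx y)
  unstable_two hp n x hx i hi := Subtype.ext (hB.unstable_two hp n x hx i hi)
  unstable_odd hp n x hx e i he hi := Subtype.ext (hB.unstable_odd hp n x hx e i he hi)
  top_two hp n x hx := Subtype.ext (hB.top_two hp n x hx)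
  top_odd hp k x hx := Subtype.ext (hB.top_odd hp k x hx)

end Conclusion

end SteenrodFG

open SteenrodFG

theorem theorem2p5 (p : ℕ) [Fact p.Prime] {B : Type*} [Ring B] [Algebra (ZMod p) B]
    (𝒜 : ℕ → Submodule (ZMod p) B) [GradedAlgebra 𝒜]
    [Module (SteenrodAlgebra p) B] [IsScalarTower (ZMod p) (SteenrodAlgebra p) B]
    (hconn : 𝒜 0 = 1) (H : GradedHopfAlgebra p 𝒜) (hB : IsFGUnstableAlgebra p 𝒜)
    (A : UnstableSubalgebra p 𝒜) (hA : H.IsHopfSubalgebra A.toSubalgebra) :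
    IsFGUnstableAlgebra p A.grading := by
  classical
  have hB' := hB.toIsUnstableAlgebra
  refine { isUnstableAlgebra_grading hB' A with fg := ?_ }
  have hAh : ∀ x ∈ A.toSubalgebra, ∀ n, (DirectSum.decompose 𝒜 x n : B) ∈ A.toSubalgebra :=
    fun x hx n => A.homogeneous' n x hx
  obtain ⟨S, hSA, hS⟩ := exists_finset_symbols hB H.counit_of_pos hconn
    (D := A.toSubalgebra) A.steenrod_mem'
  -- the homogeneous components of the representatives
  let T : Finset B := S.biUnion fun a =>
    (DirectSum.decompose 𝒜 a).support.image fun n => (DirectSum.decompose 𝒜 a n : B)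
  refine ⟨T.subtype (· ∈ A.toSubalgebra), fun C' hC' hTC => ?_⟩
  let D : Subalgebra (ZMod p) B := C'.map A.toSubalgebra.val
  have hDA : D ≤ A.toSubalgebra := by
    rintro _ ⟨y, _, rfl⟩
    exact y.2
  have hD : ∀ (θ : SteenrodAlgebra p), ∀ x ∈ D, θ • x ∈ D := by
    rintro θ _ ⟨y, hy, rfl⟩
    exact ⟨θ • y, hC' θ y hy, rfl⟩
  have hSD : ∀ a ∈ S, a ∈ homogeneousCore 𝒜 D := by
    refine fun a ha => mem_homogeneousCore.2 fun n => ?_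
    by_cases hn : n ∈ (DirectSum.decompose 𝒜 a).support
    · refine ⟨⟨_, hAh a (hSA a ha) n⟩, hTC (Finset.mem_coe.2 (Finset.mem_subtype.2 ?_)), rfl⟩
      exact Finset.mem_biUnion.2 ⟨a, ha, Finset.mem_image.2 ⟨n, hn, rfl⟩⟩
    · rw [DFinsupp.notMem_support_iff.1 hn]; exact zero_mem _
  obtain ⟨heven, hodd⟩ := hS _ (homogeneousCore_stable hB' hD) hSD
  have hle := le_of_symbols_le hB.mul_comm hconn H hA hAh
    ((homogeneousCore_le (𝒜 := 𝒜) D).trans hDA)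
    (fun x hx => decompose_mem_homogeneousCore (mem_homogeneousCore.1 hx)) heven hodd
  refine eq_top_iff.2 fun x _ => ?_
  obtain ⟨y, hy, hyx⟩ := homogeneousCore_le D (hle x.2)
  rwa [← show y = x from Subtype.ext hyx]
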